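/- **Setting.** For $f:\{0,1\}^n\to\{0,1\}$ with $f^{-1}(1)\neq\emptyset$ write $N=|f^{-1}(1)|$; $f$ is unate if in each direction $i\in[n]$ it is non-decreasing or non-increasing. Let $\mathrm{reldist}(f,g)=|f^{-1}(1)\,\triangle\, g^{-1}(1)|/|f^{-1}(1)|$ and $\mathrm{reldist}(f,\mathsf{Unate})=\min_{g\text{ unate}}\mathrm{reldist}(f,g)$. An algorithm has access to $\mathrm{MQ}(f)$ (query $f(x)$ at a point $x$) and to $\mathrm{SAMP}(f)$ (returns a uniformly random point of $f^{-1}(1)$); each call to either oracle counts as one query. Logarithms are to base 2, $\lambda:=\lceil\log(1/\delta)\rceil$, and $x^{(i)}$ is $x$ with bit $i$ flipped. For $x,y\in\{0,1,*\}^n$, $x\Delta y$ is the set of coordinates where both differ from $*$ and $x_i\ne y_i$, and $\Delta(x,y)=|x\Delta y|$; $\mathsf{Unfixed}(d)=\{i:d_i=*\}$. "Reject" and "accept" halt the whole algorithm. A block that begins by drawing a coordinate from a set is skipped if that set is empty. **Subroutines.** * *ConfirmDirection*$(i,b)$: repeat 25 times: draw $z$ from $\mathrm{SAMP}(f)$;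 return Yes if $z_i=b$ and $f(z^{(i)})=0$. Otherwise return No. * *CheckSamples*$(a,S,\delta')$: let $z\in S$ maximize $\Delta(a,z)$. Repeat $\lceil\log(1/\delta')\rceil$ times: draw $i\in a\Delta z$ uniformly; reject if $f(a^{(i)})=f(z^{(i)})=0$. * *IterativeBias*$(a,\delta)$: let $L=\max(1,\lceil 10\log n\rceil)$ (with $\log 0:=0$). For $\ell=1,2,4,8,\dots,L$ (the powers of two below $L$, then $L$): draw lists $S,T$ of $4000(2\ell+\lambda)$ samples each, let $p_i,p_i'$ be the fractions of points with $i$-th bit $1$ in $S$ and $T$, and run CheckSamples$(a,S\cup T,\delta/(48\ell))$; if $|p_i-p_i'|\le 1/20$ for all $i$, leave the loop; otherwise, if $\ell=L$, accept. After leaving the loop let $\tilde d_i=1$ if $p_i>3/4$, $\tilde d_i=0$ if $p_i<1/4$, and $\tilde d_i=*$ otherwise. Repeat $4000\lambda$ times: draw $i\in\mathsf{Unfixed}(\tilde d)$ uniformly and two samples $x,y$; reject if $x_i\ne y_i$ and $f(x^{(i)})=f(y^{(i)})=0$. Return $\tilde d$. * *Preprocessing*$(\tilde d,\varepsilon,\delta)$: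 draw $30\lceil1/\varepsilon\rceil$ samples, let $z$ be one that maximizes $\Delta(z,\tilde d)$, let $M$ be this maximum, and let $T$ be the set of all $y$ that arise from $z$ by changing some of the coordinates in $z\Delta\tilde d$. Repeat $10\lambda$ times: draw $j\in z\Delta\tilde d$ uniformly; if $f(z^{(j)})=0$, run ConfirmDirection$(j,\tilde d_j)$ and reject if it returns Yes. Then draw $5\lambda$ uniform points of $T$ and query them; if all have value $1$, return $M$. Otherwise let $y$ be the first with $f(y)=0$; by binary search between $z$ and $y$ find $i\in z\Delta y$ and $u$ with $u_i\neq\tilde d_i$, $f(u)=1$, $f(u^{(i)})=0$. Repeat $5\lambda$ times: run ConfirmDirection$(i,\tilde d_i)$ and reject if it returns Yes. Return $M$. * *BiasedTest*$(M,\varepsilon',\tilde d)$: repeat $10\lceil M/\varepsilon'\rceil$ times: draw a sample $z$, then $i\in z\Delta\tilde d$ uniformly; if $f(z^{(i)})=0$, run ConfirmDirection$(i,\tilde d_i)$ and reject if it returns Yes. * *UnbiasedTest*$(\varepsilon',\tilde d)$: let $m=|\mathsf{Unfixed}(\tilde d)|$; return if $m=0$. For $r=1,\dots,\lceil\log(m/\varepsilon')\rceil+2$,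 repeat $\lceil 50m/(\varepsilon'2^r)\rceil$ times: draw $i\in\mathsf{Unfixed}(\tilde d)$ uniformly, draw $3\cdot2^r$ samples $z$ and query $f(z^{(i)})$ for each; reject if there are two of these samples $x,y$ with $x_i=0$, $y_i=1$ and $f(x^{(i)})=f(y^{(i)})=0$. **Algorithm Unateness-Tester-Unknown-$N$** (input $n,\varepsilon,\delta$ and the two oracles, but not $N$): draw a sample $a$ and a list $S$ of $100\lambda$ samples; run CheckSamples$(a,S,\delta/12)$; let $\tilde d$ be the result of IterativeBias$(a,\delta)$ and $M$ the result of Preprocessing$(\tilde d,\varepsilon,\delta)$; run BiasedTest$(M,\varepsilon/64,\tilde d)$ and UnbiasedTest$(\varepsilon/64,\tilde d)$; accept. **Theorem.** There are absolute constants $C,c$ such that for all $n$, all $\varepsilon\in(0,1]$, all $\delta\in(0,1)$ and all $f:\{0,1\}^n\to\{0,1\}$ with $N=|f^{-1}(1)|\ge1$, the adaptive algorithm Unateness-Tester-Unknown-$N$ run on $f$ satisfies the following. 1. With probability at least $1-\delta$ it makes at most $C\,T\,(\log(T+2))^c$ queries in total, where $T=\frac{1+\log N}{\varepsilon}+\log(1/\delta)$;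 that is, $\tilde O\big(\frac{\log N}{\varepsilon}+\log(1/\delta)\big)$ queries when $N\ge2$. 2. If $f$ is unate, it accepts with probability $1$ (one-sided error). 3. If $\mathrm{reldist}(f,\mathsf{Unate})\ge\varepsilon$, it rejects with probability at least $2/3$. -/

import Mathlib

namespace RelUnate

/-! ### Strings, partial strings, unateness, relative distance -/

/-- Points of the hypercube `{0,1}^n`. -/
abbrev Cube (n : ℕ) := Fin n → Bool

/-- Partial strings in `{0,1,*}^n`; `none` is the symbol `*`. -/
abbrev PStr (n : ℕ) := Fin n → Option Bool

/-- A point of the hypercube, regarded as a partial string without `*`. -/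
def toPStr {n : ℕ} (x : Cube n) : PStr n := fun i => some (x i)

/-- `x^{(i)}`: the point `x` with its `i`-th bit flipped. -/
def flipAt {n : ℕ} (x : Cube n) (i : Fin n) : Cube n := Function.update x i (!(x i))

/-- The set of coordinates of `d` that are not `*`. -/
def fixedCoords {n : ℕ} (d : PStr n) : Finset (Fin n) :=
  Finset.univ.filter fun i => d i ≠ none

/-- The set of coordinates of `d` that are `*`. -/
def unfixedCoords {n : ℕ} (d : PStr n) : Finset (Fin n) :=
  Finset.univ.filter fun i => d i = none

/-- The symmetric difference `x Δ y` of two partial strings: the coordinates that are fixed in both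
and on which they differ. -/
def diffCoords {n : ℕ} (x y : PStr n) : Finset (Fin n) :=
  (fixedCoords x ∩ fixedCoords y).filter fun i => x i ≠ y i

/-- The Hamming distance `Δ(x, y)` of two partial strings. -/
def hdist {n : ℕ} (x y : PStr n) : ℕ := (diffCoords x y).card

/-- `f^{-1}(1)`. -/
def ones {n : ℕ} (f : Cube n → Bool) : Finset (Cube n) :=
  Finset.univ.filter fun x => f x = true

/-- `f` is unate: in every direction `i` it is non-decreasing or non-increasing. -/
def Unate {n : ℕ} (f : Cube n → Bool) : Prop :=
  ∀ i : Fin n,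
    (∀ x : Cube n, f (Function.update x i false) ≤ f (Function.update x i true)) ∨
    (∀ x : Cube n, f (Function.update x i true) ≤ f (Function.update x i false))

/-- `reldist(f, g) = |f^{-1}(1) Δ g^{-1}(1)| / |f^{-1}(1)|`. -/
noncomputable def reldist {n : ℕ} (f g : Cube n → Bool) : ℝ :=
  ((symmDiff (ones f) (ones g)).card : ℝ) / ((ones f).card : ℝ)

/-- `reldist(f, Unate)`, the minimum of `reldist(f, g)` over all unate `g` (a minimum over a finite
non-empty set, since constant functions are unate). -/
noncomputable def reldistUnate {n : ℕ} (f : Cube n → Bool) : ℝ :=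
  ⨅ g : {g : Cube n → Bool // Unate g}, reldist f g.1

/-! ### Randomized algorithms with access to `MQ(f)` and `SAMP(f)` -/

inductive Verdict
  | accept
  | reject

/-- Randomized, adaptive oracle algorithms for functions on `{0,1}^n`, as decision trees. The tree
does not depend on the tested function, which enters only through the answers of the oracles.
* `ret a`: return the value `a` to the calling procedure;
* `halt v`: stop the whole computation with verdict `v`;
* `samp k`: call `SAMP(f)` and continue with the answer;
* `query x k`: query `MQ(f)` at `x` and continue with the answer;
* `unif s hs k`: draw an element of `s` uniformly at random (internal randomness, no oracle call). -/
inductive Algo (n : ℕ) (α : Type) : Type 1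
  | ret (a : α) : Algo n α
  | halt (v : Verdict) : Algo n α
  | samp (k : Cube n → Algo n α) : Algo n α
  | query (x : Cube n) (k : Bool → Algo n α) : Algo n α
  | unif {β : Type} (s : Finset β) (hs : s.Nonempty) (k : β → Algo n α) : Algo n α

namespace Algo

/-- Sequential composition. -/
def bind {n : ℕ} {α β : Type} : Algo n α → (α → Algo n β) → Algo n β
  | ret a, g => g a
  | halt v, _ => halt v
  | samp k, g => samp fun z => (k z).bind g
  | query x k, g => query x fun b => (k b).bind g
  | unif s hs k, g => unif s hs fun b => (k b).bind g

instance {n : ℕ} : Monad (Algo n) where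
  pure := Algo.ret
  bind := Algo.bind

/-- Execution on `f`: the joint law of the outcome (`Sum.inl v` if the computation was halted with
verdict `v`, `Sum.inr a` if it returned the value `a`) and of the total number of calls to `SAMP(f)`
and `MQ(f)`. -/
noncomputable def run {n : ℕ} {α : Type} (f : Cube n → Bool) (hf : (ones f).Nonempty) :
    Algo n α → PMF ((Verdict ⊕ α) × ℕ)
  | ret a => PMF.pure (Sum.inr a, 0)
  | halt v => PMF.pure (Sum.inl v, 0)
  | samp k => (PMF.uniformOfFinset (ones f) hf).bind fun z =>
      ((k z).run f hf).map fun r => (r.1, r.2 + 1)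
  | query x k => ((k (f x)).run f hf).map fun r => (r.1, r.2 + 1)
  | unif s hs k => (PMF.uniformOfFinset s hs).bind fun b => (k b).run f hf

/-- The probability that the outcome and the number of oracle calls of `A` on `f` satisfy `P`. -/
noncomputable def prob {n : ℕ} {α : Type} (A : Algo n α) (f : Cube n → Bool)
    (hf : (ones f).Nonempty) (P : Verdict ⊕ α → ℕ → Prop) : ℝ :=
  ((A.run f hf).toOuterMeasure {r | P r.1 r.2}).toReal

/-- One call to `SAMP(f)`. -/
def sample {n : ℕ} : Algo n (Cube n) := samp ret

/-- One query to `MQ(f)`. -/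
def ask {n : ℕ} (x : Cube n) : Algo n Bool := query x ret

/-- `k` independent calls to `SAMP(f)`. -/
def samples {n : ℕ} : ℕ → Algo n (List (Cube n))
  | 0 => ret []
  | k + 1 => do
      let z ← sample
      let zs ← samples k
      ret (z :: zs)

/-- `k` independent uniform draws from `s`. -/
def draws {n : ℕ} {β : Type} (s : Finset β) (hs : s.Nonempty) : ℕ → Algo n (List β)
  | 0 => ret []
  | k + 1 => do
      let y ← unif s hs ret
      let ys ← draws s hs k
      ret (y :: ys)

/-- For each point `z` of a list query `f (g z)`, and attach the answer to `z`. -/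
def askAll {n : ℕ} (g : Cube n → Cube n) : List (Cube n) → Algo n (List (Cube n × Bool))
  | [] => ret []
  | z :: zs => do
      let b ← ask (g z)
      let bs ← askAll g zs
      ret ((z, b) :: bs)

/-- Execute `body` `k` times. -/
def repeatN {n : ℕ} : ℕ → Algo n Unit → Algo n Unit
  | 0, _ => ret ()
  | k + 1, body => do
      body
      repeatN k body

/-- Execute `body r` for each entry `r` of a list, in order. -/
def forEach {n : ℕ} : List ℕ → (ℕ → Algo n Unit) → Algo n Unit
  | [], _ => ret ()
  | r :: rs, body => do
      body r
      forEach rs body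

open Classical in
/-- Draw `i` uniformly from `s` and execute `body i`; do nothing if `s` is empty. -/
noncomputable def withRandom {n : ℕ} (s : Finset (Fin n)) (body : Fin n → Algo n Unit) :
    Algo n Unit :=
  if hs : s.Nonempty then unif s hs body else ret ()

end Algo

open Algo

/-! ### The subroutines -/

/-- `⌈log₂ t⌉`. -/
noncomputable def ceilLog (t : ℝ) : ℕ := ⌈Real.logb 2 t⌉₊

/-- `t` rounds of the search for an edge of `Edge_i^b(f)`. A sample `z` has `f z = 1`, so the edge
`{z, z^{(i)}}` is strictly `b`-monotone iff `z_i = b` and `f (z^{(i)}) = 0`. -/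
def confirmRounds {n : ℕ} (i : Fin n) (b : Bool) : ℕ → Algo n Bool
  | 0 => ret false
  | t + 1 => do
      let z ← sample
      let v ← ask (flipAt z i)
      if z i = b ∧ v = false then ret true else confirmRounds i b t

/-- `ConfirmDirection`; `true` is `Yes` and `false` is `No`. -/
def confirmDirection {n : ℕ} (i : Fin n) (b : Bool) : Algo n Bool := confirmRounds i b 25

/-- Run `ConfirmDirection(i, d_i)` and halt and reject if it returns `Yes`. It is only called on
coordinates `i` with `d_i ≠ *`. -/
def rejectIfConfirmed {n : ℕ} (d : PStr n) (i : Fin n) : Algo n Unit := do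
  let yes ← confirmDirection i ((d i).getD false)
  if yes = true then halt Verdict.reject else ret ()

/-- `CheckSamples(a, S, δ')`. -/
noncomputable def checkSamples {n : ℕ} (a : Cube n) (S : List (Cube n)) (δ' : ℝ) :
    Algo n Unit :=
  match S.argmax fun z => hdist (toPStr a) (toPStr z) with
  | none => ret ()
  | some z =>
      repeatN (ceilLog (1 / δ')) <|
        withRandom (diffCoords (toPStr a) (toPStr z)) fun i => do
          let u ← ask (flipAt a i)
          let v ← ask (flipAt z i)
          if u = false ∧ v = false then halt Verdict.reject else ret ()

/-- The empirical probability `Pr_{z ∈ S}[z_i = 1]` (with multiplicities). -/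
noncomputable def empirical {n : ℕ} (S : List (Cube n)) (i : Fin n) : ℝ :=
  (S.countP fun z => z i) / (S.length : ℝ)

/-- The values `ℓ = 1, 2, 4, 8, …, 10 log n` of the loop of `IterativeBias`: the last value is
`10 log₂ n` rounded up to a positive integer, the others are all smaller powers of two. -/
noncomputable def biasRounds (n : ℕ) : List ℕ :=
  let L := max 1 ⌈10 * Real.logb 2 (n : ℝ)⌉₊
  ((List.range (Nat.clog 2 L)).map fun j => 2 ^ j) ++ [L]

open Classical in
/-- The first phase of `IterativeBias`, over a list of values of `ℓ`; it returns the vector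
`(p_i)`, or accepts after the last value of `ℓ`. -/
noncomputable def estimateBias {n : ℕ} (a : Cube n) (δ : ℝ) : List ℕ → Algo n (Fin n → ℝ)
  | [] => halt Verdict.accept
  | l :: ls => do
      let S ← samples (4000 * (2 * l + ceilLog (1 / δ)))
      let T ← samples (4000 * (2 * l + ceilLog (1 / δ)))
      checkSamples a (S ++ T) (δ / (48 * (l : ℝ)))
      if ∀ i, |empirical S i - empirical T i| ≤ 1 / 20 then ret (empirical S)
      else estimateBias a δ ls

open Classical in
/-- The partial string with `1` where `p_i > 3/4`, `0` where `p_i < 1/4`, and `*` elsewhere. -/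
noncomputable def biasVector {n : ℕ} (p : Fin n → ℝ) : PStr n := fun i =>
  if p i > 3 / 4 then some true else if p i < 1 / 4 then some false else none

/-- `IterativeBias(a, δ)`. -/
noncomputable def iterativeBias {n : ℕ} (a : Cube n) (δ : ℝ) : Algo n (PStr n) := do
  let p ← estimateBias a δ (biasRounds n)
  let d := biasVector p
  repeatN (4000 * ceilLog (1 / δ)) <|
    withRandom (unfixedCoords d) fun i => do
      let x ← sample
      let y ← sample
      let u ← ask (flipAt x i)
      let v ← ask (flipAt y i)
      if x i ≠ y i ∧ u = false ∧ v = false then halt Verdict.reject else ret ()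
  ret d

/-- `z ⪯_d y`: `y` arises from `z` by changing some coordinates on which `z` disagrees with `d`. -/
def PrecedesTowards {n : ℕ} (d : PStr n) (z y : Cube n) : Prop :=
  ∀ i, (d i = some true → z i ≤ y i) ∧ (d i = some false → y i ≤ z i) ∧ (d i = none → z i = y i)

open Classical in
/-- The set `{y : z ⪯_d y}`. -/
noncomputable def upperCone {n : ℕ} (d : PStr n) (z : Cube n) : Finset (Cube n) :=
  Finset.univ.filter fun y => PrecedesTowards d z y

open Classical in
theorem upperCone_nonempty {n : ℕ} (d : PStr n) (z : Cube n) : (upperCone d z).Nonempty :=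
  ⟨z, Finset.mem_filter.2 ⟨Finset.mem_univ z, fun _ => ⟨fun _ => le_rfl, fun _ => le_rfl, fun _ => rfl⟩⟩⟩

/-- The point obtained from `u` by flipping the bits in `D`. -/
def flipList {n : ℕ} (u : Cube n) (D : List (Fin n)) : Cube n := fun i =>
  if i ∈ D then !(u i) else u i

/-- Binary search between a point `u` with `f u = 1` and the point obtained from it by flipping the
bits listed in `D`, where `f` is `0`: it finds a coordinate `i` of `D` and a point `w` between the
two with `w_i = u_i`, `f w = 1` and `f (w^{(i)}) = 0`, and returns `i`. -/
def binarySearch {n : ℕ} (u : Cube n) (D : List (Fin n)) : Algo n (Option (Fin n)) :=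
  if h : D.length ≤ 1 then ret D.head? else do
    let w := flipList u (D.take (D.length / 2))
    let v ← ask w
    if v = true then binarySearch w (D.drop (D.length / 2))
    else binarySearch u (D.take (D.length / 2))
termination_by D.length
decreasing_by
  all_goals simp only [List.length_drop, List.length_take]; omega

/-- `Preprocessing(d, ε, δ)`. -/
noncomputable def preprocessing {n : ℕ} (d : PStr n) (ε δ : ℝ) : Algo n ℕ := do
  let S ← samples (30 * ⌈1 / ε⌉₊)
  match S.argmax fun z => hdist (toPStr z) d with
  | none => ret 0
  | some z =>
      let M := hdist (toPStr z) d
      repeatN (10 * ceilLog (1 / δ)) <|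
        withRandom (diffCoords (toPStr z) d) fun j => do
          let v ← ask (flipAt z j)
          if v = false then rejectIfConfirmed d j else ret ()
      let ys ← draws (upperCone d z) (upperCone_nonempty d z) (5 * ceilLog (1 / δ))
      let answers ← askAll id ys
      match answers.find? fun r => !r.2 with
      | none => ret M
      | some (y, _) =>
          let r ← binarySearch z ((diffCoords (toPStr z) (toPStr y)).sort (· ≤ ·))
          match r with
          | none => ret M
          | some i =>
              repeatN (5 * ceilLog (1 / δ)) (rejectIfConfirmed d i)
              ret M

/-- `BiasedTest(M, ε', d)`. -/
noncomputable def biasedTest {n : ℕ} (M : ℕ) (ε' : ℝ) (d : PStr n) : Algo n Unit :=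
  if fixedCoords d = ∅ then ret () else
    repeatN (10 * ⌈(M : ℝ) / ε'⌉₊) do
      let z ← sample
      withRandom (diffCoords (toPStr z) d) fun i => do
        let v ← ask (flipAt z i)
        if v = false then rejectIfConfirmed d i else ret ()

open Classical in
/-- `UnbiasedTest(ε', d)`. -/
noncomputable def unbiasedTest {n : ℕ} (ε' : ℝ) (d : PStr n) : Algo n Unit :=
  if unfixedCoords d = ∅ then ret () else
    let m : ℝ := ((unfixedCoords d).card : ℝ)
    forEach (List.range' 1 (ceilLog (m / ε') + 2)) fun r =>
      repeatN ⌈50 * m / (ε' * 2 ^ r)⌉₊ <|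
        withRandom (unfixedCoords d) fun i => do
          let S ← samples (3 * 2 ^ r)
          let answers ← askAll (fun z => flipAt z i) S
          if ∃ x ∈ answers, ∃ y ∈ answers,
              x.1 i = false ∧ y.1 i = true ∧ x.2 = false ∧ y.2 = false
          then halt Verdict.reject else ret ()

/-- The algorithm `Unateness-Tester-Unknown-N`. It knows `n`, `ε` and `δ`, but not
`N = |f^{-1}(1)|`. -/
noncomputable def unatenessTesterUnknownN (n : ℕ) (ε δ : ℝ) : Algo n Unit := do
  let a ← sample
  let S ← samples (100 * ceilLog (1 / δ))
  checkSamples a S (δ / 12)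
  let d ← iterativeBias a δ
  let M ← preprocessing d ε δ
  biasedTest M (ε / 64) d
  unbiasedTest (ε / 64) d
  halt Verdict.accept

/-- `T · (log₂ (T + 2))^c`, the generic bound behind `Õ(T)`. -/
noncomputable def quasilinear (c : ℕ) (T : ℝ) : ℝ := T * Real.logb 2 (T + 2) ^ c

end RelUnate

namespace RelUnate

open Finset
open scoped BigOperators

/-! ### Execution calculus -/

namespace Algo

variable {n : ℕ} {α β : Type} {f : Cube n → Bool} {hf : (ones f).Nonempty}

/-! The three claims rest on different facts.

One-sidedness: every rejection is preceded by two points of f⁻¹(1) that differ in some bit i and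
both leave f⁻¹(1) when bit i is flipped. These are strict edges of opposite orientation in one
direction, impossible for unate f (`not_unate_of_edges`).

Cost: the point is to replace n by N = |f⁻¹(1)|. Flipping different bits of one point gives
different points, so at most N of the flips stay in f⁻¹(1). Hence CheckSamples very likely rejects
if a sample lies farther than 4N from a. For samples within 4N of a the coordinate variances sum to
at most 4N, and `listProb_deviation_le_variance` bounds each deviation by the variance times an
exponential. The union bound over all coordinates then costs a factor N rather than n, and the loop
of IterativeBias stops once ℓ is of order log N. Accuracy of the estimate comes separately from the
independent second list. By the edge-isoperimetric inequality the average number of directions in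
which a point of f⁻¹(1) has a neighbour in f⁻¹(1) is at most log N. If more than 40 log N
coordinates are unfixed, most unfixed directions therefore have many boundary edges of both
orientations, and the pair test very likely rejects. In Preprocessing, a maximal distance M > 1 +
log N makes the cone above z so large that half of it lies outside f⁻¹(1); binary search then finds
an edge against d, and ConfirmDirection finds one along d. So M and the number of unfixed
coordinates are O(1 + log N) when the final tests run.

Soundness: choose a direction for each coordinate, namely d_i where it is fixed and the one with
fewer violations elsewhere. Sorting f along all directions yields a unate function at distance at
most twice the number of violations (`exists_unate_near`). Before sorting, f is cut down to the
points within distance M of d, which loses at most an ε/8 fraction. If f is ε-far, `mass_of_far`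
puts mass 7ε/32 on fixed or on unfixed coordinates; BiasedTest detects the first, and UnbiasedTest,
searching over dyadic probabilities, the second.

All probabilistic statements are triples `Ensures f hf A c η V Q` for decision trees. They compose
along `bind`, with error probabilities adding up. The quantity `surv`, the probability of returning
without halting, turns a likely rejection into an arbitrary postcondition. -/

theorem bind_assoc {γ : Type} (A : Algo n α) (g : α → Algo n β) (h : β → Algo n γ) :
    (A.bind g).bind h = A.bind fun a => (g a).bind h := by
  induction A with
  | ret a => rfl
  | halt v => rfl
  | samp k ih => simp only [Algo.bind, ih]
  | query x k ih => simp only [Algo.bind, ih]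
  | unif s hs k ih => simp only [Algo.bind, ih]

theorem prob_nonneg (A : Algo n α) (P : Verdict ⊕ α → ℕ → Prop) : 0 ≤ A.prob f hf P :=
  ENNReal.toReal_nonneg

theorem toOuterMeasure_le_one {γ : Type} (p : PMF γ) (s : Set γ) : p.toOuterMeasure s ≤ 1 := by
  rw [PMF.toOuterMeasure_apply, ← p.tsum_coe]
  exact ENNReal.tsum_le_tsum fun x => Set.indicator_le_self _ _ x

theorem toOuterMeasure_ne_top {γ : Type} (p : PMF γ) (s : Set γ) : p.toOuterMeasure s ≠ ⊤ :=
  ne_top_of_le_ne_top ENNReal.one_ne_top (toOuterMeasure_le_one p s)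

theorem prob_le_one (A : Algo n α) (P : Verdict ⊕ α → ℕ → Prop) : A.prob f hf P ≤ 1 := by
  unfold prob
  refine ENNReal.toReal_le_of_le_ofReal zero_le_one ?_
  rw [ENNReal.ofReal_one]
  exact toOuterMeasure_le_one _ _

theorem prob_mono (A : Algo n α) {P Q : Verdict ⊕ α → ℕ → Prop} (h : ∀ o q, P o q → Q o q) :
    A.prob f hf P ≤ A.prob f hf Q :=
  ENNReal.toReal_mono (toOuterMeasure_ne_top _ _)
    (MeasureTheory.measure_mono (μ := (A.run f hf).toOuterMeasure) fun r hr => h r.1 r.2 hr)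

theorem prob_add_not (A : Algo n α) (P : Verdict ⊕ α → ℕ → Prop) :
    A.prob f hf P + A.prob f hf (fun o q => ¬ P o q) = 1 := by
  unfold prob
  rw [← ENNReal.toReal_add (toOuterMeasure_ne_top _ _) (toOuterMeasure_ne_top _ _),
    PMF.toOuterMeasure_apply, PMF.toOuterMeasure_apply, ← ENNReal.tsum_add]
  have : ∀ r, Set.indicator {r : (Verdict ⊕ α) × ℕ | P r.1 r.2} (A.run f hf) r +
      Set.indicator {r : (Verdict ⊕ α) × ℕ | ¬ P r.1 r.2} (A.run f hf) r = A.run f hf r := by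
    intro r
    by_cases h : P r.1 r.2 <;> simp [Set.indicator, h]
  simp [this, PMF.tsum_coe]

open Classical in
theorem prob_ret (a : α) (P : Verdict ⊕ α → ℕ → Prop) :
    (ret a : Algo n α).prob f hf P = if P (Sum.inr a) 0 then 1 else 0 := by
  unfold prob run
  rw [PMF.toOuterMeasure_pure_apply]
  split_ifs <;> simp_all

open Classical in
theorem prob_halt (v : Verdict) (P : Verdict ⊕ α → ℕ → Prop) :
    (halt v : Algo n α).prob f hf P = if P (Sum.inl v) 0 then 1 else 0 := by
  unfold prob run
  rw [PMF.toOuterMeasure_pure_apply]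
  split_ifs <;> simp_all

theorem toReal_uniform_bind {γ : Type} {δ : Type} (s : Finset γ) (hs : s.Nonempty) (k : γ → PMF δ)
    (t : Set δ) : (((PMF.uniformOfFinset s hs).bind k).toOuterMeasure t).toReal =
      𝔼 b ∈ s, ((k b).toOuterMeasure t).toReal := by
  classical
  rw [PMF.toOuterMeasure_bind_apply, tsum_eq_sum (s := s), ENNReal.toReal_sum,
    Finset.expect_eq_sum_div_card, Finset.sum_div]
  · refine Finset.sum_congr rfl fun b hb => ?_
    rw [ENNReal.toReal_mul, PMF.uniformOfFinset_apply_of_mem hs hb]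
    simp [div_eq_inv_mul]
  · intro b hb
    exact ENNReal.mul_ne_top (PMF.apply_ne_top _ _) (toOuterMeasure_ne_top _ _)
  · intro b hb
    rw [PMF.uniformOfFinset_apply_of_notMem hs hb, zero_mul]

theorem prob_samp (k : Cube n → Algo n α) (P : Verdict ⊕ α → ℕ → Prop) :
    (samp k).prob f hf P = 𝔼 z ∈ ones f, (k z).prob f hf (fun o q => P o (q + 1)) := by
  simp only [prob, run]
  rw [toReal_uniform_bind]
  refine Finset.expect_congr rfl fun z _ => ?_
  rw [PMF.toOuterMeasure_map_apply]
  rfl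

theorem prob_query (x : Cube n) (k : Bool → Algo n α) (P : Verdict ⊕ α → ℕ → Prop) :
    (query x k).prob f hf P = (k (f x)).prob f hf (fun o q => P o (q + 1)) := by
  simp only [prob, run]
  rw [PMF.toOuterMeasure_map_apply]
  rfl

theorem prob_unif {γ : Type} (s : Finset γ) (hs : s.Nonempty) (k : γ → Algo n α)
    (P : Verdict ⊕ α → ℕ → Prop) :
    (unif s hs k).prob f hf P = 𝔼 b ∈ s, (k b).prob f hf P := by
  simp only [prob, run]
  rw [toReal_uniform_bind]

/-- The probability that `A` returns to the calling procedure. -/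
noncomputable def surv (f : Cube n → Bool) (hf : (ones f).Nonempty) (A : Algo n α) : ℝ :=
  A.prob f hf fun o _ => o.isRight = true

theorem surv_nonneg (A : Algo n α) : 0 ≤ surv f hf A := prob_nonneg _ _

theorem surv_le_one (A : Algo n α) : surv f hf A ≤ 1 := prob_le_one _ _

@[simp] theorem surv_ret (a : α) : surv f hf (ret a : Algo n α) = 1 := by simp [surv, prob_ret]

@[simp] theorem surv_halt (v : Verdict) : surv f hf (halt v : Algo n α) = 0 := by
  simp [surv, prob_halt]

theorem surv_sample_bind (k : Cube n → Algo n α) :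
    surv f hf (sample >>= k) = 𝔼 z ∈ ones f, surv f hf (k z) := prob_samp _ _

theorem surv_ask_bind (x : Cube n) (k : Bool → Algo n α) :
    surv f hf (ask x >>= k) = surv f hf (k (f x)) := prob_query _ _ _

theorem surv_unif {γ : Type} (s : Finset γ) (hs : s.Nonempty) (k : γ → Algo n α) :
    surv f hf (unif s hs k) = 𝔼 b ∈ s, surv f hf (k b) := prob_unif _ _ _ _

/-- The source of all composition rules. Outside the bad event `B` of the first part, `P` can only
arise in the continuation, which is entered with probability `surv f hf A`. Induction on the tree
shifts the call counter inside `B` and `P`. -/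
theorem prob_bind_le (A : Algo n α) (k : α → Algo n β) (B : Verdict ⊕ α → ℕ → Prop)
    (P : Verdict ⊕ β → ℕ → Prop) {ρ : ℝ} (hρ : 0 ≤ ρ)
    (hhalt : ∀ v q, ¬ B (Sum.inl v) q → ¬ P (Sum.inl v) q)
    (hret : ∀ a q, ¬ B (Sum.inr a) q → (k a).prob f hf (fun o q' => P o (q' + q)) ≤ ρ) :
    (A.bind k).prob f hf P ≤ A.prob f hf B + ρ * surv f hf A := by
  induction A generalizing B P with
  | ret a =>
      simp only [Algo.bind, surv_ret, mul_one, prob_ret]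
      by_cases h : B (Sum.inr a) 0
      · simp only [h, if_true]
        linarith [prob_le_one (f := f) (hf := hf) (k a) P]
      · simpa [h] using hret a 0 h
  | halt v =>
      simp only [Algo.bind, surv_halt, mul_zero, add_zero, prob_halt]
      by_cases h : B (Sum.inl v) 0
      · simp only [h, if_true]; split_ifs <;> norm_num
      · simp [h, hhalt v 0 h]
  | samp g ih =>
      simp only [Algo.bind, surv, prob_samp, Finset.mul_expect]
      rw [← Finset.expect_add_distrib]
      refine Finset.expect_le_expect fun z _ => ih z _ _ (fun v q h => hhalt v _ h) fun a q h => ?_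
      simpa only [add_assoc] using hret a _ h
  | query x g ih =>
      simp only [Algo.bind, surv, prob_query]
      refine ih (f x) _ _ (fun v q h => hhalt v _ h) fun a q h => ?_
      simpa only [add_assoc] using hret a _ h
  | unif s hs g ih =>
      simp only [Algo.bind, surv, prob_unif, Finset.mul_expect]
      rw [← Finset.expect_add_distrib]
      exact Finset.expect_le_expect fun z _ => ih z _ _ hhalt hret

theorem surv_bind_le (A : Algo n α) (k : α → Algo n β) {ρ : ℝ} (hρ : 0 ≤ ρ)
    (h : ∀ a, surv f hf (k a) ≤ ρ) : surv f hf (A >>= k) ≤ ρ * surv f hf A := by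
  refine (prob_bind_le A k (fun _ _ => False) (fun o _ => o.isRight = true) hρ (by simp)
    fun a _ _ => (h a :)).trans_eq ?_
  rw [add_eq_right]
  have := prob_add_not (f := f) (hf := hf) A fun _ _ => True
  simp only [not_true_eq_false] at this
  have h1 : A.prob f hf (fun _ _ => True) = 1 := by
    have hs : {r : (Verdict ⊕ α) × ℕ | True} = Set.univ := by simp
    simp only [prob, hs]
    rw [(PMF.toOuterMeasure_apply_eq_one_iff _ _).2 (Set.subset_univ _)]
    simp
  linarith

/-- Except with probability `η`, at most `c` oracle calls are made, a verdict that halts the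
computation satisfies `V`, and a returned value satisfies `Q`. -/
def Ensures (f : Cube n → Bool) (hf : (ones f).Nonempty) (A : Algo n α) (c : ℕ∞) (η : ℝ)
    (V : Verdict → Prop) (Q : α → Prop) : Prop :=
  A.prob f hf (fun o q => ¬ ((q : ℕ∞) ≤ c ∧ Sum.elim V Q o)) ≤ η

variable {A : Algo n α} {c c₁ c₂ : ℕ∞} {η η₁ η₂ : ℝ} {V : Verdict → Prop} {Q : α → Prop}

theorem Ensures.nonneg (h : Ensures f hf A c η V Q) : 0 ≤ η := (prob_nonneg _ _).trans h

theorem Ensures.mono {c' : ℕ∞} {η' : ℝ} {V' : Verdict → Prop} {Q' : α → Prop}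
    (h : Ensures f hf A c η V Q) (hc : c ≤ c') (hη : η ≤ η') (hV : ∀ v, V v → V' v)
    (hQ : ∀ a, Q a → Q' a) : Ensures f hf A c' η' V' Q' := by
  refine (prob_mono A ?_).trans (h.trans hη)
  rintro (v | a) q h1 ⟨h2, h3⟩
  · exact h1 ⟨h2.trans hc, hV _ h3⟩
  · exact h1 ⟨h2.trans hc, hQ _ h3⟩

theorem Ensures.mono_cost {c' : ℕ∞} (h : Ensures f hf A c η V Q) (hc : c ≤ c') :
    Ensures f hf A c' η V Q := h.mono hc le_rfl (fun _ => id) fun _ => id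

theorem Ensures.mono_prob {η' : ℝ} (h : Ensures f hf A c η V Q) (hc : η ≤ η') :
    Ensures f hf A c η' V Q := h.mono le_rfl hc (fun _ => id) fun _ => id

theorem Ensures.imp {Q' : α → Prop} (h : Ensures f hf A c η V Q) (hQ : ∀ a, Q a → Q' a) :
    Ensures f hf A c η V Q' := h.mono le_rfl le_rfl (fun _ => id) hQ

theorem Ensures.bind {k : α → Algo n β} {R : β → Prop} (h : Ensures f hf A c₁ η₁ V Q)
    (hη : 0 ≤ η₂) (hk : ∀ a, Q a → Ensures f hf (k a) c₂ η₂ V R) :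
    Ensures f hf (A >>= k) (c₁ + c₂) (η₁ + η₂) V R := by
  refine (prob_bind_le A k _ _ hη ?_ ?_).trans
    (add_le_add h (mul_le_of_le_one_right hη (surv_le_one A)))
  · rintro v q hB
    rw [not_not] at hB
    exact not_not.2 ⟨hB.1.trans le_self_add, hB.2⟩
  · rintro a q hB
    rw [not_not] at hB
    refine (prob_mono _ ?_).trans (hk a hB.2)
    rintro o q' h1 ⟨h2, h3⟩
    refine h1 ⟨?_, h3⟩
    push_cast
    rw [add_comm]
    exact add_le_add hB.1 h2

/-- Compared with `Ensures.bind`, the error of the continuation is weighted by the probability that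
it is reached. -/
theorem Ensures.bind_mul {k : α → Algo n β} {R : β → Prop} {ρ : ℝ}
    (h : Ensures f hf A c₁ 0 V Q) (hs : surv f hf A ≤ ρ)
    (hη : 0 ≤ η) (hk : ∀ a, Q a → Ensures f hf (k a) c₂ η V R) :
    Ensures f hf (A >>= k) (c₁ + c₂) (ρ * η) V R := by
  refine (prob_bind_le A k _ _ hη ?_ ?_).trans
    ((add_le_add h (mul_le_mul_of_nonneg_left hs hη)).trans_eq (by ring))
  · rintro v q hB
    rw [not_not] at hB
    exact not_not.2 ⟨hB.1.trans le_self_add, hB.2⟩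
  · rintro a q hB
    rw [not_not] at hB
    refine (prob_mono _ ?_).trans (hk a hB.2)
    rintro o q' h1 ⟨h2, h3⟩
    refine h1 ⟨?_, h3⟩
    push_cast
    rw [add_comm]
    exact add_le_add hB.1 h2

theorem ensures_ret {a : α} (hη : 0 ≤ η) (h : Q a) : Ensures f hf (ret a) c η V Q := by
  simp [Ensures, prob_ret, h, hη]

theorem ensures_halt {v : Verdict} (hη : 0 ≤ η) (h : V v) : Ensures f hf (halt v) c η V Q := by
  simp [Ensures, prob_halt, h, hη]

theorem ensures_of_one_le (h : 1 ≤ η) : Ensures f hf A c η V Q := (prob_le_one _ _).trans h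

theorem ensures_samp {k : Cube n → Algo n α} {h : Cube n → ℝ}
    (hk : ∀ z ∈ ones f, Ensures f hf (k z) c (h z) V Q) (hη : 𝔼 z ∈ ones f, h z ≤ η) :
    Ensures f hf (samp k) (c + 1) η V Q := by
  unfold Ensures
  rw [prob_samp]
  refine (Finset.expect_le_expect fun z hz => (prob_mono _ ?_).trans (hk z hz)).trans hη
  rintro o q h1 ⟨h2, h3⟩
  refine h1 ⟨?_, h3⟩
  push_cast
  exact add_le_add h2 le_rfl

theorem ensures_sample_bind {k : Cube n → Algo n α}
    (hk : ∀ z ∈ ones f, Ensures f hf (k z) c η V Q) :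
    Ensures f hf (sample >>= k) (c + 1) η V Q :=
  ensures_samp (h := fun _ => η) hk (Finset.expect_const hf η).le

theorem ensures_ask_bind {x : Cube n} {k : Bool → Algo n α}
    (hk : Ensures f hf (k (f x)) c η V Q) : Ensures f hf (ask x >>= k) (c + 1) η V Q := by
  change Ensures f hf (query x k) (c + 1) η V Q
  unfold Ensures
  rw [prob_query]
  refine (prob_mono _ ?_).trans hk
  rintro o q h1 ⟨h2, h3⟩
  refine h1 ⟨?_, h3⟩
  push_cast
  exact add_le_add h2 le_rfl

theorem ensures_unif {γ : Type} {s : Finset γ} {hs : s.Nonempty} {k : γ → Algo n α} {h : γ → ℝ}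
    (hk : ∀ b ∈ s, Ensures f hf (k b) c (h b) V Q) (hη : 𝔼 b ∈ s, h b ≤ η) :
    Ensures f hf (unif s hs k) c η V Q := by
  unfold Ensures
  rw [prob_unif]
  exact (Finset.expect_le_expect fun z hz => hk z hz).trans hη

theorem ensures_withRandom {s : Finset (Fin n)} {k : Fin n → Algo n Unit} {Q : Unit → Prop}
    (hη : 0 ≤ η) (hk : ∀ b ∈ s, Ensures f hf (k b) c η V Q) (hQ : s = ∅ → Q ()) :
    Ensures f hf (withRandom s k) c η V Q := by
  unfold withRandom
  split_ifs with hs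
  · exact ensures_unif (h := fun _ => η) hk (Finset.expect_const hs η).le
  · exact ensures_ret hη (hQ (Finset.not_nonempty_iff_eq_empty.1 hs))

theorem surv_withRandom {s : Finset (Fin n)} (hs : s.Nonempty) (k : Fin n → Algo n Unit) :
    surv f hf (withRandom s k) = 𝔼 i ∈ s, surv f hf (k i) := by
  simp only [withRandom, hs, dif_pos, surv_unif]

theorem ensures_repeatN {body : Algo n Unit} (k : ℕ)
    (h : Ensures f hf body c 0 V fun _ => True) :
    Ensures f hf (repeatN k body) (k * c) 0 V fun _ => True := by
  induction k with
  | zero => exact ensures_ret le_rfl trivial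
  | succ k ih =>
      exact (h.bind (k := fun _ => repeatN k body) le_rfl fun _ _ => ih).mono
        (by push_cast; rw [add_mul, one_mul, add_comm]) (by simp) (fun _ => id) fun _ => id

theorem ensures_forEach {ls : List ℕ} {body : ℕ → Algo n Unit} {c : ℕ → ℕ∞}
    (h : ∀ r ∈ ls, Ensures f hf (body r) (c r) 0 V fun _ => True) :
    Ensures f hf (forEach ls body) (ls.map c).sum 0 V fun _ => True := by
  induction ls with
  | nil => exact ensures_ret le_rfl trivial
  | cons r rs ih =>
      exact ((h r (by simp)).bind (k := fun _ => forEach rs body) le_rfl fun _ _ =>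
        ih fun r hr => h r (by simp [hr])).mono (by simp) (by simp) (fun _ => id) fun _ => id

theorem surv_repeatN_le {body : Algo n Unit} (k : ℕ) {ρ : ℝ} (hρ : surv f hf body ≤ ρ) :
    surv f hf (repeatN k body) ≤ ρ ^ k := by
  have h0 : 0 ≤ ρ := (surv_nonneg _).trans hρ
  induction k with
  | zero => simpa using surv_le_one _
  | succ k ih =>
      refine (surv_bind_le body (fun _ => repeatN k body) (pow_nonneg h0 k) fun _ => ih).trans ?_
      rw [pow_succ]
      exact mul_le_mul_of_nonneg_left hρ (pow_nonneg h0 k)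

theorem surv_forEach_le {ls : List ℕ} {body : ℕ → Algo n Unit} {ρ : ℕ → ℝ}
    (h : ∀ r ∈ ls, surv f hf (body r) ≤ ρ r) :
    surv f hf (forEach ls body) ≤ (ls.map ρ).prod := by
  induction ls with
  | nil => simpa using surv_le_one _
  | cons r rs ih =>
      have hr := h r (by simp)
      have ih' := ih fun r hr => h r (by simp [hr])
      refine (surv_bind_le (body r) (fun _ => forEach rs body) ((surv_nonneg _).trans ih')
        fun _ => ih').trans ?_
      rw [List.map_cons, List.prod_cons, mul_comm]
      exact mul_le_mul_of_nonneg_right hr ((surv_nonneg _).trans ih')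

/-- A postcondition can fail only if the computation returns. This is how "otherwise the test
rejects" is expressed: a likely halt lets any `Q` be assumed afterwards. The proof appends a trivial
`ret` that is charged error 1. -/
theorem Ensures.of_surv {Q : α → Prop} {ρ : ℝ} (h : Ensures f hf A c 0 V fun _ => True)
    (hs : surv f hf A ≤ ρ) : Ensures f hf A c ρ V Q := by
  have h1 : Ensures f hf (A.bind ret) (c + 0) (ρ * 1) V Q :=
    Ensures.bind_mul (k := ret) h hs zero_le_one fun _ _ => ensures_of_one_le le_rfl
  have h2 : ∀ A : Algo n α, A.bind ret = A := by
    intro A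
    induction A with
    | ret a => rfl
    | halt v => rfl
    | samp k ih => simp only [Algo.bind, ih]
    | query x k ih => simp only [Algo.bind, ih]
    | unif s hs k ih => simp only [Algo.bind, ih]
  rw [h2] at h1
  simpa using h1

end Algo

/-! ### Lists of independent samples -/

/-- The expectation of `F` over lists of `k` independent uniform elements of `s`. -/
noncomputable def listExpect {β : Type} (s : Finset β) : ℕ → (List β → ℝ) → ℝ
  | 0, F => F []
  | k + 1, F => 𝔼 z ∈ s, listExpect s k fun S => F (z :: S)

section listExpect

variable {β : Type} {s : Finset β}

theorem listExpect_mono {k : ℕ} {F G : List β → ℝ}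
    (h : ∀ S : List β, S.length = k → (∀ z ∈ S, z ∈ s) → F S ≤ G S) :
    listExpect s k F ≤ listExpect s k G := by
  induction k generalizing F G with
  | zero => exact h [] rfl (by simp)
  | succ k ih =>
      refine Finset.expect_le_expect fun z hz => ih fun S hS hSs => h _ (by simp [hS]) ?_
      simpa [hz] using hSs

theorem listExpect_prod (k : ℕ) (g : β → ℝ) :
    listExpect s k (fun S => (S.map g).prod) = (𝔼 z ∈ s, g z) ^ k := by
  have hmul : ∀ (k : ℕ) (c : ℝ) (F : List β → ℝ),
      listExpect s k (fun S => c * F S) = c * listExpect s k F := by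
    intro k c
    induction k with
    | zero => intro F; rfl
    | succ k ih => intro F; simp only [listExpect, ih, Finset.mul_expect]
  induction k with
  | zero => simp [listExpect]
  | succ k ih =>
      simp only [listExpect, List.map_cons, List.prod_cons, hmul, ih, pow_succ']
      rw [← Finset.expect_mul]

theorem listExpect_add (k : ℕ) (F G : List β → ℝ) :
    listExpect s k (fun S => F S + G S) = listExpect s k F + listExpect s k G := by
  induction k generalizing F G with
  | zero => rfl
  | succ k ih => simp only [listExpect, ih, Finset.expect_add_distrib]

theorem listExpect_mul (k : ℕ) (c : ℝ) (F : List β → ℝ) :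
    listExpect s k (fun S => c * F S) = c * listExpect s k F := by
  induction k generalizing F with
  | zero => rfl
  | succ k ih => simp only [listExpect, ih, Finset.mul_expect]

theorem listExpect_const (hs : s.Nonempty) (k : ℕ) (c : ℝ) :
    listExpect s k (fun _ => c) = c := by
  induction k with
  | zero => rfl
  | succ k ih => simp only [listExpect, ih, Finset.expect_const hs]

theorem listExpect_zero (k : ℕ) : listExpect s k (fun _ => 0) = 0 := by
  induction k with
  | zero => rfl
  | succ k ih => simp only [listExpect, ih, Finset.expect_const_zero]

theorem listExpect_sum {ι : Type} (t : Finset ι) (k : ℕ) (F : ι → List β → ℝ) :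
    listExpect s k (fun S => ∑ i ∈ t, F i S) = ∑ i ∈ t, listExpect s k (F i) := by
  induction k generalizing F with
  | zero => rfl
  | succ k ih => simp only [listExpect, ih, Finset.expect_sum_comm]

open Classical in
/-- The probability that a list of `k` independent uniform elements of `s` satisfies `G`. -/
noncomputable def listProb (s : Finset β) (k : ℕ) (G : List β → Prop) : ℝ :=
  listExpect s k fun S => if G S then 1 else 0

theorem listProb_mono {k : ℕ} {G H : List β → Prop}
    (h : ∀ S : List β, S.length = k → (∀ z ∈ S, z ∈ s) → G S → H S) :
    listProb s k G ≤ listProb s k H := by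
  refine listExpect_mono fun S h1 h2 => ?_
  by_cases hG : G S
  · simp [hG, h S h1 h2 hG]
  · simp only [hG, if_false]; split_ifs <;> norm_num

theorem listProb_nonneg (k : ℕ) (G : List β → Prop) : 0 ≤ listProb s k G := by
  rw [← listExpect_zero (s := s) k]
  exact listExpect_mono fun S _ _ => by split_ifs <;> norm_num

open Classical in
theorem listProb_exists_le {ι : Type} (t : Finset ι) (k : ℕ) (G : ι → List β → Prop) :
    listProb s k (fun S => ∃ i ∈ t, G i S) ≤ ∑ i ∈ t, listProb s k (G i) := by
  unfold listProb
  rw [← listExpect_sum]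
  refine listExpect_mono fun S _ _ => ?_
  have h0 : ∀ i ∈ t, (0 : ℝ) ≤ if G i S then 1 else 0 := fun i _ => by split_ifs <;> norm_num
  split_ifs with h
  · obtain ⟨i, hi, hG⟩ := h
    exact le_trans (by simp [hG]) (Finset.single_le_sum h0 hi)
  · exact Finset.sum_nonneg h0

open Classical in
theorem listProb_forall (k : ℕ) (p : β → Prop) :
    listProb s k (fun S => ∀ z ∈ S, p z) = (𝔼 z ∈ s, if p z then 1 else 0) ^ k := by
  unfold listProb
  rw [← listExpect_prod]
  congr 1
  funext S
  induction S with
  | nil => simp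
  | cons z S ih =>
      rw [List.map_cons, List.prod_cons, ← ih]
      by_cases h : p z <;> simp [h]

/-- Conditioning all elements of the list on a subset. -/
theorem listProb_and_forall_mem_le {t : Finset β} (hts : t ⊆ s) (k : ℕ) (G : List β → Prop) :
    listProb s k (fun S => (∀ z ∈ S, z ∈ t) ∧ G S) ≤ listProb t k G := by
  classical
  induction k generalizing G with
  | zero => simp [listProb, listExpect]
  | succ k ih =>
      have h1 : ∀ z, listProb s k (fun S => (∀ y ∈ z :: S, y ∈ t) ∧ G (z :: S)) ≤
          if z ∈ t then listProb t k (fun S => G (z :: S)) else 0 := by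
        intro z
        split_ifs with hz
        · refine le_trans (listProb_mono ?_) (ih fun S => G (z :: S))
          intro S _ _ h
          exact ⟨fun y hy => h.1 y (by simp [hy]), h.2⟩
        · rw [← listExpect_zero (s := s) k]
          exact listExpect_mono fun S _ _ => by simp [hz]
      change 𝔼 z ∈ s, listProb s k (fun S => (∀ y ∈ z :: S, y ∈ t) ∧ G (z :: S)) ≤
        𝔼 z ∈ t, listProb t k (fun S => G (z :: S))
      refine (Finset.expect_le_expect fun z _ => h1 z).trans ?_
      -- Only heads in `t` contribute, so both sides have the same numerator, and the left one is
      -- divided by the larger `s.card`.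
      rw [Finset.expect_eq_sum_div_card, Finset.expect_eq_sum_div_card, Finset.sum_ite_mem,
        Finset.inter_eq_right.2 hts]
      have h2 : 0 ≤ ∑ z ∈ t, listProb t k fun S => G (z :: S) :=
        Finset.sum_nonneg fun z _ => listProb_nonneg _ _
      rcases t.eq_empty_or_nonempty with rfl | ht
      · simp
      · have h3 : (0 : ℝ) < t.card := by exact_mod_cast ht.card_pos
        have h4 : (t.card : ℝ) ≤ s.card := by exact_mod_cast Finset.card_le_card hts
        gcongr

end listExpect

/-! ### Laws of the sampling and querying subroutines -/

namespace Algo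

variable {n : ℕ} {α : Type} {f : Cube n → Bool} {hf : (ones f).Nonempty}

theorem prob_bind_ret {β : Type} (A : Algo n α) (g : α → β) (P : Verdict ⊕ β → ℕ → Prop) :
    (A.bind fun a => ret (g a)).prob f hf P = A.prob f hf (fun o q => P (o.map id g) q) := by
  induction A generalizing P with
  | ret a => simp only [Algo.bind, prob_ret]; rfl
  | halt v => simp only [Algo.bind, prob_halt]; rfl
  | samp k ih => simp only [Algo.bind, prob_samp, ih]
  | query x k ih => simp only [Algo.bind, prob_query, ih]
  | unif s hs k ih => simp only [Algo.bind, prob_unif, ih]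

theorem prob_samples (k : ℕ) (P : Verdict ⊕ List (Cube n) → ℕ → Prop) :
    (samples k).prob f hf P = listProb (ones f) k fun S => P (Sum.inr S) k := by
  induction k generalizing P with
  | zero => simp [samples, prob_ret, listProb, listExpect]
  | succ k ih =>
      change (samp fun z => (samples k).bind fun zs => ret (z :: zs)).prob f hf P = _
      simp only [prob_samp, prob_bind_ret, ih]
      rfl

theorem prob_draws {β : Type} (s : Finset β) (hs : s.Nonempty) (k : ℕ)
    (P : Verdict ⊕ List β → ℕ → Prop) :
    (draws s hs k).prob f hf P = listProb s k fun S => P (Sum.inr S) 0 := by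
  induction k generalizing P with
  | zero => simp [draws, prob_ret, listProb, listExpect]
  | succ k ih =>
      change (unif s hs fun z => (draws s hs k).bind fun zs => ret (z :: zs)).prob f hf P = _
      simp only [prob_unif, prob_bind_ret, ih]
      rfl

theorem ensures_samples {k : ℕ} {η : ℝ} {V : Verdict → Prop} {G : List (Cube n) → Prop}
    (h : listProb (ones f) k (fun S => ¬ G S) ≤ η) :
    Ensures f hf (samples k) k η V fun S => (S.length = k ∧ ∀ z ∈ S, z ∈ ones f) ∧ G S := by
  unfold Ensures
  rw [prob_samples]
  refine (listProb_mono ?_).trans h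
  intro S h1 h2 h3 h4
  exact h3 ⟨le_rfl, ⟨h1, h2⟩, h4⟩

theorem ensures_samples_zero {k : ℕ} {V : Verdict → Prop} :
    Ensures f hf (samples k) k 0 V fun S => S.length = k ∧ ∀ z ∈ S, z ∈ ones f :=
  (ensures_samples (G := fun _ => True) (by
    simp [listProb, listExpect_const hf])).imp fun _ h => h.1

theorem ensures_draws {β : Type} {s : Finset β} {hs : s.Nonempty} {k : ℕ} {η : ℝ}
    {V : Verdict → Prop} {G : List β → Prop} (h : listProb s k (fun S => ¬ G S) ≤ η) :
    Ensures f hf (draws s hs k) 0 η V fun S => (S.length = k ∧ ∀ z ∈ S, z ∈ s) ∧ G S := by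
  unfold Ensures
  rw [prob_draws]
  refine (listProb_mono ?_).trans h
  intro S h1 h2 h3 h4
  exact h3 ⟨le_rfl, ⟨h1, h2⟩, h4⟩

theorem surv_samples_bind_le {k : ℕ} {g : List (Cube n) → Algo n α} {G : List (Cube n) → Prop}
    (h : ∀ S, S.length = k → (∀ z ∈ S, z ∈ ones f) → G S → surv f hf (g S) ≤ 0) :
    surv f hf (samples k >>= g) ≤ listProb (ones f) k fun S => ¬ G S := by
  have h1 := prob_bind_le (f := f) (hf := hf) (samples k) g
    (fun o _ => ¬ ∃ S : List (Cube n), o = Sum.inr S ∧ S.length = k ∧ (∀ z ∈ S, z ∈ ones f) ∧ G S)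
    (fun o _ => o.isRight = true) le_rfl (by simp) (by
      rintro S q hS
      rw [not_not] at hS
      obtain ⟨S', h1, h2, h3, h4⟩ := hS
      cases h1
      exact h S h2 h3 h4)
  rw [zero_mul, add_zero, prob_samples] at h1
  refine h1.trans (listProb_mono fun S h2 h3 h4 h5 => h4 ⟨S, rfl, h2, h3, h5⟩)

theorem askAll_bind (g : Cube n → Cube n) (S : List (Cube n))
    (k : List (Cube n × Bool) → Algo n α) (P : Verdict ⊕ α → ℕ → Prop) :
    (askAll g S >>= k).prob f hf P =
      (k (S.map fun z => (z, f (g z)))).prob f hf (fun o q => P o (q + S.length)) := by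
  induction S generalizing k P with
  | nil => rfl
  | cons z S ih =>
      change (query (g z) fun b => (((askAll g S).bind fun bs => ret ((z, b) :: bs)).bind k)).prob
        f hf P = _
      rw [prob_query]
      simp only [bind_assoc]
      refine (ih (fun bs => k ((z, f (g z)) :: bs)) _).trans ?_
      simp [add_assoc]

theorem ensures_askAll_bind {g : Cube n → Cube n} {S : List (Cube n)}
    {k : List (Cube n × Bool) → Algo n α} {c : ℕ∞} {η : ℝ} {V : Verdict → Prop} {Q : α → Prop}
    (h : Ensures f hf (k (S.map fun z => (z, f (g z)))) c η V Q) :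
    Ensures f hf (askAll g S >>= k) (c + S.length) η V Q := by
  unfold Ensures
  rw [askAll_bind]
  refine (prob_mono _ ?_).trans h
  rintro o q h1 ⟨h2, h3⟩
  refine h1 ⟨?_, h3⟩
  push_cast
  exact add_le_add h2 le_rfl

theorem surv_askAll_bind (g : Cube n → Cube n) (S : List (Cube n))
    (k : List (Cube n × Bool) → Algo n α) :
    surv f hf (askAll g S >>= k) = surv f hf (k (S.map fun z => (z, f (g z)))) :=
  askAll_bind g S k _

end Algo

/-! ### Flipping coordinates -/

section flip

variable {n : ℕ}

@[simp] theorem flipAt_same (x : Cube n) (i : Fin n) : flipAt x i i = !(x i) := by simp [flipAt]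

theorem flipAt_of_ne (x : Cube n) {i j : Fin n} (h : j ≠ i) : flipAt x i j = x j := by
  simp [flipAt, h]

@[simp] theorem flipAt_flipAt (x : Cube n) (i : Fin n) : flipAt (flipAt x i) i = x := by
  simp [flipAt]

theorem flipAt_comm (x : Cube n) (i j : Fin n) :
    flipAt (flipAt x i) j = flipAt (flipAt x j) i := by
  funext k
  by_cases hij : i = j
  · subst hij; rfl
  · by_cases hi : k = i
    · subst hi; simp [flipAt_of_ne _ hij]
    · by_cases hj : k = j
      · subst hj; simp [flipAt_of_ne _ hi]
      · simp [flipAt_of_ne _ hi, flipAt_of_ne _ hj]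

theorem flipAt_injective (i : Fin n) : Function.Injective fun x : Cube n => flipAt x i :=
  Function.LeftInverse.injective (g := fun x => flipAt x i) fun x => flipAt_flipAt x i

/-- Flipping bit `i`, as a permutation of the cube. -/
def flipEquiv (i : Fin n) : Cube n ≃ Cube n where
  toFun x := flipAt x i
  invFun x := flipAt x i
  left_inv x := flipAt_flipAt x i
  right_inv x := flipAt_flipAt x i

theorem flipAt_left_injective (x : Cube n) : Function.Injective fun i => flipAt x i := by
  intro i j h
  by_contra hij
  have := congrFun h i
  simp [flipAt_of_ne x hij] at this

theorem mem_ones {f : Cube n → Bool} {x : Cube n} : x ∈ ones f ↔ f x = true := by simp [ones]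

/-- Each of the two edges refutes one of the two monotonicities. All rejections of the tester are
justified by this lemma. -/
theorem not_unate_of_edges {f : Cube n → Bool} {i : Fin n} {x y : Cube n} (hx : f x = true)
    (hy : f y = true) (hxy : x i ≠ y i) (hx' : f (flipAt x i) = false)
    (hy' : f (flipAt y i) = false) : ¬ Unate f := by
  intro h
  have key : ∀ z b, f z = true → f (flipAt z i) = false → z i = b →
      f (Function.update z i b) = true ∧ f (Function.update z i (!b)) = false := by
    intro z b h1 h2 h3
    subst h3
    rw [Function.update_eq_self]
    exact ⟨h1, h2⟩
  have hle : ¬ (true ≤ false) := by decide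
  rcases h i with h | h
  · cases hb : x i
    · have h' := h x
      rw [(key x false hx hx' hb).1] at h'
      rw [show f (Function.update x i true) = false from (key x false hx hx' hb).2] at h'
      exact hle h'
    · have hb' : y i = false := by cases hy : y i <;> simp_all
      have h' := h y
      rw [(key y false hy hy' hb').1] at h'
      rw [show f (Function.update y i true) = false from (key y false hy hy' hb').2] at h'
      exact hle h'
  · cases hb : x i
    · have hb' : y i = true := by cases hy : y i <;> simp_all
      have h' := h y
      rw [(key y true hy hy' hb').1] at h'
      rw [show f (Function.update y i false) = false from (key y true hy hy' hb').2] at h'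
      exact hle h'
    · have h' := h x
      rw [(key x true hx hx' hb).1] at h'
      rw [show f (Function.update x i false) = false from (key x true hx hx' hb).2] at h'
      exact hle h'

end flip

/-! ### The edge-isoperimetric inequality -/

/-- After division by a + b this says that the binary entropy H(p) of p = a/(a+b) ≤ 1/2 is at least
2p, i.e. that the concave function H lies above its chord from 0 to 1/2. -/
theorem entropy_step {a b : ℕ} (hab : a ≤ b) :
    (a : ℝ) * Real.logb 2 a + b * Real.logb 2 b + 2 * a ≤ (a + b : ℝ) * Real.logb 2 (a + b) := by
  rcases Nat.eq_zero_or_pos a with rfl | ha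
  · simp
  have ha' : (0 : ℝ) < a := by exact_mod_cast ha
  have hab' : (a : ℝ) ≤ b := by exact_mod_cast hab
  have hb' : (0 : ℝ) < b := ha'.trans_le hab'
  set p : ℝ := a / (a + b) with hp
  have hs : (0 : ℝ) < a + b := by positivity
  have hp0 : 0 ≤ p := by positivity
  have hp2 : 2 * p ≤ 1 := by
    rw [hp, ← mul_div_assoc, div_le_one hs]; linarith
  have hconc := Real.strictConcave_binEntropy.concaveOn
  have h1 := hconc.2 (show (0 : ℝ) ∈ Set.Icc 0 1 by norm_num)
    (show (2⁻¹ : ℝ) ∈ Set.Icc 0 1 by norm_num)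
    (show 0 ≤ 1 - 2 * p by linarith) (show 0 ≤ 2 * p by linarith) (by ring)
  have h2 : (1 - 2 * p) • (0 : ℝ) + (2 * p) • (2⁻¹ : ℝ) = p := by
    simp only [smul_eq_mul]; ring
  rw [h2, Real.binEntropy_zero, Real.binEntropy_two_inv] at h1
  simp only [smul_eq_mul, mul_zero, zero_add] at h1
  have hq : 1 - p = b / (a + b) := by rw [hp]; field_simp; ring
  rw [Real.binEntropy, hq, hp, inv_div, inv_div, Real.log_div hs.ne' ha'.ne',
    Real.log_div hs.ne' hb'.ne'] at h1
  have hl : 0 < Real.log 2 := Real.log_pos (by norm_num)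
  simp only [Real.logb]
  have h3 : 2 * (a : ℝ) * Real.log 2 ≤ a * (Real.log (a + b) - Real.log a) +
      b * (Real.log (a + b) - Real.log b) := by
    have := mul_le_mul_of_nonneg_right h1 hs.le
    have e1 : 2 * ((a : ℝ) / (a + b)) * Real.log 2 * (a + b) = 2 * a * Real.log 2 := by
      field_simp
    have e2 : ((a : ℝ) / (a + b) * (Real.log (a + b) - Real.log a) +
      b / (a + b) * (Real.log (a + b) - Real.log b)) * (a + b) =
        a * (Real.log (a + b) - Real.log a) + b * (Real.log (a + b) - Real.log b) := by
      field_simp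
    rwa [e1, e2] at this
  have h4 : 2 * (a : ℝ) ≤ (a * (Real.log (a + b) - Real.log a) +
      b * (Real.log (a + b) - Real.log b)) / Real.log 2 := by
    rwa [le_div_iff₀ hl]
  have h5 : (a * (Real.log (a + b) - Real.log a) + b * (Real.log (a + b) - Real.log b)) /
      Real.log 2 = (a + b : ℝ) * (Real.log (a + b) / Real.log 2) -
        (a * (Real.log a / Real.log 2) + b * (Real.log b / Real.log 2)) := by ring
  linarith

/-- Induction on the set of directions: split A by bit j. The other directions split over the two
halves, and direction j contributes at most twice the smaller half, which is the gain in
`entropy_step`. -/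
theorem edge_isoperimetric {n : ℕ} (s : Finset (Fin n)) (A : Finset (Cube n)) :
    (∑ i ∈ s, ((A.filter fun z => flipAt z i ∈ A).card : ℝ)) ≤ A.card * Real.logb 2 A.card := by
  classical
  induction s using Finset.induction_on generalizing A with
  | empty =>
      rw [Finset.sum_empty]
      rcases Nat.eq_zero_or_pos A.card with h | h
      · simp [h]
      · exact mul_nonneg (by positivity) (Real.logb_nonneg (by norm_num) (by exact_mod_cast h))
  | insert j t hj ih =>
      rw [Finset.sum_insert hj]
      set B : Bool → Finset (Cube n) := fun b => A.filter fun z => z j = b with hB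
      have hcard : (A.card : ℝ) = (B false).card + (B true).card := by
        have := Finset.card_filter_add_card_filter_not (s := A) fun z => z j = false
        have h2 : (A.filter fun z => ¬ z j = false) = B true := by
          simp [hB]
        rw [h2] at this
        exact_mod_cast this.symm
      have hsum : ∀ i ∈ t, ((A.filter fun z => flipAt z i ∈ A).card : ℝ) =
          ((B false).filter fun z => flipAt z i ∈ B false).card +
          ((B true).filter fun z => flipAt z i ∈ B true).card := by
        intro i hi
        have hij : j ≠ i := fun h => hj (h ▸ hi)
        have := Finset.card_filter_add_card_filter_not
          (s := A.filter fun z => flipAt z i ∈ A) fun z => z j = false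
        rw [← Nat.cast_add, ← this]
        congr 2
        · congr 1; ext z; simp [hB, flipAt_of_ne _ hij]; tauto
        · congr 1; ext z; simp [hB, flipAt_of_ne _ hij]; tauto
      have hjb : ∀ b, (A.filter fun z => flipAt z j ∈ A).card ≤ 2 * (B b).card := by
        intro b
        have := Finset.card_filter_add_card_filter_not
          (s := A.filter fun z => flipAt z j ∈ A) fun z => z j = b
        rw [← this, two_mul]
        refine add_le_add (Finset.card_le_card fun z => ?_) ?_
        · simp [hB]; tauto
        · refine Finset.card_le_card_of_injOn (fun z => flipAt z j) ?_
            (flipAt_injective j).injOn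
          intro z hz
          simp only [Finset.coe_filter, Finset.mem_filter, Set.mem_ofPred_eq] at hz
          simp only [hB, Finset.coe_filter, Set.mem_ofPred_eq, flipAt_same]
          refine ⟨hz.1.2, ?_⟩
          have := hz.2
          cases h : z j <;> cases b <;> simp_all
      rw [Finset.sum_congr rfl hsum, Finset.sum_add_distrib]
      have h0 := ih (B false)
      have h1 := ih (B true)
      rw [hcard]
      rcases le_total (B false).card (B true).card with h | h
      · have := entropy_step h
        have h2 : ((A.filter fun z => flipAt z j ∈ A).card : ℝ) ≤ 2 * (B false).card := by
          exact_mod_cast hjb false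
        linarith
      · have := entropy_step h
        have h2 : ((A.filter fun z => flipAt z j ∈ A).card : ℝ) ≤ 2 * (B true).card := by
          exact_mod_cast hjb true
        rw [add_comm ((B true).card : ℝ) ((B false).card : ℝ)] at this
        linarith

/-! ### Repairing a function in prescribed directions -/

section repair

variable {n : ℕ}

/-- The points of `f⁻¹(1)` at which moving bit `i` towards `b` leaves `f⁻¹(1)`. -/
def violations (f : Cube n → Bool) (i : Fin n) (b : Bool) : Finset (Cube n) :=
  (ones f).filter fun x => x i ≠ b ∧ f (flipAt x i) = false

/-- Sort the values of `f` on every edge in direction `i`, the larger value where the bit is `b`. -/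
def sortAt (f : Cube n → Bool) (i : Fin n) (b : Bool) : Cube n → Bool := fun x =>
  if x i = b then f x || f (flipAt x i) else f x && f (flipAt x i)

theorem violations_sortAt_same (f : Cube n → Bool) (i : Fin n) (b : Bool) :
    violations (sortAt f i b) i b = ∅ := by
  ext x
  simp only [violations, sortAt, mem_filter, mem_ones, flipAt_same, flipAt_flipAt]
  cases x i <;> cases b <;> cases f x <;> cases f (flipAt x i) <;> simp

/-- A statement about two-dimensional faces. Pairing every x with `flipAt x i` counts each violation
twice, and the summand then depends only on the four values of f on the face spanned by i and j, so
a finite check suffices. -/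
theorem card_violations_sortAt_le (f : Cube n → Bool) {i j : Fin n} (hij : j ≠ i) (b b' : Bool) :
    (violations (sortAt f i b) j b').card ≤ (violations f j b').card := by
  have h : ∀ g : Cube n → Bool, 2 * (violations g j b').card =
      ∑ x, ((if g x = true ∧ x j ≠ b' ∧ g (flipAt x j) = false then 1 else 0) +
        (if g (flipAt x i) = true ∧ x j ≠ b' ∧ g (flipAt (flipAt x i) j) = false
          then 1 else 0)) := by
    intro g
    have e : (violations g j b').card =
        ∑ x, (if g x = true ∧ x j ≠ b' ∧ g (flipAt x j) = false then 1 else 0) := by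
      rw [violations, ones, Finset.filter_filter, Finset.card_filter]
    rw [Finset.sum_add_distrib, two_mul]
    nth_rewrite 2 [e]
    rw [← e, ← Equiv.sum_comp (flipEquiv i)]
    simp [flipEquiv, flipAt_of_ne _ hij, violations, ones, Finset.filter_filter]
  have key := h (sortAt f i b)
  have key' := h f
  have : 2 * (violations (sortAt f i b) j b').card ≤ 2 * (violations f j b').card := by
    rw [key, key']
    refine Finset.sum_le_sum fun x _ => ?_
    simp only [sortAt, flipAt_same, flipAt_flipAt, flipAt_of_ne _ hij.symm]
    rw [flipAt_comm (flipAt x i) j i, flipAt_flipAt, flipAt_comm x j i]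
    cases x i <;> cases x j <;> cases b <;> cases b' <;> cases f x <;> cases f (flipAt x i) <;>
      cases f (flipAt x j) <;> cases f (flipAt (flipAt x i) j) <;> decide
  omega

theorem card_symmDiff_sortAt_le (f : Cube n → Bool) (i : Fin n) (b : Bool) :
    (symmDiff (ones f) (ones (sortAt f i b))).card ≤ 2 * (violations f i b).card := by
  have : symmDiff (ones f) (ones (sortAt f i b)) ⊆
      violations f i b ∪ (violations f i b).image fun x => flipAt x i := by
    intro x hx
    simp only [Finset.mem_symmDiff, mem_ones, sortAt] at hx
    simp only [Finset.mem_union, Finset.mem_image]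
    by_cases hb : x i = b
    · right
      refine ⟨flipAt x i, ?_, flipAt_flipAt x i⟩
      simp only [violations, mem_filter, mem_ones, flipAt_same, flipAt_flipAt]
      cases h1 : f x <;> cases h2 : f (flipAt x i) <;> simp_all
    · left
      simp only [violations, mem_filter, mem_ones]
      cases h1 : f x <;> cases h2 : f (flipAt x i) <;> simp_all
  refine (Finset.card_le_card this).trans ((Finset.card_union_le _ _).trans ?_)
  rw [two_mul]
  exact Nat.add_le_add_left Finset.card_image_le _

theorem unate_of_violations {g : Cube n → Bool} (b : Fin n → Bool)
    (h : ∀ i, violations g i (b i) = ∅) : Unate g := by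
  intro i
  have key : ∀ x : Cube n, g (Function.update x i (!b i)) ≤ g (Function.update x i (b i)) := by
    intro x
    by_contra hlt
    have h1 : g (Function.update x i (!b i)) = true ∧ g (Function.update x i (b i)) = false := by
      revert hlt
      cases g (Function.update x i (!b i)) <;> cases g (Function.update x i (b i)) <;> simp
    have : Function.update x i (!b i) ∈ violations g i (b i) := by
      refine Finset.mem_filter.2 ⟨mem_ones.2 h1.1, by simp, ?_⟩
      simpa [flipAt] using h1.2
    simp [h i] at this
  cases hb : b i
  · right; simpa [hb] using key
  · left; simpa [hb] using key

/-- Sort one direction after another. Sorting destroys no direction already repaired and creates no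
violations elsewhere, so each step costs at most twice the violations of the original f in that
direction. -/
theorem exists_unate_near (f : Cube n → Bool) (b : Fin n → Bool) :
    ∃ g, Unate g ∧ (symmDiff (ones f) (ones g)).card ≤ 2 * ∑ i, (violations f i (b i)).card := by
  have : ∀ s : Finset (Fin n), ∃ g : Cube n → Bool, (∀ i ∈ s, violations g i (b i) = ∅) ∧
      (∀ i, (violations g i (b i)).card ≤ (violations f i (b i)).card) ∧
      (symmDiff (ones f) (ones g)).card ≤ 2 * ∑ i ∈ s, (violations f i (b i)).card := by
    intro s
    induction s using Finset.induction_on with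
    | empty => exact ⟨f, by simp, fun _ => le_rfl, by simp⟩
    | insert j t hj ih =>
        obtain ⟨g, h1, h2, h3⟩ := ih
        have h4 : ∀ i, (violations (sortAt g j (b j)) i (b i)).card ≤
            (violations g i (b i)).card := by
          intro i
          by_cases hij : i = j
          · subst hij; simp [violations_sortAt_same]
          · exact card_violations_sortAt_le g hij _ _
        refine ⟨sortAt g j (b j), ?_, fun i => (h4 i).trans (h2 i), ?_⟩
        · intro i hi
          rcases Finset.mem_insert.1 hi with rfl | hi
          · exact violations_sortAt_same _ _ _
          · have := h4 i
            rw [h1 i hi, Finset.card_empty] at this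
            exact Finset.card_eq_zero.1 (Nat.le_zero.1 this)
        · have h5 := card_symmDiff_sortAt_le g j (b j)
          have h6 := h2 j
          have h7 : symmDiff (ones f) (ones (sortAt g j (b j))) ⊆
              symmDiff (ones f) (ones g) ∪ symmDiff (ones g) (ones (sortAt g j (b j))) :=
            symmDiff_triangle _ _ _
          have h8 := (Finset.card_le_card h7).trans (Finset.card_union_le _ _)
          rw [Finset.sum_insert hj]
          omega
  obtain ⟨g, h1, _, h3⟩ := this Finset.univ
  exact ⟨g, unate_of_violations b fun i => h1 i (Finset.mem_univ i), h3⟩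

theorem reldistUnate_le (f : Cube n → Bool) {g : Cube n → Bool} (hg : Unate g) :
    reldistUnate f ≤ reldist f g :=
  ciInf_le (f := fun g : {g : Cube n → Bool // Unate g} => reldist f g.1)
    ⟨0, by rintro _ ⟨g, rfl⟩; exact div_nonneg (Nat.cast_nonneg _) (Nat.cast_nonneg _)⟩ ⟨g, hg⟩

end repair

/-! ### Frequencies and concentration -/

section freq

variable {β : Type} {s : Finset β}

open Classical in
/-- The probability that a uniform element of `s` satisfies `p`. -/
noncomputable def freq (s : Finset β) (p : β → Prop) : ℝ := 𝔼 z ∈ s, if p z then 1 else 0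

theorem freq_eq_div (s : Finset β) (p : β → Prop) [DecidablePred p] :
    freq s p = ((s.filter p).card : ℝ) / s.card := by
  rw [freq, Finset.expect_eq_sum_div_card, Finset.card_filter]
  push_cast
  congr 1
  exact Finset.sum_congr rfl fun _ _ => by congr

theorem freq_nonneg (s : Finset β) (p : β → Prop) : 0 ≤ freq s p :=
  Finset.expect_nonneg fun _ _ => by split_ifs <;> norm_num

theorem freq_mono {p q : β → Prop} (h : ∀ z ∈ s, p z → q z) : freq s p ≤ freq s q := by
  refine Finset.expect_le_expect fun z hz => ?_
  by_cases hp : p z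
  · simp [hp, h z hz hp]
  · simp only [hp, if_false]; split_ifs <;> norm_num

theorem freq_congr {p q : β → Prop} (h : ∀ z ∈ s, (p z ↔ q z)) : freq s p = freq s q :=
  le_antisymm (freq_mono fun z hz => (h z hz).1) (freq_mono fun z hz => (h z hz).2)

theorem freq_add_not (hs : s.Nonempty) (p : β → Prop) :
    freq s p + freq s (fun z => ¬ p z) = 1 := by
  rw [freq, freq, ← Finset.expect_add_distrib]
  refine (Finset.expect_congr rfl fun z _ => ?_).trans (Finset.expect_const hs (1 : ℝ))
  by_cases h : p z <;> simp [h]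

theorem freq_le_one (hs : s.Nonempty) (p : β → Prop) : freq s p ≤ 1 := by
  linarith [freq_add_not hs p, freq_nonneg s fun z => ¬ p z]

theorem freq_and_add (p q : β → Prop) :
    freq s (fun z => p z ∧ q z) + freq s (fun z => p z ∧ ¬ q z) = freq s p := by
  rw [freq, freq, freq, ← Finset.expect_add_distrib]
  refine Finset.expect_congr rfl fun z _ => ?_
  by_cases h : p z <;> by_cases h' : q z <;> simp [h, h']

theorem listProb_forall_eq (k : ℕ) (p : β → Prop) :
    listProb s k (fun S => ∀ z ∈ S, p z) = freq s p ^ k := listProb_forall k p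

/-- The deviation of the number of elements of a list with `X` from its expectation. -/
noncomputable def deviation (s : Finset β) (X : β → Bool) (S : List β) : ℝ :=
  S.countP X - S.length * freq s fun z => X z = true

/-- The moment generating function factorizes over the samples. The true variance μ(1 - μ) is kept,
since the bound must become small for nearly constant coordinates. -/
theorem listExpect_exp_deviation_le (hs : s.Nonempty) (X : β → Bool) (k : ℕ) {t : ℝ}
    (ht : |t| ≤ 1) : listExpect s k (fun S => Real.exp (t * deviation s X S)) ≤
      (1 + (freq s fun z => X z = true) * (1 - freq s fun z => X z = true) * t ^ 2) ^ k := by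
  set μ := freq s fun z => X z = true with hμ
  have h0 : 0 ≤ μ := freq_nonneg _ _
  have h1 : μ ≤ 1 := freq_le_one hs _
  have h2 : ∀ S : List β, Real.exp (t * deviation s X S) =
      (S.map fun z => Real.exp (t * ((if X z = true then 1 else 0) - μ))).prod := by
    intro S
    induction S with
    | nil => simp [deviation]
    | cons z S ih =>
        rw [List.map_cons, List.prod_cons, ← ih, ← Real.exp_add]
        congr 1
        simp only [deviation, List.countP_cons, List.length_cons, ← hμ]
        split_ifs <;> push_cast <;> ring
  simp only [h2]
  rw [listExpect_prod]
  refine pow_le_pow_left₀ (Finset.expect_nonneg fun _ _ => (Real.exp_pos _).le) ?_ k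
  -- This is e^u ≤ 1 + u + u² for |u| ≤ 1. Since the indicator X is idempotent, (X - μ)² = (1 - 2μ)X
  -- + μ² is linear in X, which allows taking expectations.
  have h3 : ∀ z, Real.exp (t * ((if X z = true then 1 else 0) - μ)) ≤
      1 + t * ((if X z = true then 1 else 0) - μ) +
        t ^ 2 * ((1 - 2 * μ) * (if X z = true then 1 else 0) + μ ^ 2) := by
    intro z
    have hle : |t * ((if X z = true then 1 else 0) - μ)| ≤ 1 := by
      rw [abs_mul]
      refine mul_le_one₀ ht (abs_nonneg _) ?_
      split_ifs <;> rw [abs_le] <;> constructor <;> linarith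
    have := (abs_le.1 (Real.abs_exp_sub_one_sub_id_le hle)).2
    have e : (t * ((if X z = true then (1 : ℝ) else 0) - μ)) ^ 2 =
        t ^ 2 * ((1 - 2 * μ) * (if X z = true then 1 else 0) + μ ^ 2) := by
      split_ifs <;> ring
    linarith
  refine (Finset.expect_le_expect fun z _ => h3 z).trans_eq ?_
  have hμ' : 𝔼 z ∈ s, (if X z = true then (1 : ℝ) else 0) = μ := by
    rw [hμ, freq]
    exact Finset.expect_congr rfl fun z _ => by congr
  simp only [Finset.expect_add_distrib, Finset.expect_sub_distrib, ← Finset.mul_expect,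
    Finset.expect_const hs, hμ']
  ring

theorem listExpect_cosh_deviation_le (hs : s.Nonempty) (X : β → Bool) (k : ℕ) {t : ℝ}
    (ht : |t| ≤ 1) : listExpect s k (fun S => Real.cosh (t * deviation s X S)) ≤
      (1 + (freq s fun z => X z = true) * (1 - freq s fun z => X z = true) * t ^ 2) ^ k := by
  have h : ∀ S : List β, Real.cosh (t * deviation s X S) =
      2⁻¹ * (Real.exp (t * deviation s X S) + Real.exp (-t * deviation s X S)) := by
    intro S
    rw [Real.cosh_eq, neg_mul]; ring
  simp only [h]
  rw [listExpect_mul, listExpect_add]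
  have h1 := listExpect_exp_deviation_le hs X k ht
  have h2 := listExpect_exp_deviation_le hs X k (t := -t) (by rwa [abs_neg])
  rw [neg_sq] at h2
  linarith

theorem cosh_le_of_lt_abs {t r D : ℝ} (hr : 0 ≤ r) (h : r < |D|) :
    Real.cosh (t * r) ≤ Real.cosh (t * D) := by
  rw [Real.cosh_le_cosh, abs_mul, abs_mul, abs_of_nonneg hr]
  exact mul_le_mul_of_nonneg_left h.le (abs_nonneg t)

theorem freq_mul_le (s : Finset β) (p : β → Prop) : freq s p * (1 - freq s p) ≤ 1 / 4 := by
  nlinarith [sq_nonneg (freq s p - 1 / 2)]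

theorem listProb_deviation_le (hs : s.Nonempty) (X : β → Bool) (k : ℕ) {t r : ℝ} (ht : 0 < t)
    (ht1 : t ≤ 1) (hr : 0 ≤ r) : listProb s k (fun S => r < |deviation s X S|) ≤
      2 * Real.exp (k * t ^ 2 / 4 - t * r) := by
  have h1 : listProb s k (fun S => r < |deviation s X S|) ≤
      listExpect s k fun S => 2 * Real.exp (-(t * r)) * Real.cosh (t * deviation s X S) := by
    refine listExpect_mono fun S _ _ => ?_
    split_ifs with h
    · have h2 := cosh_le_of_lt_abs (t := t) hr h
      have h3 : Real.exp (t * r) / 2 ≤ Real.cosh (t * r) := by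
        rw [Real.cosh_eq]; linarith [Real.exp_pos (-(t * r))]
      have h4 := mul_le_mul_of_nonneg_left (h3.trans h2)
        (show 0 ≤ 2 * Real.exp (-(t * r)) by positivity)
      refine le_trans (le_of_eq ?_) h4
      have : Real.exp (-(t * r)) * Real.exp (t * r) = 1 := by rw [← Real.exp_add]; simp
      linarith
    · exact mul_nonneg (by positivity) (Real.cosh_pos _).le
  refine h1.trans ?_
  rw [listExpect_mul]
  have h5 := listExpect_cosh_deviation_le hs X k (t := t) (by rwa [abs_of_pos ht])
  have h6 : (1 + (freq s fun z => X z = true) * (1 - freq s fun z => X z = true) * t ^ 2) ^ k ≤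
      Real.exp (k * t ^ 2 / 4) := by
    have e : Real.exp (k * t ^ 2 / 4) = Real.exp (t ^ 2 / 4) ^ k := by
      rw [← Real.exp_nat_mul]; congr 1; ring
    rw [e]
    have h0 : 0 ≤ (freq s fun z => X z = true) * (1 - freq s fun z => X z = true) :=
      mul_nonneg (freq_nonneg _ _) (by linarith [freq_le_one hs fun z => X z = true])
    refine pow_le_pow_left₀ (by positivity) ?_ k
    have := freq_mul_le s fun z => X z = true
    have h7 := Real.add_one_le_exp (t ^ 2 / 4)
    nlinarith [sq_nonneg t]
  calc _ ≤ 2 * Real.exp (-(t * r)) * Real.exp (k * t ^ 2 / 4) :=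
        mul_le_mul_of_nonneg_left (h5.trans h6) (by positivity)
    _ = _ := by rw [mul_assoc, ← Real.exp_add]; congr 2; ring

/-- Markov's inequality is applied to cosh(tD) - 1 instead of cosh(tD): its expectation is at most
(1 + v)^k - 1 with v = t² times the variance, and this vanishes with the variance. The factor k that
appears is absorbed by weakening the exponent. -/
theorem listProb_deviation_le_variance (hs : s.Nonempty) (X : β → Bool) {k : ℕ}
    (hk : 3200 ≤ k) : listProb s k (fun S => (k : ℝ) / 40 < |deviation s X S|) ≤
      32 * ((freq s fun z => X z = true) * (1 - freq s fun z => X z = true)) *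
        Real.exp (-(k / 3200 : ℝ)) := by
  set q := (freq s fun z => X z = true) * (1 - freq s fun z => X z = true) with hq
  have hq0 : 0 ≤ q :=
    mul_nonneg (freq_nonneg _ _) (by linarith [freq_le_one hs fun z => X z = true])
  have hq4 : q ≤ 1 / 4 := freq_mul_le s _
  have hk' : (3200 : ℝ) ≤ k := by exact_mod_cast hk
  set E := Real.exp (k / 3200 : ℝ) with hE
  have hEpos : 0 < E := Real.exp_pos _
  have hkE : (k : ℝ) / 3200 ≤ E := by linarith [Real.add_one_le_exp (k / 3200 : ℝ)]
  have hE2 : 2 ≤ E := by linarith [Real.add_one_le_exp (k / 3200 : ℝ)]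
  have e800 : Real.exp (k / 800 : ℝ) = E ^ 4 := by
    rw [hE, ← Real.exp_nat_mul]; congr 1; push_cast; ring
  have e1600 : Real.exp (k / 1600 : ℝ) = E ^ 2 := by
    rw [hE, ← Real.exp_nat_mul]; congr 1; push_cast; ring
  -- With t = 1/20 and r = k/40 one has tr = k/800, hence cosh(tr) - 1 ≥ E⁴/4 for E = e^(k/3200) ≥
  -- 2.
  set c := Real.cosh (1 / 20 * (k / 40 : ℝ)) - 1 with hc
  have hc4 : E ^ 4 / 4 ≤ c := by
    rw [hc, Real.cosh_eq]
    have e : (1 / 20 * (k / 40 : ℝ)) = k / 800 := by ring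
    rw [e, e800]
    have : (16 : ℝ) ≤ E ^ 4 := by
      calc (16 : ℝ) = 2 ^ 4 := by norm_num
        _ ≤ E ^ 4 := pow_le_pow_left₀ (by norm_num) hE2 4
    linarith [Real.exp_pos (-(k / 800 : ℝ))]
  have hcpos : 0 < c := lt_of_lt_of_le (by positivity) hc4
  have h1 : listProb s k (fun S => (k : ℝ) / 40 < |deviation s X S|) ≤
      listExpect s k fun S => c⁻¹ * (Real.cosh (1 / 20 * deviation s X S) + (-1)) := by
    refine listExpect_mono fun S _ _ => ?_
    have hcosh : 0 ≤ Real.cosh (1 / 20 * deviation s X S) + (-1) := by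
      linarith [Real.one_le_cosh (1 / 20 * deviation s X S)]
    split_ifs with h
    · have h2 := cosh_le_of_lt_abs (t := 1 / 20) (by positivity) h
      rw [inv_mul_eq_div, one_le_div hcpos]
      linarith
    · positivity
  refine h1.trans ?_
  rw [listExpect_mul, listExpect_add, listExpect_const hs]
  have h5 := listExpect_cosh_deviation_le hs X k (t := 1 / 20) (by rw [abs_of_pos] <;> norm_num)
  rw [← hq] at h5
  set v := q * (1 / 20 : ℝ) ^ 2 with hv
  have hv0 : 0 ≤ v := by positivity
  have h6 : (1 + v) ^ k ≤ E ^ 2 := by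
    rw [← e1600]
    have e : Real.exp (k / 1600 : ℝ) = Real.exp (1 / 1600) ^ k := by
      rw [← Real.exp_nat_mul]; congr 1; ring
    rw [e]
    refine pow_le_pow_left₀ (by positivity) ?_ k
    have := Real.add_one_le_exp (1 / 1600 : ℝ)
    have hv4 : v ≤ 1 / 1600 := by rw [hv]; linarith
    linarith
  -- Bernoulli's inequality for the inverse (1 + v)⁻¹ = 1 - v/(1 + v) gives the upper bound that is
  -- linear in v.
  have h7 : (1 + v) ^ k - 1 ≤ k * v * (1 + v) ^ k := by
    have hb := one_add_mul_le_pow (a := -(v / (1 + v))) (by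
      have : v / (1 + v) ≤ 1 := by rw [div_le_one (by positivity)]; linarith
      linarith) k
    have e : 1 + -(v / (1 + v)) = (1 + v)⁻¹ := by field_simp; ring
    rw [e, inv_pow] at hb
    have hpos : 0 < (1 + v) ^ k := by positivity
    have h8 := mul_le_mul_of_nonneg_right hb hpos.le
    rw [inv_mul_cancel₀ hpos.ne'] at h8
    have h9 : v / (1 + v) ≤ v := div_le_self hv0 (by linarith)
    have h10 : k * (v / (1 + v)) * (1 + v) ^ k ≤ k * v * (1 + v) ^ k := by gcongr
    linarith
  have h8 : (1 + v) ^ k - 1 ≤ 3200 * E * v * E ^ 2 := by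
    refine h7.trans ?_
    have : (k : ℝ) ≤ 3200 * E := by linarith
    gcongr
  calc c⁻¹ * (listExpect s k (fun S => Real.cosh (1 / 20 * deviation s X S)) + -1)
      ≤ (E ^ 4 / 4)⁻¹ * (3200 * E * v * E ^ 2) := by
        have h9 : listExpect s k (fun S => Real.cosh (1 / 20 * deviation s X S)) + -1 ≤
          3200 * E * v * E ^ 2 := by linarith
        have h10 : 0 ≤ 3200 * E * v * E ^ 2 := by positivity
        calc _ ≤ c⁻¹ * (3200 * E * v * E ^ 2) := mul_le_mul_of_nonneg_left h9 (by positivity)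
          _ ≤ _ := mul_le_mul_of_nonneg_right (inv_anti₀ (by positivity) hc4) h10
    _ = 32 * q * Real.exp (-(k / 3200 : ℝ)) := by
        rw [Real.exp_neg, ← hE, hv]; field_simp; ring

end freq

/-! ### Concentration of empirical coordinate frequencies -/

section empirical

variable {n : ℕ} {s : Finset (Cube n)}

theorem abs_empirical_sub (i : Fin n) {S : List (Cube n)} {k : ℕ} (hk : 0 < k)
    (hS : S.length = k) : |empirical S i - freq s fun z => z i = true| =
      |deviation s (fun z => z i) S| / k := by
  have hk' : (0 : ℝ) < k := by exact_mod_cast hk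
  rw [show |deviation s (fun z => z i) S| / k = |deviation s (fun z => z i) S / k| by
    rw [abs_div, abs_of_pos hk'], empirical, deviation, hS]
  congr 1
  field_simp

theorem listProb_empirical_eq (i : Fin n) {k : ℕ} (hk : 0 < k) (r : ℝ) :
    listProb s k (fun S => r < |empirical S i - freq s fun z => z i = true|) =
      listProb s k (fun S => k * r < |deviation s (fun z => z i) S|) := by
  have hk' : (0 : ℝ) < k := by exact_mod_cast hk
  refine le_antisymm (listProb_mono fun S h1 _ h => ?_) (listProb_mono fun S h1 _ h => ?_)
  · rw [abs_empirical_sub i hk h1, lt_div_iff₀ hk'] at h; linarith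
  · rw [abs_empirical_sub i hk h1, lt_div_iff₀ hk']; linarith

theorem listProb_empirical_twentieth (hs : s.Nonempty) (i : Fin n) {k : ℕ} (hk : 0 < k) :
    listProb s k (fun S => 1 / 20 < |empirical S i - freq s fun z => z i = true|) ≤
      2 * Real.exp (-(k / 400 : ℝ)) := by
  rw [listProb_empirical_eq i hk]
  -- The choice t = 2r/k minimizes kt²/4 - tr; here r = k/20.
  refine (listProb_deviation_le hs _ k (t := 1 / 10) (by norm_num) (by norm_num)
    (by positivity)).trans_eq ?_
  congr 2; ring

theorem listProb_empirical_fortieth (hs : s.Nonempty) (i : Fin n) {k : ℕ} (hk : 0 < k) :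
    listProb s k (fun S => 1 / 40 < |empirical S i - freq s fun z => z i = true|) ≤
      2 * Real.exp (-(k / 1600 : ℝ)) := by
  rw [listProb_empirical_eq i hk]
  refine (listProb_deviation_le hs _ k (t := 1 / 20) (by norm_num) (by norm_num)
    (by positivity)).trans_eq ?_
  congr 2; ring

theorem listProb_empirical_variance (hs : s.Nonempty) (i : Fin n) {k : ℕ} (hk : 3200 ≤ k) :
    listProb s k (fun S => 1 / 40 < |empirical S i - freq s fun z => z i = true|) ≤
      32 * ((freq s fun z => z i = true) * (1 - freq s fun z => z i = true)) *
        Real.exp (-(k / 3200 : ℝ)) := by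
  rw [listProb_empirical_eq i (by omega)]
  refine le_trans (le_of_eq ?_) (listProb_deviation_le_variance hs _ hk)
  congr 1
  funext S
  rw [mul_one_div]

end empirical

end RelUnate

namespace RelUnate

open Finset Algo
open scoped BigOperators

variable {n : ℕ} {f : Cube n → Bool} {hf : (ones f).Nonempty} {V : Verdict → Prop}

theorem Algo.surv_bind_le_of_ensures {α β : Type} {A : Algo n α} {k : α → Algo n β} {c : ℕ∞}
    {η : ℝ} {V : Verdict → Prop} {Q : α → Prop} (h : Ensures f hf A c η V Q)
    (hk : ∀ a, Q a → surv f hf (k a) ≤ 0) : surv f hf (A >>= k) ≤ η := by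
  refine (prob_bind_le A k _ (fun o _ => o.isRight = true) le_rfl (by simp) ?_).trans
    ((add_le_add h (zero_mul _).le).trans_eq (add_zero η))
  intro a q hB
  rw [not_not] at hB
  exact hk a hB.2

theorem Algo.Ensures.sure_bind {α β : Type} {A : Algo n α} {k : α → Algo n β} {c₁ c₂ : ℕ∞} {η : ℝ}
    {Q : α → Prop} {R : β → Prop} (h : Ensures f hf A c₁ 0 V Q) (hη : 0 ≤ η)
    (hk : ∀ a, Q a → Ensures f hf (k a) c₂ η V R) :
    Ensures f hf (A >>= k) (c₁ + c₂) η V R :=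
  (h.bind hη hk).mono_prob (zero_add η).le

/-! ### Logarithms -/

theorem half_pow_ceilLog {t : ℝ} (ht : 0 < t) : (1 / 2 : ℝ) ^ ceilLog (1 / t) ≤ t := by
  have h1 : Real.logb 2 (1 / t) ≤ ceilLog (1 / t) := Nat.le_ceil _
  rw [Real.logb_le_iff_le_rpow (by norm_num) (by positivity), Real.rpow_natCast] at h1
  rw [one_div_pow]
  rw [div_le_iff₀ ht] at h1
  rw [div_le_iff₀ (by positivity)]
  linarith

theorem ceilLog_pos {δ : ℝ} (h0 : 0 < δ) (h1 : δ < 1) : 1 ≤ ceilLog (1 / δ) := by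
  rw [ceilLog, Nat.one_le_ceil_iff]
  exact Real.logb_pos (by norm_num) (by rw [lt_div_iff₀ h0]; linarith)

/-! ### ConfirmDirection -/

theorem ensures_confirmRounds (i : Fin n) (b : Bool) (t : ℕ) :
    Ensures f hf (confirmRounds i b t) ((2 * t : ℕ) : ℕ∞) 0 V fun yes =>
      yes = true → ∃ z, f z = true ∧ z i = b ∧ f (flipAt z i) = false := by
  induction t with
  | zero => exact ensures_ret le_rfl (by simp)
  | succ t ih =>
      refine (ensures_sample_bind (c := ((2 * t : ℕ) : ℕ∞) + 1) fun z hz =>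
        ensures_ask_bind ?_).mono_cost (by norm_cast)
      split_ifs with h
      · exact ensures_ret le_rfl fun _ => ⟨z, mem_ones.1 hz, h⟩
      · exact ih

/-- Here the answer No counts as the error: every round has to miss an event of frequency κ. -/
theorem ensures_confirmRounds_yes (i : Fin n) (b : Bool) (t : ℕ) :
    Ensures f hf (confirmRounds i b t) ((2 * t : ℕ) : ℕ∞)
      ((1 - freq (ones f) fun z => z i = b ∧ f (flipAt z i) = false) ^ t) V fun yes =>
      yes = true := by
  classical
  set κ := freq (ones f) fun z => z i = b ∧ f (flipAt z i) = false with hκ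
  have h1 : κ ≤ 1 := freq_le_one hf _
  induction t with
  | zero => exact ensures_of_one_le (by simp)
  | succ t ih =>
      refine (ensures_samp (c := ((2 * t : ℕ) : ℕ∞) + 1) (h := fun z =>
        (1 - if z i = b ∧ f (flipAt z i) = false then 1 else 0) * (1 - κ) ^ t) (fun z hz =>
        ensures_ask_bind ?_) ?_).mono_cost (by norm_cast)
      · split_ifs with h
        · exact ensures_ret (by simp) rfl
        · simpa using ih
      · rw [← Finset.expect_mul, Finset.expect_sub_distrib, Finset.expect_const hf, pow_succ',
          hκ, freq]
        refine le_of_eq ?_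
        congr 2
        exact Finset.expect_congr rfl fun z _ => by congr

/-- The hypothesis `hV` recurs below and serves both claims on correctness: either f is unate, and a
rejection would contradict `not_unate_of_edges`, or rejecting is an allowed verdict. The edge `w`
against d supplies the second orientation. -/
theorem ensures_rejectIfConfirmed (hV : Unate f ∨ V Verdict.reject) {d : PStr n} {i : Fin n}
    {b : Bool} (hb : d i = some b)
    (h : ∃ w, f w = true ∧ w i ≠ b ∧ f (flipAt w i) = false) :
    Ensures f hf (rejectIfConfirmed d i) 50 0 V fun _ => True := by
  refine ((ensures_confirmRounds i _ 25).bind (c₂ := 0) (η₂ := 0) le_rfl fun yes hyes => ?_).mono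
    (by norm_num) (by norm_num) (fun _ => id) fun _ => id
  split_ifs with hy
  · refine ensures_halt le_rfl (hV.resolve_left ?_)
    obtain ⟨z, hz, hzb, hz'⟩ := hyes hy
    obtain ⟨w, hw, hwb, hw'⟩ := h
    rw [hb, Option.getD_some] at hzb
    exact not_unate_of_edges hz hw (by rw [hzb]; exact hwb.symm) hz' hw'
  · exact ensures_ret le_rfl trivial

/-! ### Reliable partial strings -/

/-- On fixed coordinates `d` agrees with most of `f⁻¹(1)`, and unfixed coordinates are not too
biased. -/
def Reliable (f : Cube n → Bool) (d : PStr n) : Prop :=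
  ∀ i b, (d i = some b → 13 / 20 ≤ freq (ones f) fun z => z i = b) ∧
    (d i = none → 3 / 20 ≤ freq (ones f) fun z => z i = b)

/-- Flipping bit i maps the points on the left injectively to those on the right. -/
theorem freq_flip_le (i : Fin n) (b : Bool) :
    (freq (ones f) fun z => z i = b ∧ f (flipAt z i) = true) ≤
      freq (ones f) fun z => ¬ z i = b := by
  classical
  rw [freq_eq_div, freq_eq_div]
  gcongr ?_ / _
  norm_cast
  refine Finset.card_le_card_of_injOn (fun z => flipAt z i) ?_ (flipAt_injective i).injOn
  intro z hz
  simp only [Finset.coe_filter, Set.mem_ofPred_eq, mem_ones] at hz ⊢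
  exact ⟨hz.2.2, by simp [hz.2.1]⟩

/-- At least 13/20 of the points have z_i = b, and at most 7/20 of all points can be matched with a
neighbour having the other bit; 6/20 remain on the boundary. -/
theorem Reliable.confirm {d : PStr n} (hd : Reliable f d) (hf : (ones f).Nonempty) {i : Fin n}
    {b : Bool} (hb : d i = some b) :
    3 / 10 ≤ freq (ones f) fun z => z i = b ∧ f (flipAt z i) = false := by
  have h1 := (hd i b).1 hb
  have h2 := freq_flip_le (f := f) i b
  have h3 := freq_add_not hf fun z => z i = b
  have h4 := freq_and_add (s := ones f) (fun z => z i = b) fun z => f (flipAt z i) = true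
  simp only [Bool.not_eq_true] at h4
  linarith

theorem surv_rejectIfConfirmed_le {d : PStr n} (hd : Reliable f d) {i : Fin n} {b : Bool}
    (hb : d i = some b) : surv f hf (rejectIfConfirmed d i) ≤ 1 / 100 := by
  refine (surv_bind_le_of_ensures (V := fun _ => True)
    (ensures_confirmRounds_yes (hf := hf) i _ 25) fun yes hyes => ?_).trans ?_
  · simp [hyes]
  · have h1 := hd.confirm hf hb
    rw [hb, Option.getD_some]
    have h2 := freq_le_one hf fun z => z i = b ∧ f (flipAt z i) = false
    calc _ ≤ (7 / 10 : ℝ) ^ 25 := pow_le_pow_left₀ (by linarith) (by linarith) 25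
      _ ≤ 1 / 100 := by norm_num

/-! ### CheckSamples -/

theorem mem_diffCoords_toPStr {x y : Cube n} {i : Fin n} :
    i ∈ diffCoords (toPStr x) (toPStr y) ↔ x i ≠ y i := by
  simp [diffCoords, fixedCoords, toPStr]

theorem mem_diffCoords {x : Cube n} {d : PStr n} {i : Fin n} :
    i ∈ diffCoords (toPStr x) d ↔ d i = some (!(x i)) := by
  rw [diffCoords, Finset.mem_filter, Finset.mem_inter]
  simp only [fixedCoords, toPStr, Finset.mem_filter, Finset.mem_univ, true_and]
  cases h : d i with
  | none => simp
  | some b => cases b <;> cases x i <;> simp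

theorem ensures_checkSamples (hV : Unate f ∨ V Verdict.reject) {a : Cube n} (ha : a ∈ ones f)
    {S : List (Cube n)} (hS : ∀ z ∈ S, z ∈ ones f) (δ' : ℝ) :
    Ensures f hf (checkSamples a S δ') ((2 * ceilLog (1 / δ') : ℕ) : ℕ∞) 0 V fun _ => True := by
  unfold checkSamples
  split
  · exact ensures_ret le_rfl trivial
  · rename_i z hz
    have hbody : ∀ i ∈ diffCoords (toPStr a) (toPStr z), Ensures f hf (do
        let u ← ask (flipAt a i)
        let v ← ask (flipAt z i)
        if u = false ∧ v = false then halt Verdict.reject else ret () : Algo n Unit)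
        (0 + 1 + 1) 0 V fun _ => True := by
      intro i hi
      refine ensures_ask_bind (ensures_ask_bind ?_)
      split_ifs with h
      · refine ensures_halt le_rfl (hV.resolve_left ?_)
        exact not_unate_of_edges (mem_ones.1 ha) (mem_ones.1 (hS z (List.argmax_mem hz)))
          (mem_diffCoords_toPStr.1 hi) h.1 h.2
      · exact ensures_ret le_rfl trivial
    refine (ensures_repeatN _ (ensures_withRandom le_rfl hbody fun _ => trivial)).mono_cost ?_
    push_cast
    rw [mul_comm]
    norm_num

/-- Distinct coordinates give distinct flipped points. This is what makes distances comparable with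
N. -/
theorem card_filter_flipAt_le (x : Cube n) (D : Finset (Fin n)) :
    (D.filter fun i => f (flipAt x i) = true).card ≤ (ones f).card := by
  refine Finset.card_le_card_of_injOn (fun i => flipAt x i) ?_ (flipAt_left_injective x).injOn
  intro i hi
  simp only [Finset.coe_filter, Set.mem_ofPred_eq] at hi
  exact mem_ones.2 hi.2

/-- If the farthest z is more than 4N away from a, at most N of the coordinates in question keep
`flipAt a i` in f⁻¹(1), and at most N keep `flipAt z i` there. So at least half of them reject, and
the ⌈log(1/δ')⌉ trials survive with probability at most δ'. -/
theorem ensures_checkSamples_near (hV : Unate f ∨ V Verdict.reject) {a : Cube n} (ha : a ∈ ones f)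
    {S : List (Cube n)} (hS : ∀ z ∈ S, z ∈ ones f) {δ' : ℝ} (hδ : 0 < δ') :
    Ensures f hf (checkSamples a S δ') ((2 * ceilLog (1 / δ') : ℕ) : ℕ∞) δ' V fun _ =>
      ∀ z ∈ S, hdist (toPStr a) (toPStr z) ≤ 4 * (ones f).card := by
  have hsure := ensures_checkSamples (hf := hf) hV ha hS δ'
  rcases hz : S.argmax fun z => hdist (toPStr a) (toPStr z) with _ | z
  · rw [List.argmax_eq_none] at hz
    subst hz
    exact hsure.mono le_rfl hδ.le (fun _ => id) (by simp)
  · by_cases hfar : hdist (toPStr a) (toPStr z) ≤ 4 * (ones f).card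
    · refine hsure.mono le_rfl hδ.le (fun _ => id) fun _ _ y hy => ?_
      exact (List.le_of_mem_argmax hy hz).trans hfar
    · refine hsure.of_surv ?_
      unfold checkSamples
      rw [hz]
      refine (surv_repeatN_le _ (ρ := 1 / 2) ?_).trans (half_pow_ceilLog hδ)
      set D := diffCoords (toPStr a) (toPStr z) with hD
      have hcard : 4 * (ones f).card < D.card := not_le.1 hfar
      have hne : D.Nonempty := Finset.card_pos.1 (by omega)
      rw [surv_withRandom hne]
      have h1 : ∀ i ∈ D, surv f hf (do
          let u ← ask (flipAt a i)
          let v ← ask (flipAt z i)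
          if u = false ∧ v = false then halt Verdict.reject else ret () : Algo n Unit) ≤
          (if f (flipAt a i) = true then 1 else 0) + (if f (flipAt z i) = true then 1 else 0) := by
        intro i _
        rw [surv_ask_bind, surv_ask_bind]
        cases f (flipAt a i) <;> cases f (flipAt z i) <;> simp
      refine (Finset.expect_le_expect h1).trans ?_
      rw [Finset.expect_eq_sum_div_card, Finset.sum_add_distrib, Finset.sum_boole,
        Finset.sum_boole]
      have h2 : ((D.filter fun i => f (flipAt a i) = true).card : ℝ) ≤ (ones f).card := by
        exact_mod_cast card_filter_flipAt_le a D
      have h3 : ((D.filter fun i => f (flipAt z i) = true).card : ℝ) ≤ (ones f).card := by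
        exact_mod_cast card_filter_flipAt_le z D
      have h4 : 4 * ((ones f).card : ℝ) < D.card := by exact_mod_cast hcard
      rw [div_le_iff₀ (by positivity)]
      linarith

/-! ### IterativeBias: estimating the biases -/

/-- `p` approximates the biases of all coordinates up to `1/10`. -/
def Accurate (f : Cube n → Bool) (p : Fin n → ℝ) : Prop :=
  ∀ i, |p i - freq (ones f) fun z => z i = true| ≤ 1 / 10

/-- The constants are 3/4 - 1/10 = 13/20 and 1/4 - 1/10 = 3/20. -/
theorem Accurate.reliable {p : Fin n → ℝ} (hp : Accurate f p) (hf : (ones f).Nonempty) :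
    Reliable f (biasVector p) := by
  intro i b
  have h1 := abs_le.1 (hp i)
  have h2 := freq_add_not hf fun z => z i = true
  simp only [Bool.not_eq_true] at h2
  unfold biasVector
  constructor
  · intro h
    split_ifs at h with h3 h4
    · cases h; linarith
    · cases h; linarith
  · intro h
    split_ifs at h with h3 h4
    cases b <;> linarith

/-- The number of samples in each of the two lists of round `l`. -/
noncomputable def biasSamples (δ : ℝ) (l : ℕ) : ℕ := 4000 * (2 * l + ceilLog (1 / δ))

/-- The number of oracle calls in round `l`. -/
noncomputable def biasCost (δ : ℝ) (l : ℕ) : ℕ :=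
  2 * biasSamples δ l + 2 * ceilLog (1 / (δ / (48 * (l : ℝ))))

/-- The second list detects an inaccurate first list. -/
theorem listProb_detect_le (S : List (Cube n)) (hf : (ones f).Nonempty) {k : ℕ} (hk : 0 < k) :
    listProb (ones f) k (fun T => ¬ ((∀ i, |empirical S i - empirical T i| ≤ 1 / 20) →
      Accurate f (empirical S))) ≤ 2 * Real.exp (-(k / 400 : ℝ)) := by
  by_cases hS : Accurate f (empirical S)
  · refine le_trans (le_of_eq ?_) (by positivity : (0:ℝ) ≤ _)
    simp [hS, listProb, listExpect_zero]
  · simp only [Accurate, not_forall, not_le] at hS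
    obtain ⟨i, hi⟩ := hS
    -- One coordinate i on which S is off by more than 1/10 is enough: T passes the comparison at i
    -- only if it is off by more than 1/20 there. No union bound over coordinates is needed, so n
    -- does not enter.
    refine (listProb_mono fun T _ _ hT => ?_).trans (listProb_empirical_twentieth hf i hk)
    rw [Classical.not_imp] at hT
    have h1 := hT.1 i
    have h2 := abs_sub_le (empirical S i) (empirical T i) (freq (ones f) fun z => z i = true)
    linarith

theorem ensures_estimateBias_cons (hV : Unate f ∨ V Verdict.reject) {a : Cube n}
    (ha : a ∈ ones f) {δ : ℝ} {l : ℕ} (hk : 0 < biasSamples δ l) {ls : List ℕ}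
    {c : ℕ∞} {η : ℝ} (h : Ensures f hf (estimateBias a δ ls) c η V (Accurate f)) :
    Ensures f hf (estimateBias a δ (l :: ls)) (biasCost δ l + c)
      (2 * Real.exp (-(biasSamples δ l / 400 : ℝ)) + η) V (Accurate f) := by
  have hη := h.nonneg
  refine ((ensures_samples_zero (k := biasSamples δ l)).sure_bind
    (η := 2 * Real.exp (-(biasSamples δ l / 400 : ℝ)) + η) (by positivity) fun S hS =>
    (ensures_samples (listProb_detect_le S hf hk)).bind hη fun T hT =>
    (ensures_checkSamples hV ha (S := S ++ T) (by
      intro z hz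
      rcases List.mem_append.1 hz with hz | hz
      · exact hS.2 z hz
      · exact hT.1.2 z hz) (δ / (48 * (l : ℝ)))).sure_bind hη (c₂ := c) fun _ _ => ?_).mono_cost ?_
  · split_ifs with hc
    · exact ensures_ret hη (hT.2 hc)
    · exact h
  · rw [biasCost]
    push_cast
    rw [two_mul (biasSamples δ l : ℕ∞)]
    simp only [add_assoc]
    exact le_rfl

theorem ensures_estimateBias_append (hV : Unate f ∨ V Verdict.reject) {a : Cube n}
    (ha : a ∈ ones f) {δ : ℝ} {ls ls' : List ℕ} (hk : ∀ l ∈ ls, 0 < biasSamples δ l)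
    {c : ℕ∞} {η : ℝ} (h : Ensures f hf (estimateBias a δ ls') c η V (Accurate f)) :
    Ensures f hf (estimateBias a δ (ls ++ ls')) (((ls.map (biasCost δ)).sum : ℕ) + c)
      ((ls.map fun l => 2 * Real.exp (-(biasSamples δ l / 400 : ℝ))).sum + η) V
        (Accurate f) := by
  induction ls with
  | nil => simpa using h
  | cons l ls ih =>
      refine (ensures_estimateBias_cons hV ha (hk l (by simp))
        (ih fun l hl => hk l (by simp [hl]))).mono ?_ ?_ (fun _ => id) fun _ => id
      · simp [add_assoc]
      · simp [add_assoc]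

theorem ensures_estimateBias_sure (hV : Unate f ∨ V Verdict.reject) (hacc : V Verdict.accept)
    {a : Cube n} (ha : a ∈ ones f) (δ : ℝ) (ls : List ℕ) :
    Ensures f hf (estimateBias a δ ls) ⊤ 0 V fun _ => True := by
  induction ls with
  | nil => exact ensures_halt le_rfl hacc
  | cons l ls ih =>
      refine ((ensures_samples_zero (k := biasSamples δ l)).sure_bind le_rfl fun S hS =>
        (ensures_samples_zero (k := biasSamples δ l)).sure_bind le_rfl fun T hT =>
        (ensures_checkSamples hV ha (S := S ++ T) (by
          intro z hz
          rcases List.mem_append.1 hz with hz | hz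
          · exact hS.2 z hz
          · exact hT.2 z hz) (δ / (48 * (l : ℝ)))).sure_bind le_rfl (c₂ := ⊤) fun _ _ => ?_).mono_cost
            le_top
      split_ifs with hc
      · exact ensures_ret le_rfl trivial
      · exact ih

end RelUnate

namespace RelUnate

open Finset Algo
open scoped BigOperators

variable {n : ℕ} {f : Cube n → Bool} {hf : (ones f).Nonempty} {V : Verdict → Prop}

/-! ### IterativeBias: leaving the loop -/

theorem listProb_not_and_le {β : Type} {s : Finset β} (k : ℕ) (G H : List β → Prop) :
    listProb s k (fun S => ¬ (G S ∧ H S)) ≤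
      listProb s k (fun S => ¬ G S) + listProb s k (fun S => ¬ H S) := by
  unfold listProb
  rw [← listExpect_add]
  refine listExpect_mono fun S _ _ => ?_
  by_cases hG : G S <;> by_cases hH : H S <;> simp [hG, hH]

/-- The points of `f⁻¹(1)` at distance at most `4N` from `a`. -/
def nearOnes (f : Cube n → Bool) (a : Cube n) : Finset (Cube n) :=
  (ones f).filter fun z => hdist (toPStr a) (toPStr z) ≤ 4 * (ones f).card

theorem self_mem_nearOnes {a : Cube n} (ha : a ∈ ones f) : a ∈ nearOnes f a := by
  refine Finset.mem_filter.2 ⟨ha, ?_⟩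
  have : diffCoords (toPStr a) (toPStr a) = ∅ := by
    ext i; simp [mem_diffCoords_toPStr]
  simp [hdist, this]

/-- The variance of bit i is at most the probability that z_i ≠ a_i, and these probabilities sum to
the mean distance from a. -/
theorem sum_variance_nearOnes_le {a : Cube n} (ha : a ∈ ones f) :
    ∑ i, (freq (nearOnes f a) fun z => z i = true) *
      (1 - freq (nearOnes f a) fun z => z i = true) ≤ 4 * (ones f).card := by
  classical
  have hne : (nearOnes f a).Nonempty := ⟨a, self_mem_nearOnes ha⟩
  have h1 : ∀ i, (freq (nearOnes f a) fun z => z i = true) *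
      (1 - freq (nearOnes f a) fun z => z i = true) ≤ freq (nearOnes f a) fun z => a i ≠ z i := by
    intro i
    have h0 := freq_nonneg (nearOnes f a) fun z => z i = true
    have h2 := freq_le_one hne fun z => z i = true
    have h3 := freq_add_not hne fun z => z i = true
    cases hai : a i
    · have : (freq (nearOnes f a) fun z => false ≠ z i) =
          freq (nearOnes f a) fun z => z i = true := freq_congr fun z _ => by cases z i <;> simp
      rw [this]
      nlinarith
    · have : (freq (nearOnes f a) fun z => true ≠ z i) =
          freq (nearOnes f a) fun z => ¬ z i = true := freq_congr fun z _ => by cases z i <;> simp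
      rw [this]
      nlinarith
  refine (Finset.sum_le_sum fun i _ => h1 i).trans ?_
  simp only [freq]
  rw [← Finset.expect_sum_comm]
  refine (Finset.expect_le_expect fun z hz => ?_).trans_eq (Finset.expect_const hne _)
  have hz' := (Finset.mem_filter.1 hz).2
  have h2 : (Finset.univ.filter fun i => a i ≠ z i) = diffCoords (toPStr a) (toPStr z) := by
    ext i; simp [mem_diffCoords_toPStr]
  have h3 : (∑ i, if a i ≠ z i then (1 : ℝ) else 0) =
      ((Finset.univ.filter fun i => a i ≠ z i).card : ℝ) := by
    rw [Finset.card_filter]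
    push_cast
    exact Finset.sum_congr rfl fun _ _ => by congr
  refine le_trans (le_of_eq ?_) (h3.le.trans ?_)
  · exact Finset.sum_congr rfl fun _ _ => by congr
  · rw [h2]
    exact_mod_cast hz'

/-- Conditioned on all samples being near a, they are uniform on `nearOnes f a`. The union bound
then runs over variances with sum at most 4N, which gives 32 · 4N = 128N in place of a multiple of
n. -/
theorem listProb_nearOnes_le {a : Cube n} (ha : a ∈ ones f) {k : ℕ} (hk : 3200 ≤ k) :
    listProb (ones f) k (fun S => ¬ ((∀ z ∈ S, z ∈ nearOnes f a) → ∀ i, |empirical S i -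
      freq (nearOnes f a) fun z => z i = true| ≤ 1 / 40)) ≤
        128 * (ones f).card * Real.exp (-(k / 3200 : ℝ)) := by
  have hne : (nearOnes f a).Nonempty := ⟨a, self_mem_nearOnes ha⟩
  have h1 : listProb (ones f) k (fun S => ¬ ((∀ z ∈ S, z ∈ nearOnes f a) → ∀ i, |empirical S i -
      freq (nearOnes f a) fun z => z i = true| ≤ 1 / 40)) ≤
      listProb (ones f) k (fun S => (∀ z ∈ S, z ∈ nearOnes f a) ∧ ∃ i ∈ Finset.univ,
        1 / 40 < |empirical S i - freq (nearOnes f a) fun z => z i = true|) := by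
    refine listProb_mono fun S _ _ h => ?_
    rw [Classical.not_imp] at h
    refine ⟨h.1, ?_⟩
    obtain ⟨i, hi⟩ := not_forall.1 h.2
    exact ⟨i, Finset.mem_univ i, not_le.1 hi⟩
  refine h1.trans ((listProb_and_forall_mem_le (Finset.filter_subset _ _) k _).trans
    ((listProb_exists_le _ _ _).trans ?_))
  refine (Finset.sum_le_sum fun i _ => listProb_empirical_variance hne i hk).trans ?_
  rw [← Finset.sum_mul, ← Finset.mul_sum]
  have := sum_variance_nearOnes_le ha
  have h2 := mul_le_mul_of_nonneg_right this (Real.exp_pos (-(k / 3200 : ℝ))).le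
  linarith

theorem le_biasSamples (δ : ℝ) {l : ℕ} (hl : 1 ≤ l) : 3200 ≤ biasSamples δ l := by
  unfold biasSamples; omega

/-- Except for the stated error the computation does not go beyond this round: CheckSamples rejects,
or all samples are near a, both lists estimate the same frequencies up to 1/40, and the comparison
succeeds. -/
theorem ensures_estimateBias_stop (hV : Unate f ∨ V Verdict.reject) {a : Cube n}
    (ha : a ∈ ones f) {δ : ℝ} (hδ : 0 < δ) {l : ℕ} (hl : 1 ≤ l) (ls : List ℕ) :
    Ensures f hf (estimateBias a δ (l :: ls)) (biasCost δ l)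
      (2 * Real.exp (-(biasSamples δ l / 400 : ℝ)) + δ / 48 +
        256 * (ones f).card * Real.exp (-(biasSamples δ l / 3200 : ℝ))) V (Accurate f) := by
  have hk := le_biasSamples δ hl
  have hk0 : 0 < biasSamples δ l := by omega
  set E := 128 * (ones f).card * Real.exp (-(biasSamples δ l / 3200 : ℝ)) with hE
  have hE0 : 0 ≤ E := by positivity
  have hl' : (1 : ℝ) ≤ l := by exact_mod_cast hl
  have hδ' : 0 < δ / (48 * (l : ℝ)) := by positivity
  have hδ'' : δ / (48 * (l : ℝ)) ≤ δ / 48 := by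
    apply div_le_div_of_nonneg_left hδ.le (by norm_num); linarith
  have hnear := listProb_nearOnes_le ha hk
  refine ((ensures_samples hnear).bind
    (η₂ := (2 * Real.exp (-(biasSamples δ l / 400 : ℝ)) + E) + δ / 48) (by positivity) fun S hS =>
    (ensures_samples ((listProb_not_and_le _ _ _).trans
      (add_le_add (listProb_detect_le S hf hk0) hnear))).bind (by positivity) fun T hT =>
    ((ensures_checkSamples_near hV ha (S := S ++ T) (by
      intro z hz
      rcases List.mem_append.1 hz with hz | hz
      · exact hS.1.2 z hz
      · exact hT.1.2 z hz) hδ').bind le_rfl (c₂ := 0) (η₂ := 0) fun _ hfar => ?_).mono_prob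
        ((add_zero _).le.trans hδ'')).mono
        ?_ ?_ (fun _ => id) fun _ => id
  · have hS' := hS.2 fun z hz => Finset.mem_filter.2 ⟨hS.1.2 z hz, hfar z (by simp [hz])⟩
    have hT' := hT.2.2 fun z hz => Finset.mem_filter.2 ⟨hT.1.2 z hz, hfar z (by simp [hz])⟩
    have hc : ∀ i, |empirical S i - empirical T i| ≤ 1 / 20 := by
      intro i
      have h1 := hS' i
      have h2 := hT' i
      rw [abs_le] at h1 h2 ⊢
      constructor <;> linarith
    rw [if_pos hc]
    exact ensures_ret le_rfl (hT.2.1 hc)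
  · rw [biasCost]
    push_cast
    rw [two_mul (biasSamples δ l : ℕ∞)]
    simp only [add_assoc, add_zero]
    exact le_rfl
  · rw [hE]; linarith

/-- A plain union bound over the n coordinates, affordable because it is applied with l of order log
n. It is used for soundness, where accepting at the end of the loop must be unlikely; no cost is
claimed. -/
theorem ensures_estimateBias_last (hV : Unate f ∨ V Verdict.reject) {a : Cube n}
    (ha : a ∈ ones f) {δ : ℝ} {l : ℕ} (hl : 1 ≤ l) (ls : List ℕ) :
    Ensures f hf (estimateBias a δ (l :: ls)) ⊤
      (4 * n * Real.exp (-(biasSamples δ l / 1600 : ℝ))) V (Accurate f) := by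
  have hk := le_biasSamples δ hl
  have hk0 : 0 < biasSamples δ l := by omega
  set E := 2 * n * Real.exp (-(biasSamples δ l / 1600 : ℝ)) with hE
  have hE0 : 0 ≤ E := by positivity
  have hdev : listProb (ones f) (biasSamples δ l) (fun S => ¬ ∀ i, |empirical S i -
      freq (ones f) fun z => z i = true| ≤ 1 / 40) ≤ E := by
    refine (listProb_mono (H := fun S => ∃ i ∈ Finset.univ, 1 / 40 < |empirical S i -
      freq (ones f) fun z => z i = true|) fun S _ _ h => ?_).trans ((listProb_exists_le _ _ _).trans
        ((Finset.sum_le_sum fun i _ => listProb_empirical_fortieth hf i hk0).trans_eq ?_))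
    · obtain ⟨i, hi⟩ := not_forall.1 h
      exact ⟨i, Finset.mem_univ i, not_le.1 hi⟩
    · rw [Finset.sum_const, Finset.card_univ, Fintype.card_fin, nsmul_eq_mul, hE]; ring
  refine ((ensures_samples hdev).bind (η₂ := E) hE0 fun S hS =>
    ((ensures_samples hdev).bind le_rfl fun T hT =>
    (ensures_checkSamples hV ha (S := S ++ T) (by
      intro z hz
      rcases List.mem_append.1 hz with hz | hz
      · exact hS.1.2 z hz
      · exact hT.1.2 z hz) _).sure_bind le_rfl (c₂ := ⊤) fun _ _ => ?_).mono_prob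
        (add_zero E).le).mono le_top ?_ (fun _ => id) fun _ => id
  · have hc : ∀ i, |empirical S i - empirical T i| ≤ 1 / 20 := by
      intro i
      have h1 := hS.2 i
      have h2 := hT.2 i
      rw [abs_le] at h1 h2 ⊢
      constructor <;> linarith
    rw [if_pos hc]
    exact ensures_ret le_rfl fun i => (hS.2 i).trans (by norm_num)
  · rw [hE]; linarith

theorem two_pow_neg_ceilLog_le {δ : ℝ} (hδ : 0 < δ) : (2 ^ ceilLog (1 / δ) : ℝ)⁻¹ ≤ δ := by
  have := half_pow_ceilLog hδ
  rwa [one_div, inv_pow] at this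

theorem exp_neg_nat_le (m : ℕ) : Real.exp (-(m : ℝ)) ≤ ((2 : ℝ) ^ m)⁻¹ := by
  rw [Real.exp_neg]
  refine inv_anti₀ (by positivity) ?_
  have : Real.exp m = Real.exp 1 ^ m := by rw [← Real.exp_nat_mul, mul_one]
  rw [this]
  exact pow_le_pow_left₀ (by norm_num) (by linarith [Real.add_one_le_exp (1 : ℝ)]) m

theorem exp_neg_biasSamples_le {δ : ℝ} (hδ : 0 < δ) (l : ℕ) :
    2 * Real.exp (-(biasSamples δ l / 400 : ℝ)) ≤ δ * (2 * (2 ^ (20 * l) : ℝ)⁻¹) := by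
  have h : -(biasSamples δ l / 400 : ℝ) ≤ -((20 * l + ceilLog (1 / δ) : ℕ) : ℝ) := by
    rw [biasSamples]; push_cast
    have : (0 : ℝ) ≤ ceilLog (1 / δ) := Nat.cast_nonneg _
    linarith
  have h1 := (Real.exp_le_exp.2 h).trans (exp_neg_nat_le _)
  rw [pow_add, mul_inv] at h1
  have h2 := two_pow_neg_ceilLog_le hδ
  have h3 : (2 ^ (20 * l) : ℝ)⁻¹ * (2 ^ ceilLog (1 / δ) : ℝ)⁻¹ ≤ (2 ^ (20 * l) : ℝ)⁻¹ * δ :=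
    mul_le_mul_of_nonneg_left h2 (by positivity)
  linarith

theorem sum_detect_le {δ : ℝ} (hδ : 0 < δ) (m : ℕ) :
    (((List.range m).map fun j => 2 ^ j).map fun l =>
      2 * Real.exp (-(biasSamples δ l / 400 : ℝ))).sum ≤ δ / 32 * (1 - (1 / 2) ^ m) := by
  induction m with
  | zero => simp
  | succ m ih =>
      rw [List.range_succ, List.map_append, List.map_append, List.sum_append]
      simp only [List.map_cons, List.map_nil, List.sum_cons, List.sum_nil, add_zero]
      refine (add_le_add ih (exp_neg_biasSamples_le hδ (2 ^ m))).trans ?_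
      -- The doubly exponential decay is compared with a geometric series: 20 · 2^m ≥ m + 7.
      have h1 : (2 ^ (20 * 2 ^ m) : ℝ)⁻¹ ≤ (2 ^ (m + 7) : ℝ)⁻¹ := by
        refine inv_anti₀ (by positivity) (pow_le_pow_right₀ (by norm_num) ?_)
        have : m < 2 ^ m := Nat.lt_two_pow_self
        omega
      have h2 : (2 ^ (m + 7) : ℝ)⁻¹ = (1 / 2) ^ m / 128 := by
        rw [pow_add, mul_inv, one_div, inv_pow]; norm_num; ring
      rw [h2] at h1
      have h3 := mul_le_mul_of_nonneg_left h1 hδ.le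
      rw [pow_succ]
      nlinarith

theorem biasCost_mono {δ : ℝ} (hδ : 0 < δ) {l l' : ℕ} (hl : 1 ≤ l) (h : l ≤ l') :
    biasCost δ l ≤ biasCost δ l' := by
  have h1 : (1 : ℝ) ≤ l := by exact_mod_cast hl
  have h2 : (l : ℝ) ≤ l' := by exact_mod_cast h
  have h3 : biasSamples δ l ≤ biasSamples δ l' := by unfold biasSamples; omega
  have h4 : ceilLog (1 / (δ / (48 * (l : ℝ)))) ≤ ceilLog (1 / (δ / (48 * (l' : ℝ)))) := by
    refine Nat.ceil_le_ceil ?_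
    refine Real.logb_le_logb_of_le (by norm_num) (by positivity) ?_
    rw [one_div_div, one_div_div]
    gcongr
  unfold biasCost
  omega

/-- Half the exponent suffices to beat N: 2^l ≥ 64N makes 2^(-2l) at most (64N)⁻², and the λ part of
the sample size provides δ. -/
theorem stop_error_le {δ : ℝ} (hδ : 0 < δ) {N l : ℕ} (hN : 1 ≤ N) (hl : 64 * N ≤ 2 ^ l) :
    256 * (N : ℝ) * Real.exp (-(biasSamples δ l / 3200 : ℝ)) ≤ δ / 16 := by
  have hN' : (1 : ℝ) ≤ N := by exact_mod_cast hN
  have hlN : 64 * (N : ℝ) ≤ 2 ^ l := by exact_mod_cast hl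
  have e5 : Real.exp (-(biasSamples δ l / 3200 : ℝ)) ≤
      (2 ^ l : ℝ)⁻¹ ^ 2 * (2 ^ ceilLog (1 / δ) : ℝ)⁻¹ := by
    have h : -(biasSamples δ l / 3200 : ℝ) ≤ -((l * 2 + ceilLog (1 / δ) : ℕ) : ℝ) := by
      rw [biasSamples]; push_cast
      have h1 : (0 : ℝ) ≤ ceilLog (1 / δ) := Nat.cast_nonneg _
      have h2 : (0 : ℝ) ≤ l := Nat.cast_nonneg _
      linarith
    refine ((Real.exp_le_exp.2 h).trans (exp_neg_nat_le _)).trans_eq ?_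
    rw [pow_add, pow_mul, mul_inv, inv_pow]
  have e6 := two_pow_neg_ceilLog_le hδ
  have e7 : (2 ^ l : ℝ)⁻¹ ≤ (64 * (N : ℝ))⁻¹ := inv_anti₀ (by positivity) hlN
  have e8 : Real.exp (-(biasSamples δ l / 3200 : ℝ)) ≤ (64 * (N : ℝ))⁻¹ ^ 2 * δ :=
    e5.trans (mul_le_mul (pow_le_pow_left₀ (by positivity) e7 2) e6 (by positivity)
      (by positivity))
  calc _ ≤ 256 * (N : ℝ) * ((64 * (N : ℝ))⁻¹ ^ 2 * δ) :=
        mul_le_mul_of_nonneg_left e8 (by positivity)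
    _ = δ / 16 / N := by field_simp; ring
    _ ≤ _ := div_le_self (by positivity) hN'

/-- The number of rounds of the loop that have to be considered. -/
noncomputable def loopRounds (f : Cube n → Bool) : ℕ := Nat.clog 2 (Nat.clog 2 (ones f).card + 6)

theorem sum_biasCost_le {δ : ℝ} (hδ : 0 < δ) {m J : ℕ} (hm : m ≤ J) :
    (((List.range m).map fun j => 2 ^ j).map (biasCost δ)).sum ≤ m * biasCost δ (2 ^ J) := by
  refine (List.sum_le_card_nsmul _ (biasCost δ (2 ^ J)) ?_).trans (by simp)
  intro c hc
  simp only [List.map_map, List.mem_map, List.mem_range, Function.comp] at hc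
  obtain ⟨j, hj, rfl⟩ := hc
  exact biasCost_mono hδ Nat.one_le_two_pow (Nat.pow_le_pow_right (by norm_num) (by omega))

/-- With J = `loopRounds f` one has 2^(2^J) ≥ 64N, so the loop very likely stops by the value 2^J,
unless the list of values ends earlier. In either case at most J + 1 rounds are run, each no dearer
than the one for 2^J. -/
theorem ensures_estimateBias_cost {a : Cube n} (ha : a ∈ ones f) {δ : ℝ} (hδ : 0 < δ) :
    Ensures f hf (estimateBias a δ (biasRounds n))
      (((loopRounds f + 1) * biasCost δ (2 ^ loopRounds f) : ℕ)) (δ / 4) (fun _ => True)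
      (Accurate f) := by
  obtain ⟨J, hJ⟩ : ∃ J, J = loopRounds f := ⟨_, rfl⟩
  obtain ⟨L, hL1, hrounds⟩ : ∃ L, 1 ≤ L ∧
      biasRounds n = ((List.range (Nat.clog 2 L)).map fun j => 2 ^ j) ++ [L] :=
    ⟨max 1 ⌈10 * Real.logb 2 (n : ℝ)⌉₊, le_max_left _ _, rfl⟩
  rw [← hJ]
  have hpos : ∀ m, ∀ l ∈ (List.range m).map fun j => 2 ^ j, 0 < biasSamples δ l := by
    intro m l hl
    obtain ⟨j, _, rfl⟩ := List.mem_map.1 hl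
    have := le_biasSamples δ (Nat.one_le_two_pow (n := j))
    omega
  have hbias : ∀ m, (((List.range m).map fun j => 2 ^ j).map fun l =>
      2 * Real.exp (-(biasSamples δ l / 400 : ℝ))).sum ≤ δ / 32 := fun m =>
    (sum_detect_le hδ m).trans (by
      have : (0 : ℝ) ≤ (1 / 2) ^ m := by positivity
      nlinarith)
  have hone : ∀ l, 1 ≤ l → 2 * Real.exp (-(biasSamples δ l / 400 : ℝ)) ≤ δ / 32 := by
    intro l hl
    refine (exp_neg_biasSamples_le hδ l).trans ?_
    have : (2 ^ (20 * l) : ℝ)⁻¹ ≤ (2 ^ 6 : ℝ)⁻¹ :=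
      inv_anti₀ (by positivity) (pow_le_pow_right₀ (by norm_num) (by omega))
    have := mul_le_mul_of_nonneg_left this hδ.le
    norm_num at this
    linarith
  rw [hrounds]
  rcases Nat.lt_or_ge J (Nat.clog 2 L) with hlt | hge
  · obtain ⟨rest, hrest⟩ : ∃ rest, ((List.range (Nat.clog 2 L)).map fun j => 2 ^ j) ++ [L] =
        ((List.range J).map fun j => 2 ^ j) ++ (2 ^ J :: rest) := by
      obtain ⟨d, hd⟩ := Nat.exists_eq_add_of_lt hlt
      refine ⟨((List.range d).map fun j => 2 ^ (J + 1 + j)) ++ [L], ?_⟩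
      rw [show Nat.clog 2 L = (J + 1) + d by omega, List.range_add, List.range_succ]
      simp [Function.comp_def]
    rw [hrest]
    refine (ensures_estimateBias_append (Or.inr trivial) ha (hpos J)
      (ensures_estimateBias_stop (hf := hf) (Or.inr trivial) ha hδ Nat.one_le_two_pow rest)).mono
        ?_ ?_ (fun _ => id) fun _ => id
    · have := Nat.add_le_add_right (sum_biasCost_le hδ (le_refl J)) (biasCost δ (2 ^ J))
      rw [add_mul, one_mul]
      exact_mod_cast this
    · have h1 := hbias J
      have h2 := hone (2 ^ J) Nat.one_le_two_pow
      have h3 : 256 * ((ones f).card : ℝ) * Real.exp (-(biasSamples δ (2 ^ J) / 3200 : ℝ)) ≤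
          δ / 16 := by
        refine stop_error_le hδ hf.card_pos ?_
        have e1 : (ones f).card ≤ 2 ^ Nat.clog 2 (ones f).card :=
          Nat.le_pow_clog (by norm_num) _
        have e2 : Nat.clog 2 (ones f).card + 6 ≤ 2 ^ J := by
          rw [hJ]; exact Nat.le_pow_clog (by norm_num) _
        have e3 : 2 ^ (Nat.clog 2 (ones f).card + 6) ≤ 2 ^ (2 ^ J) :=
          Nat.pow_le_pow_right (by norm_num) e2
        rw [pow_add] at e3
        refine le_trans ?_ e3
        rw [mul_comm]
        exact Nat.mul_le_mul_right _ e1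
      linarith
  · have hL0 : 0 < biasSamples δ L := by
      have := le_biasSamples δ hL1
      omega
    -- If the list ends first, the algorithm accepts for free; in the cost analysis every verdict is
    -- allowed.
    have h0 : Ensures f hf (estimateBias a δ []) 0 0 (fun _ => True) (Accurate f) :=
      ensures_halt le_rfl trivial
    refine (ensures_estimateBias_append (Or.inr trivial) ha (hpos _)
      (ensures_estimateBias_cons (hf := hf) (Or.inr trivial) ha
        hL0 h0)).mono
        ?_ ?_ (fun _ => id) fun _ => id
    · have h1 := sum_biasCost_le hδ hge
      have h2 : biasCost δ L ≤ biasCost δ (2 ^ J) := by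
        refine biasCost_mono hδ hL1 ?_
        exact (Nat.le_pow_clog (by norm_num) L).trans (Nat.pow_le_pow_right (by norm_num) hge)
      have h3 : Nat.clog 2 L * biasCost δ (2 ^ J) ≤ J * biasCost δ (2 ^ J) :=
        Nat.mul_le_mul_right _ hge
      rw [add_zero, add_mul, one_mul]
      exact_mod_cast Nat.add_le_add (h1.trans h3) h2
    · have h1 := hbias (Nat.clog 2 L)
      have h2 := hone L hL1
      linarith

theorem ensures_estimateBias_accurate (hV : Unate f ∨ V Verdict.reject) {a : Cube n}
    (ha : a ∈ ones f) {δ : ℝ} (hδ : 0 < δ) (hδ1 : δ < 1) :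
    Ensures f hf (estimateBias a δ (biasRounds n)) ⊤ (1 / 10) V (Accurate f) := by
  set L := max 1 ⌈10 * Real.logb 2 (n : ℝ)⌉₊ with hL
  have hrounds : biasRounds n = ((List.range (Nat.clog 2 L)).map fun j => 2 ^ j) ++ [L] := rfl
  have hL1 : 1 ≤ L := le_max_left _ _
  rw [hrounds]
  refine (ensures_estimateBias_append hV ha ?_
    (ensures_estimateBias_last (hf := hf) hV ha hL1 [])).mono le_top ?_ (fun _ => id) fun _ => id
  · intro l hl
    obtain ⟨j, _, rfl⟩ := List.mem_map.1 hl
    have := le_biasSamples δ (Nat.one_le_two_pow (n := j))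
    omega
  · have h1 : δ / 32 * (1 - (1 / 2) ^ Nat.clog 2 L) ≤ 1 / 32 := by
      have : (0 : ℝ) ≤ (1 / 2) ^ Nat.clog 2 L := by positivity
      nlinarith
    have h2 := (sum_detect_le hδ (Nat.clog 2 L)).trans h1
    have hn : (n : ℝ) ≤ 2 ^ L := by
      rcases Nat.eq_zero_or_pos n with rfl | hn
      · simp
      · have hn' : (1 : ℝ) ≤ n := by exact_mod_cast hn
        have e1 : 10 * Real.logb 2 (n : ℝ) ≤ L :=
          (Nat.le_ceil _).trans (by exact_mod_cast le_max_right _ _)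
        have e2 : 0 ≤ Real.logb 2 (n : ℝ) := Real.logb_nonneg (by norm_num) hn'
        have e3 : Real.logb 2 (n : ℝ) ≤ L := by linarith
        rwa [Real.logb_le_iff_le_rpow (by norm_num) (by positivity), Real.rpow_natCast] at e3
    have h3 : Real.exp (-(biasSamples δ L / 1600 : ℝ)) ≤ (2 ^ L : ℝ)⁻¹ * (1 / 64) := by
      -- The exponent is 5L + (5/2)λ, and L, λ ≥ 1. The part L cancels n ≤ 2^L, the part 6 leaves
      -- the factor 1/64.
      have h : -(biasSamples δ L / 1600 : ℝ) ≤ -((L + 6 : ℕ) : ℝ) := by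
        have e1 : (1 : ℝ) ≤ ceilLog (1 / δ) := by exact_mod_cast ceilLog_pos hδ hδ1
        have e2 : (1 : ℝ) ≤ L := by exact_mod_cast hL1
        rw [biasSamples]; push_cast
        linarith
      refine ((Real.exp_le_exp.2 h).trans (exp_neg_nat_le _)).trans_eq ?_
      rw [pow_add, mul_inv]; norm_num
    have h4 : 4 * n * Real.exp (-(biasSamples δ L / 1600 : ℝ)) ≤ 1 / 16 := by
      calc _ ≤ 4 * (2 : ℝ) ^ L * ((2 ^ L : ℝ)⁻¹ * (1 / 64)) := by gcongr
        _ = 1 / 16 := by field_simp; norm_num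
    linarith

end RelUnate

namespace RelUnate

open Finset Algo
open scoped BigOperators

variable {n : ℕ} {f : Cube n → Bool} {hf : (ones f).Nonempty} {V : Verdict → Prop}

/-! ### IterativeBias: the test on unfixed coordinates -/

theorem sum_freq_flip_le (hf : (ones f).Nonempty) (s : Finset (Fin n)) :
    ∑ i ∈ s, freq (ones f) (fun z => f (flipAt z i) = true) ≤ Real.logb 2 (ones f).card := by
  classical
  have hN : (0 : ℝ) < (ones f).card := by exact_mod_cast hf.card_pos
  have h := edge_isoperimetric s (ones f)
  simp only [freq_eq_div]
  rw [← Finset.sum_div, div_le_iff₀ hN, mul_comm (Real.logb _ _)]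
  refine le_trans (le_of_eq ?_) h
  refine Finset.sum_congr rfl fun i _ => ?_
  congr 2
  ext z
  simp [mem_ones]

theorem freq_outer_ge (i : Fin n) (b : Bool) :
    (freq (ones f) fun z => z i = b) - freq (ones f) (fun z => f (flipAt z i) = true) ≤
      freq (ones f) fun z => z i = b ∧ f (flipAt z i) = false := by
  have h4 := freq_and_add (s := ones f) (fun z => z i = b) fun z => f (flipAt z i) = true
  simp only [Bool.not_eq_true] at h4
  have h5 : (freq (ones f) fun z => z i = b ∧ f (flipAt z i) = true) ≤
      freq (ones f) (fun z => f (flipAt z i) = true) := freq_mono fun z _ h => h.2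
  linarith

/-- One trial of the test on a pair of samples in direction `i`. -/
def pairTest (i : Fin n) : Algo n Unit := do
  let x ← sample
  let y ← sample
  let u ← ask (flipAt x i)
  let v ← ask (flipAt y i)
  if x i ≠ y i ∧ u = false ∧ v = false then halt Verdict.reject else ret ()

theorem ensures_pairTest (hV : Unate f ∨ V Verdict.reject) (i : Fin n) :
    Ensures f hf (pairTest i) 4 0 V fun _ => True := by
  have h : Ensures f hf (pairTest i) (0 + 1 + 1 + 1 + 1) 0 V fun _ => True := by
    refine ensures_sample_bind fun x hx => ensures_sample_bind fun y hy =>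
      ensures_ask_bind (ensures_ask_bind ?_)
    split_ifs with h
    · refine ensures_halt le_rfl (hV.resolve_left ?_)
      exact not_unate_of_edges (mem_ones.1 hx) (mem_ones.1 hy) h.1 h.2.1 h.2.2
    · exact ensures_ret le_rfl trivial
  exact h.mono_cost (by norm_num)

theorem surv_pairTest_le (i : Fin n) : surv f hf (pairTest i) ≤
    1 - (freq (ones f) fun z => z i = false ∧ f (flipAt z i) = false) *
      freq (ones f) fun z => z i = true ∧ f (flipAt z i) = false := by
  classical
  rw [pairTest, surv_sample_bind]
  have h : ∀ x ∈ ones f, (surv f hf do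
      let y ← sample
      let u ← ask (flipAt x i)
      let v ← ask (flipAt y i)
      if x i ≠ y i ∧ u = false ∧ v = false then halt Verdict.reject else ret () : ℝ) ≤
      1 - (if x i = false ∧ f (flipAt x i) = false then 1 else 0) *
        freq (ones f) fun z => z i = true ∧ f (flipAt z i) = false := by
    intro x _
    rw [surv_sample_bind]
    have h2 : ∀ y ∈ ones f, (surv f hf do
        let u ← ask (flipAt x i)
        let v ← ask (flipAt y i)
        if x i ≠ y i ∧ u = false ∧ v = false then halt Verdict.reject else ret () : ℝ) ≤
        1 - (if x i = false ∧ f (flipAt x i) = false then 1 else 0) *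
          (if y i = true ∧ f (flipAt y i) = false then 1 else 0) := by
      intro y _
      rw [surv_ask_bind, surv_ask_bind]
      cases x i <;> cases y i <;> cases f (flipAt x i) <;> cases f (flipAt y i) <;> simp
    refine (Finset.expect_le_expect h2).trans_eq ?_
    rw [Finset.expect_sub_distrib, Finset.expect_const hf, ← Finset.mul_expect, freq]
    congr 2
    exact Finset.expect_congr rfl fun _ _ => by congr
  refine (Finset.expect_le_expect h).trans_eq ?_
  rw [Finset.expect_sub_distrib, Finset.expect_const hf, ← Finset.expect_mul]
  congr 2
  exact Finset.expect_congr rfl fun _ _ => by congr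

/-- Let g_i be the frequency of points whose i-neighbour is in f⁻¹(1). By reliability both
orientations have boundary frequency at least 15/100 - g_i, while isoperimetry bounds the average of
g_i by 1/40. The rejection probability is at least 0.0225 - 0.3/40 = 0.015. -/
theorem surv_withRandom_pairTest_le {d : PStr n} (hd : Reliable f d)
    (hm : 40 * Real.logb 2 (ones f).card < (unfixedCoords d).card) :
    surv f hf (withRandom (unfixedCoords d) pairTest) ≤ 1 - 15 / 1000 := by
  set U := unfixedCoords d with hU
  have hN : (1 : ℝ) ≤ (ones f).card := by exact_mod_cast hf.card_pos
  have hlog : 0 ≤ Real.logb 2 ((ones f).card : ℝ) := Real.logb_nonneg (by norm_num) hN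
  have hm0 : (0 : ℝ) < U.card := by linarith
  have hne : U.Nonempty := Finset.card_pos.1 (by exact_mod_cast hm0)
  rw [surv_withRandom hne]
  have h : ∀ i ∈ U, surv f hf (pairTest i) ≤
      (1 - 225 / 10000) + 3 / 10 * freq (ones f) (fun z => f (flipAt z i) = true) := by
    intro i hi
    refine (surv_pairTest_le i).trans ?_
    have hi' : d i = none := by simpa [hU, unfixedCoords] using hi
    have h1 := freq_outer_ge (f := f) i false
    have h2 := freq_outer_ge (f := f) i true
    have h3 := (hd i false).2 hi'
    have h4 := (hd i true).2 hi'
    have h5 := freq_nonneg (ones f) fun z => z i = false ∧ f (flipAt z i) = false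
    have h6 := freq_nonneg (ones f) fun z => z i = true ∧ f (flipAt z i) = false
    set g := freq (ones f) (fun z => f (flipAt z i) = true)
    set α := freq (ones f) fun z => z i = false ∧ f (flipAt z i) = false
    set β := freq (ones f) fun z => z i = true ∧ f (flipAt z i) = false
    -- For g ≥ 15/100 the linear lower bound 0.0225 - 0.3 g is negative, so nothing has to be shown
    -- about the product.
    rcases le_total g (15 / 100) with hg | hg
    · have : (15 / 100 - g) * (15 / 100 - g) ≤ α * β :=
        mul_le_mul (by linarith) (by linarith) (by linarith) h5
      nlinarith [sq_nonneg g]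
    · have := mul_nonneg h5 h6
      linarith
  refine (Finset.expect_le_expect h).trans ?_
  rw [Finset.expect_add_distrib, Finset.expect_const hne, ← Finset.mul_expect,
    Finset.expect_eq_sum_div_card]
  have h7 : (∑ i ∈ U, freq (ones f) (fun z => f (flipAt z i) = true)) / U.card ≤ 1 / 40 := by
    rw [div_le_iff₀ hm0]
    linarith [sum_freq_flip_le hf U]
  linarith

theorem pow_le_of_exp {δ ρ : ℝ} (hδ : 0 < δ) {m c : ℕ} (hρ : 0 ≤ ρ)
    (hc : c + 1 ≤ m) (h : ρ ≤ 1 / 2) (hlam : 1 ≤ ceilLog (1 / δ)) :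
    ρ ^ (m * ceilLog (1 / δ)) ≤ δ / 2 ^ c := by
  have h1 : ρ ^ (m * ceilLog (1 / δ)) ≤ (1 / 2 : ℝ) ^ (c + ceilLog (1 / δ)) := by
    refine (pow_le_pow_left₀ hρ h _).trans
      (pow_le_pow_of_le_one (by norm_num) (by norm_num) ?_)
    calc c + ceilLog (1 / δ) ≤ c * ceilLog (1 / δ) + ceilLog (1 / δ) := by
          gcongr; exact Nat.le_mul_of_pos_right c hlam
      _ = (c + 1) * ceilLog (1 / δ) := by ring
      _ ≤ _ := Nat.mul_le_mul_right _ hc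
  refine h1.trans ?_
  rw [pow_add, mul_comm, div_eq_mul_inv δ]
  have := half_pow_ceilLog hδ
  have e : (1 / 2 : ℝ) ^ c = (2 ^ c : ℝ)⁻¹ := by rw [one_div, inv_pow]
  rw [e]
  exact mul_le_mul_of_nonneg_right this (by positivity)

theorem iterativeBias_eq (a : Cube n) (δ : ℝ) : iterativeBias a δ =
    estimateBias a δ (biasRounds n) >>= fun p =>
      repeatN (4000 * ceilLog (1 / δ)) (withRandom (unfixedCoords (biasVector p)) pairTest) >>=
        fun _ => ret (biasVector p) := rfl

theorem ensures_pairTests (hV : Unate f ∨ V Verdict.reject) (d : PStr n) (k : ℕ) :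
    Ensures f hf (repeatN k (withRandom (unfixedCoords d) pairTest)) ((k * 4 : ℕ) : ℕ∞) 0 V
      fun _ => True := by
  refine (ensures_repeatN k (ensures_withRandom le_rfl (fun i _ => ensures_pairTest hV i)
    fun _ => trivial)).mono_cost (by norm_cast)

theorem ensures_iterativeBias_sure (hV : Unate f ∨ V Verdict.reject) (hacc : V Verdict.accept)
    {a : Cube n} (ha : a ∈ ones f) (δ : ℝ) :
    Ensures f hf (iterativeBias a δ) ⊤ 0 V fun _ => True := by
  rw [iterativeBias_eq]
  exact ((ensures_estimateBias_sure hV hacc ha δ _).sure_bind le_rfl fun p _ =>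
    (ensures_pairTests hV (biasVector p) _).sure_bind (c₂ := 0) le_rfl
      fun _ _ => ensures_ret le_rfl trivial).mono_cost le_top

theorem ensures_iterativeBias_reliable (hV : Unate f ∨ V Verdict.reject)
    {a : Cube n} (ha : a ∈ ones f) {δ : ℝ} (hδ : 0 < δ) (hδ1 : δ < 1) :
    Ensures f hf (iterativeBias a δ) ⊤ (1 / 10) V (Reliable f) := by
  rw [iterativeBias_eq]
  refine ((ensures_estimateBias_accurate hV ha hδ hδ1).bind le_rfl fun p hp =>
    (ensures_pairTests hV (biasVector p) _).sure_bind (c₂ := 0) le_rfl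
      fun _ _ => ensures_ret le_rfl (hp.reliable hf)).mono le_top (add_zero _).le
        (fun _ => id) fun _ => id

theorem ensures_iterativeBias_cost {a : Cube n} (ha : a ∈ ones f) {δ : ℝ} (hδ : 0 < δ)
    (hδ1 : δ < 1) :
    Ensures f hf (iterativeBias a δ)
      (((loopRounds f + 1) * biasCost δ (2 ^ loopRounds f) + 16000 * ceilLog (1 / δ) : ℕ))
      (δ / 4 + δ / 16) (fun _ => True) fun d => Reliable f d ∧
        ((unfixedCoords d).card : ℝ) ≤ 40 * Real.logb 2 (ones f).card := by
  rw [iterativeBias_eq]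
  refine ((ensures_estimateBias_cost ha hδ).bind (η₂ := δ / 16) (by positivity)
    (c₂ := ((4000 * ceilLog (1 / δ) * 4 : ℕ) : ℕ∞) + 0) fun p hp => ?_).mono_cost ?_
  · have hrel := hp.reliable hf
    have hsure := ensures_pairTests (V := fun _ => True) (hf := hf) (f := f) (Or.inr trivial)
      (biasVector p) (4000 * ceilLog (1 / δ))
    by_cases hm : ((unfixedCoords (biasVector p)).card : ℝ) ≤ 40 * Real.logb 2 (ones f).card
    · exact hsure.sure_bind (by positivity) fun _ _ => ensures_ret (by positivity) ⟨hrel, hm⟩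
    · have hs := surv_repeatN_le (4000 * ceilLog (1 / δ))
        (surv_withRandom_pairTest_le (hf := hf) hrel (not_le.1 hm))
      have hρ : (1 - 15 / 1000 : ℝ) ^ (4000 * ceilLog (1 / δ)) ≤ δ / 16 := by
        -- Grouping the 4000λ trials into 40λ blocks of 100 makes each block survive with
        -- probability at most 1/2.
        have h1 : ((1 - 15 / 1000 : ℝ) ^ 100) ≤ 1 / 2 := by norm_num
        have h2 := pow_le_of_exp (c := 4) (m := 40) hδ (by norm_num) (by norm_num) h1
          (ceilLog_pos hδ hδ1)
        rw [← pow_mul] at h2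
        rw [show 4000 * ceilLog (1 / δ) = 100 * (40 * ceilLog (1 / δ)) by ring]
        exact h2.trans (by norm_num)
      exact ((hsure.of_surv (Q := fun _ => False) (hs.trans hρ)).bind (η₂ := 0) (c₂ := 0) le_rfl
        fun _ h => h.elim).mono_prob (add_zero _).le
  · rw [add_zero]
    norm_cast
    apply le_of_eq
    ring

/-! ### Binary search -/

theorem flipList_nil (u : Cube n) : flipList u [] = u := by
  funext i; simp [flipList]

theorem flipList_singleton (u : Cube n) (i : Fin n) : flipList u [i] = flipAt u i := by
  funext j
  by_cases h : j = i
  · subst h; simp [flipList]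
  · simp [flipList, h, flipAt_of_ne]

theorem flipList_append (u : Cube n) {D D' : List (Fin n)} (h : D.Disjoint D') :
    flipList (flipList u D) D' = flipList u (D ++ D') := by
  funext j
  by_cases h1 : j ∈ D
  · have h2 : j ∉ D' := fun h2 => h h1 h2
    simp [flipList, h1, h2]
  · simp [flipList, h1]

/-- The invariant is f = 1 at the near end and f = 0 at the far end. It excludes an empty list, and
a single coordinate is an edge across which f drops. -/
theorem ensures_binarySearch (u : Cube n) (D : List (Fin n)) (hu : f u = true)
    (hD : f (flipList u D) = false) (hnd : D.Nodup) :
    Ensures f hf (binarySearch u D) (Nat.clog 2 D.length : ℕ) 0 V fun r => ∃ i ∈ D, r = some i ∧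
      ∃ w, f w = true ∧ w i = u i ∧ f (flipAt w i) = false := by
  induction hlen : D.length using Nat.strong_induction_on generalizing u D with
  | _ m ih =>
    subst hlen
    rw [binarySearch]
    split_ifs with h
    · refine ensures_ret le_rfl ?_
      match D, h with
      | [], _ => rw [flipList_nil] at hD; simp [hu] at hD
      | [i], _ =>
        rw [flipList_singleton] at hD
        exact ⟨i, by simp, rfl, u, hu, rfl, hD⟩
    · have hcl : (Nat.clog 2 D.length : ℕ) =
          Nat.clog 2 ((D.length + 1) / 2) + 1 := by
        rw [Nat.clog_of_two_le (by norm_num) (by omega)]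
        rfl
      rw [hcl]
      have hsplit := List.take_append_drop (D.length / 2) D
      have hdisj : (D.take (D.length / 2)).Disjoint (D.drop (D.length / 2)) := by
        rw [← hsplit] at hnd
        exact (List.nodup_append'.1 hnd).2.2
      refine (ensures_ask_bind (c := (Nat.clog 2 ((D.length + 1) / 2) : ℕ)) ?_).mono_cost
        (by norm_cast)
      split_ifs with hw
      · refine ((ih (D.drop (D.length / 2)).length (by simp; omega) _ _ hw (by
          rw [flipList_append _ hdisj, hsplit]; exact hD) (hnd.sublist (List.drop_sublist _ _))
          rfl).mono_cost ?_).imp ?_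
        · have : (D.drop (D.length / 2)).length ≤ (D.length + 1) / 2 := by
            rw [List.length_drop]; omega
          exact_mod_cast Nat.clog_mono_right 2 this
        · rintro r ⟨i, hi, hr, w, h1, h2, h3⟩
          refine ⟨i, List.mem_of_mem_drop hi, hr, w, h1, ?_, h3⟩
          -- The flips already made lie in the other half of the list, so bit i still has its
          -- original value.
          rw [h2, flipList, if_neg fun h => hdisj h hi]
      · refine ((ih (D.take (D.length / 2)).length (by simp; omega) _ _ hu (by
          simpa using hw) (hnd.sublist (List.take_sublist _ _)) rfl).mono_cost ?_).imp ?_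
        · have : (D.take (D.length / 2)).length ≤ (D.length + 1) / 2 := by
            rw [List.length_take]; omega
          exact_mod_cast Nat.clog_mono_right 2 this
        · rintro r ⟨i, hi, hr, hw⟩
          exact ⟨i, List.mem_of_mem_take hi, hr, hw⟩

/-! ### Moving a sample towards `d` -/

/-- Move `z` towards `d` along a random coordinate; if `f` drops, try to confirm the direction. -/
noncomputable def moveTest (d : PStr n) (z : Cube n) : Algo n Unit :=
  withRandom (diffCoords (toPStr z) d) fun i => do
    let v ← ask (flipAt z i)
    if v = false then rejectIfConfirmed d i else ret ()

theorem ensures_moveTest (hV : Unate f ∨ V Verdict.reject) (d : PStr n) {z : Cube n}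
    (hz : z ∈ ones f) : Ensures f hf (moveTest d z) 51 0 V fun _ => True := by
  refine (ensures_withRandom (c := 50 + 1) le_rfl (fun i hi => ensures_ask_bind ?_)
    fun _ => trivial).mono_cost (by norm_num)
  split_ifs with h
  · exact ensures_rejectIfConfirmed hV (mem_diffCoords.1 hi) ⟨z, mem_ones.1 hz, by simp, h⟩
  · exact ensures_ret le_rfl trivial

theorem surv_moveTest_le {d : PStr n} (hd : Reliable f d) {z : Cube n}
    (hne : (diffCoords (toPStr z) d).Nonempty) : surv f hf (moveTest d z) ≤
      𝔼 i ∈ diffCoords (toPStr z) d, if f (flipAt z i) = true then (1 : ℝ) else 1 / 100 := by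
  rw [moveTest, surv_withRandom hne]
  refine Finset.expect_le_expect fun i hi => ?_
  rw [surv_ask_bind]
  cases h : f (flipAt z i)
  · simpa using surv_rejectIfConfirmed_le (hf := hf) hd (mem_diffCoords.1 hi)
  · simp

/-! ### Preprocessing -/

theorem mem_upperCone {d : PStr n} {z y : Cube n} : y ∈ upperCone d z ↔ PrecedesTowards d z y := by
  simp [upperCone]

theorem eq_of_mem_upperCone {d : PStr n} {z y : Cube n} (hy : y ∈ upperCone d z) {i : Fin n}
    (hi : i ∈ diffCoords (toPStr z) (toPStr y)) : d i = some (!(z i)) := by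
  have h := mem_upperCone.1 hy i
  have h' := mem_diffCoords_toPStr.1 hi
  cases hd : d i with
  | none => exact absurd (h.2.2 hd) h'
  | some b =>
    cases b
    · have := h.2.1 hd
      revert this h'
      cases z i <;> cases y i <;> simp
    · have := h.1 hd
      revert this h'
      cases z i <;> cases y i <;> simp

theorem flipList_sort_diffCoords (z y : Cube n) :
    flipList z ((diffCoords (toPStr z) (toPStr y)).sort (· ≤ ·)) = y := by
  funext i
  simp only [flipList, Finset.mem_sort, mem_diffCoords_toPStr]
  cases z i <;> cases y i <;> simp

/-- Each set of coordinates on which z disagrees with d yields its own point of the cone. -/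
theorem two_pow_hdist_le (d : PStr n) (z : Cube n) :
    2 ^ hdist (toPStr z) d ≤ (upperCone d z).card := by
  rw [hdist, ← Finset.card_powerset]
  refine Finset.card_le_card_of_injOn (fun D i => if i ∈ D then !(z i) else z i) ?_ ?_
  · intro D hD
    simp only [Finset.mem_coe, Finset.mem_powerset] at hD
    simp only [Finset.mem_coe]
    rw [mem_upperCone]
    intro i
    by_cases hi : i ∈ D
    · have := mem_diffCoords.1 (hD hi)
      simp only [hi, if_true, this]
      cases z i <;> simp
    · simp [hi]
  · intro D _ D' _ h
    ext i
    have := congrFun h i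
    simp only at this
    by_cases h1 : i ∈ D <;> by_cases h2 : i ∈ D' <;> simp [h1, h2] at this ⊢

/-- The part of `Preprocessing` after the choice of `z`. -/
noncomputable def preprocessTail (d : PStr n) (δ : ℝ) (z : Cube n) : Algo n ℕ := do
  repeatN (10 * ceilLog (1 / δ)) (moveTest d z)
  let ys ← draws (upperCone d z) (upperCone_nonempty d z) (5 * ceilLog (1 / δ))
  let answers ← askAll id ys
  match answers.find? fun r => !r.2 with
  | none => ret (hdist (toPStr z) d)
  | some (y, _) =>
      let r ← binarySearch z ((diffCoords (toPStr z) (toPStr y)).sort (· ≤ ·))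
      match r with
      | none => ret (hdist (toPStr z) d)
      | some i =>
          repeatN (5 * ceilLog (1 / δ)) (rejectIfConfirmed d i)
          ret (hdist (toPStr z) d)

theorem preprocessing_eq (d : PStr n) (ε δ : ℝ) : preprocessing d ε δ =
    samples (30 * ⌈1 / ε⌉₊) >>= fun S =>
      match S.argmax fun z => hdist (toPStr z) d with
      | none => ret 0
      | some z => preprocessTail d δ z := rfl

end RelUnate

namespace RelUnate

open Finset Algo
open scoped BigOperators

variable {n : ℕ} {f : Cube n → Bool} {hf : (ones f).Nonempty} {V : Verdict → Prop}

/-- What remains of `Preprocessing` after querying the points `ys` of the cone. -/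
noncomputable def preprocessEnd (d : PStr n) (δ : ℝ) (z : Cube n) (ys : List (Cube n)) :
    Algo n ℕ := do
  let answers ← askAll id ys
  match answers.find? fun r => !r.2 with
  | none => ret (hdist (toPStr z) d)
  | some (y, _) =>
      let r ← binarySearch z ((diffCoords (toPStr z) (toPStr y)).sort (· ≤ ·))
      match r with
      | none => ret (hdist (toPStr z) d)
      | some i =>
          repeatN (5 * ceilLog (1 / δ)) (rejectIfConfirmed d i)
          ret (hdist (toPStr z) d)

/-- Separates the two outcomes: all queried points have value 1 (`hnone`), or binary search finds an
edge oriented against d and only the repeated confirmation remains (`hrep`). The same lemma gives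
the sure and the costed version. -/
theorem ensures_preprocessEnd {d : PStr n} {δ : ℝ} {z : Cube n} (hz : z ∈ ones f)
    {ys : List (Cube n)} (hys : ∀ y ∈ ys, y ∈ upperCone d z) {c : ℕ} {η : ℝ} (hη : 0 ≤ η)
    {Q : ℕ → Prop} (hnone : (∀ y ∈ ys, f y = true) → Q (hdist (toPStr z) d))
    (hrep : ∀ i b w, d i = some b → f w = true → w i ≠ b → f (flipAt w i) = false →
      Ensures f hf (repeatN (5 * ceilLog (1 / δ)) (rejectIfConfirmed d i)) c η V
        fun _ => Q (hdist (toPStr z) d)) :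
    Ensures f hf (preprocessEnd d δ z ys)
      ((Nat.clog 2 (hdist (toPStr z) d) + c + ys.length : ℕ)) η V Q := by
  refine (ensures_askAll_bind (c := ((Nat.clog 2 (hdist (toPStr z) d) + c : ℕ) : ℕ∞)) ?_).mono_cost
    (by push_cast; exact le_rfl)
  split
  · rename_i h
    refine ensures_ret hη (hnone fun y hy => ?_)
    have := List.find?_eq_none.1 h (y, f y) (List.mem_map.2 ⟨y, hy, rfl⟩)
    simpa using this
  · rename_i y b h
    have hmem := List.mem_of_find?_eq_some h
    obtain ⟨y', hy', he⟩ := List.mem_map.1 hmem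
    simp only [id, Prod.mk.injEq] at he
    obtain ⟨rfl, rfl⟩ := he
    have hfy : f y' = false := by simpa using List.find?_some h
    have hcone := hys y' hy'
    have hlen : ((diffCoords (toPStr z) (toPStr y')).sort (· ≤ ·)).length ≤
        hdist (toPStr z) d := by
      rw [Finset.length_sort, hdist]
      exact Finset.card_le_card fun i hi => mem_diffCoords.2 (eq_of_mem_upperCone hcone hi)
    have hbs := ensures_binarySearch (hf := hf) (V := V) z
      ((diffCoords (toPStr z) (toPStr y')).sort (· ≤ ·)) (mem_ones.1 hz)
      (by rw [flipList_sort_diffCoords]; exact hfy) (Finset.sort_nodup _ _)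
    refine (hbs.sure_bind hη (c₂ := c) fun r hr => ?_).mono_cost ?_
    · obtain ⟨i, hi, rfl, w, h1, h2, h3⟩ := hr
      rw [Finset.mem_sort] at hi
      refine ((hrep i _ w (eq_of_mem_upperCone hcone hi) h1 (by rw [h2]; simp) h3).bind
        (c₂ := 0) (η₂ := 0) le_rfl fun _ h => ensures_ret le_rfl h).mono
          (add_zero _).le (add_zero _).le (fun _ => id) fun _ => id
    · push_cast
      gcongr

theorem preprocessTail_eq (d : PStr n) (δ : ℝ) (z : Cube n) : preprocessTail d δ z =
    repeatN (10 * ceilLog (1 / δ)) (moveTest d z) >>= fun _ =>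
      draws (upperCone d z) (upperCone_nonempty d z) (5 * ceilLog (1 / δ)) >>= fun ys =>
        preprocessEnd d δ z ys := rfl

theorem ensures_preprocessTail_sure (hV : Unate f ∨ V Verdict.reject) (d : PStr n) (δ : ℝ)
    {z : Cube n} (hz : z ∈ ones f) : Ensures f hf (preprocessTail d δ z) ⊤ 0 V
      fun M => M = hdist (toPStr z) d := by
  rw [preprocessTail_eq]
  have hdraws : Ensures f hf (draws (upperCone d z) (upperCone_nonempty d z)
      (5 * ceilLog (1 / δ))) 0 0 V fun ys =>
        (ys.length = 5 * ceilLog (1 / δ) ∧ ∀ y ∈ ys, y ∈ upperCone d z) ∧ True :=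
    ensures_draws (by simp [listProb, listExpect_zero])
  refine ((ensures_repeatN _ (ensures_moveTest hV d hz)).sure_bind le_rfl fun _ _ =>
    hdraws.sure_bind le_rfl fun ys hys =>
    (ensures_preprocessEnd (Q := fun M => M = hdist (toPStr z) d)
      (c := 5 * ceilLog (1 / δ) * 50) hz hys.1.2 le_rfl (fun _ => rfl)
      fun i b w h1 h2 h3 h4 => (((ensures_repeatN _
        (ensures_rejectIfConfirmed hV h1 ⟨w, h2, h3, h4⟩)).mono_cost
          (by push_cast; exact le_rfl)).imp fun _ _ => rfl)).mono_cost le_top).mono_cost le_top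

/-- If z disagrees with d in more than 2N places, at least half of the moves leave f⁻¹(1), and
reliability confirms such a move. This crude bound on M is needed only to keep the binary search at
log(2N) queries. -/
theorem ensures_moveTests (hV : Unate f ∨ V Verdict.reject) {d : PStr n}
    (hd : Reliable f d) {δ : ℝ} (hδ : 0 < δ) (hδ1 : δ < 1) {z : Cube n} (hz : z ∈ ones f) :
    Ensures f hf (repeatN (10 * ceilLog (1 / δ)) (moveTest d z))
      ((10 * ceilLog (1 / δ) * 51 : ℕ) : ℕ∞) (δ / 16) V
      fun _ => hdist (toPStr z) d ≤ 2 * (ones f).card := by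
  have hlam := ceilLog_pos hδ hδ1
  have hN : (0 : ℝ) < (ones f).card := by exact_mod_cast hf.card_pos
  have hsure := (ensures_repeatN (10 * ceilLog (1 / δ)) (ensures_moveTest (hf := hf) hV d
    hz)).mono_cost (c' := ((10 * ceilLog (1 / δ) * 51 : ℕ) : ℕ∞)) (by push_cast; exact le_rfl)
  by_cases hM : hdist (toPStr z) d ≤ 2 * (ones f).card
  · exact hsure.mono le_rfl (by positivity) (fun _ => id) fun _ _ => hM
  · refine hsure.of_surv ?_
    set D := diffCoords (toPStr z) d with hD
    have hcard : 2 * (ones f).card < D.card := not_le.1 hM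
    have hne : D.Nonempty := Finset.card_pos.1 (by omega)
    have hcard' : 2 * ((ones f).card : ℝ) < D.card := by exact_mod_cast hcard
    have hs : surv f hf (moveTest d z) ≤ 3 / 5 := by
      refine (surv_moveTest_le hd hne).trans ?_
      have h1 : ∀ i ∈ D, (if f (flipAt z i) = true then (1 : ℝ) else 1 / 100) ≤
          (if f (flipAt z i) = true then 1 else 0) + 1 / 100 := by
        intro i _; split_ifs <;> norm_num
      refine (Finset.expect_le_expect h1).trans ?_
      rw [Finset.expect_add_distrib, Finset.expect_const hne, Finset.expect_eq_sum_div_card,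
        Finset.sum_boole]
      have h2 : ((D.filter fun i => f (flipAt z i) = true).card : ℝ) ≤ (ones f).card := by
        exact_mod_cast card_filter_flipAt_le z D
      have h3 : ((D.filter fun i => f (flipAt z i) = true).card : ℝ) / D.card ≤ 1 / 2 := by
        rw [div_le_iff₀ (by linarith)]
        linarith
      linarith
    refine (surv_repeatN_le _ hs).trans ?_
    have h1 : ((3 / 5 : ℝ) ^ 2) ≤ 1 / 2 := by norm_num
    have h2 := pow_le_of_exp (c := 4) (m := 5) hδ (by norm_num) (by norm_num) h1 hlam
    rw [← pow_mul] at h2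
    rw [show 10 * ceilLog (1 / δ) = 2 * (5 * ceilLog (1 / δ)) by ring]
    exact h2.trans (by norm_num)

/-- If M > 1 + log N, the cone has at least 2^M ≥ 2N points, so a uniform one has value 1 with
probability at most 1/2. -/
theorem ensures_cone_draws (hf : (ones f).Nonempty) (d : PStr n) {δ : ℝ} (hδ : 0 < δ)
    (hδ1 : δ < 1) (z : Cube n) :
    Ensures f hf (draws (upperCone d z) (upperCone_nonempty d z) (5 * ceilLog (1 / δ))) 0
      (δ / 16) V fun ys => (ys.length = 5 * ceilLog (1 / δ) ∧ ∀ y ∈ ys, y ∈ upperCone d z) ∧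
        ((∀ y ∈ ys, f y = true) → (hdist (toPStr z) d : ℝ) ≤ 1 + Real.logb 2 (ones f).card) := by
  have hlam := ceilLog_pos hδ hδ1
  have hN : (0 : ℝ) < (ones f).card := by exact_mod_cast hf.card_pos
  refine ensures_draws ?_
  by_cases hM : (hdist (toPStr z) d : ℝ) ≤ 1 + Real.logb 2 (ones f).card
  · refine le_trans (le_of_eq ?_) (by positivity : (0:ℝ) ≤ _)
    simp [listProb, listExpect_zero, hM]
  · refine (listProb_mono (H := fun ys => ∀ y ∈ ys, f y = true) fun S _ _ h =>
      (Classical.not_imp.1 h).1).trans ?_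
    rw [listProb_forall_eq]
    have hfreq : freq (upperCone d z) (fun y => f y = true) ≤ 1 / 2 := by
      rw [freq_eq_div]
      have h2 : (2 : ℝ) ^ hdist (toPStr z) d ≤ (upperCone d z).card := by
        exact_mod_cast two_pow_hdist_le d z
      have h3 : 2 * ((ones f).card : ℝ) ≤ (2 : ℝ) ^ hdist (toPStr z) d := by
        have h4 : Real.logb 2 (2 * (ones f).card) ≤ hdist (toPStr z) d := by
          rw [Real.logb_mul (by norm_num) hN.ne', Real.logb_self_eq_one (by norm_num)]
          exact (not_le.1 hM).le
        rwa [Real.logb_le_iff_le_rpow (by norm_num) (by positivity), Real.rpow_natCast] at h4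
      have h5 : (0 : ℝ) < (upperCone d z).card := by linarith
      rw [div_le_iff₀ h5]
      refine (Nat.cast_le.2 (Finset.card_le_card (t := ones f) fun y hy =>
        mem_ones.2 (Finset.mem_filter.1 hy).2)).trans ?_
      linarith
    exact (pow_le_of_exp (c := 4) (m := 5) hδ (freq_nonneg _ _) (by norm_num) hfreq hlam).trans
      (by norm_num)

/-- Three failures of probability δ/16 each: the move tests, the draws from the cone, and the
confirmation of the edge found. The last very likely rejects, so the bound on M may be asserted on
return. -/
theorem ensures_preprocessTail_cost (hV : Unate f ∨ V Verdict.reject) {d : PStr n}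
    (hd : Reliable f d) {δ : ℝ} (hδ : 0 < δ) (hδ1 : δ < 1) {z : Cube n} (hz : z ∈ ones f) :
    Ensures f hf (preprocessTail d δ z)
      ((765 * ceilLog (1 / δ) + Nat.clog 2 (2 * (ones f).card) : ℕ)) (3 * (δ / 16)) V
      fun M => (M : ℝ) ≤ 1 + Real.logb 2 (ones f).card := by
  rw [preprocessTail_eq]
  have hlam := ceilLog_pos hδ hδ1
  generalize hc₂ : 255 * ceilLog (1 / δ) + Nat.clog 2 (2 * (ones f).card) = c₂
  have hend : ∀ ys : List (Cube n), hdist (toPStr z) d ≤ 2 * (ones f).card →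
      ((ys.length = 5 * ceilLog (1 / δ) ∧ ∀ y ∈ ys, y ∈ upperCone d z) ∧
        ((∀ y ∈ ys, f y = true) → (hdist (toPStr z) d : ℝ) ≤ 1 + Real.logb 2 (ones f).card)) →
      Ensures f hf (preprocessEnd d δ z ys) (c₂ : ℕ) (δ / 16) V
        fun M => (M : ℝ) ≤ 1 + Real.logb 2 (ones f).card := by
    intro ys hM hys
    refine (ensures_preprocessEnd (c := 5 * ceilLog (1 / δ) * 50) hz hys.1.2 (by positivity) hys.2
        fun i b w h1 h2 h3 h4 => ?_).mono_cost ?_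
    · have hsure := (ensures_repeatN (hf := hf) (5 * ceilLog (1 / δ))
        (ensures_rejectIfConfirmed hV h1 ⟨w, h2, h3, h4⟩)).mono_cost
          (c' := ((5 * ceilLog (1 / δ) * 50 : ℕ) : ℕ∞)) (by push_cast; exact le_rfl)
      refine hsure.of_surv ((surv_repeatN_le _ (surv_rejectIfConfirmed_le hd h1)).trans ?_)
      exact (pow_le_of_exp (c := 4) (m := 5) hδ (by norm_num) (by norm_num) (by norm_num)
        hlam).trans (by norm_num)
    · have h1 : Nat.clog 2 (hdist (toPStr z) d) ≤ Nat.clog 2 (2 * (ones f).card) :=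
        Nat.clog_mono_right 2 hM
      rw [hys.1.1, ← hc₂]
      exact_mod_cast (by omega : Nat.clog 2 (hdist (toPStr z) d) + 5 * ceilLog (1 / δ) * 50 +
        5 * ceilLog (1 / δ) ≤ 255 * ceilLog (1 / δ) + Nat.clog 2 (2 * (ones f).card))
  refine ((ensures_moveTests (hf := hf) hV hd hδ hδ1 hz).bind (η₂ := δ / 16 + δ / 16)
    (c₂ := 0 + (c₂ : ℕ∞)) (by positivity) fun _ hM =>
      (ensures_cone_draws hf d hδ hδ1 z).bind (by positivity) fun ys hys => hend ys hM hys).mono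
        ?_ (by linarith) (fun _ => id) fun _ => id
  rw [zero_add, ← Nat.cast_add, ← hc₂]
  exact_mod_cast (by omega : 10 * ceilLog (1 / δ) * 51 + (255 * ceilLog (1 / δ) +
    Nat.clog 2 (2 * (ones f).card)) ≤ 765 * ceilLog (1 / δ) + Nat.clog 2 (2 * (ones f).card))

theorem ensures_preprocessing_sure (hV : Unate f ∨ V Verdict.reject) (d : PStr n) (ε δ : ℝ) :
    Ensures f hf (preprocessing d ε δ) ⊤ 0 V fun _ => True := by
  rw [preprocessing_eq]
  refine (ensures_samples_zero.sure_bind le_rfl (c₂ := ⊤) fun S hS => ?_).mono_cost le_top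
  split
  · exact ensures_ret le_rfl trivial
  · rename_i z hz
    exact (ensures_preprocessTail_sure hV d δ (hS.2 z (List.argmax_mem hz))).imp fun _ _ => trivial

theorem ensures_preprocessing_cost (hV : Unate f ∨ V Verdict.reject) {d : PStr n}
    (hd : Reliable f d) (ε : ℝ) {δ : ℝ} (hδ : 0 < δ) (hδ1 : δ < 1) :
    Ensures f hf (preprocessing d ε δ)
      ((30 * ⌈1 / ε⌉₊ + (765 * ceilLog (1 / δ) + Nat.clog 2 (2 * (ones f).card)) : ℕ))
      (3 * (δ / 16)) V fun M => (M : ℝ) ≤ 1 + Real.logb 2 (ones f).card := by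
  rw [preprocessing_eq]
  refine (ensures_samples_zero.sure_bind (by positivity) (c₂ :=
    ((765 * ceilLog (1 / δ) + Nat.clog 2 (2 * (ones f).card) : ℕ) : ℕ∞)) fun S hS => ?_).mono_cost
      (by norm_cast)
  have hN : (1 : ℝ) ≤ (ones f).card := by exact_mod_cast hf.card_pos
  split
  · refine ensures_ret (by positivity) ?_
    have := Real.logb_nonneg (b := 2) (by norm_num) hN
    push_cast
    linarith
  · rename_i z hz
    exact ensures_preprocessTail_cost hV hd hδ hδ1 (hS.2 z (List.argmax_mem hz))

/-- M is an empirical upper quantile of the distance to d: 30/ε samples miss an event of probability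
ε/8 with probability at most e⁻³. -/
theorem ensures_preprocessing_tail (hV : Unate f ∨ V Verdict.reject) (d : PStr n) {ε : ℝ}
    (hε : 0 < ε) (hε1 : ε ≤ 1) (δ : ℝ) :
    Ensures f hf (preprocessing d ε δ) ⊤ (1 / 10) V fun M =>
      freq (ones f) (fun z => M < hdist (toPStr z) d) ≤ ε / 8 := by
  rw [preprocessing_eq]
  have hex : ∃ t, freq (ones f) (fun z => t < hdist (toPStr z) d) ≤ ε / 8 := by
    refine ⟨n, le_trans (le_of_eq ?_) (by positivity : (0 : ℝ) ≤ _)⟩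
    rw [freq_eq_div, Finset.filter_false_of_mem, Finset.card_empty, Nat.cast_zero, zero_div]
    intro z _
    have := Finset.card_le_univ (diffCoords (toPStr z) d)
    rw [Fintype.card_fin] at this
    exact not_lt.2 this
  -- By minimality of t a distance of at least t has frequency more than ε/8 (or t = 0). One such
  -- sample gives M ≥ t, and the tail above M is at most the tail above t.
  obtain ⟨t, ht, hmin⟩ : ∃ t, freq (ones f) (fun z => t < hdist (toPStr z) d) ≤ ε / 8 ∧
      ∀ s < t, ¬ freq (ones f) (fun z => s < hdist (toPStr z) d) ≤ ε / 8 :=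
    ⟨Nat.find hex, Nat.find_spec hex, fun s hs => Nat.find_min hex hs⟩
  have hk : 1 ≤ 30 * ⌈1 / ε⌉₊ := by
    have : 0 < ⌈1 / ε⌉₊ := Nat.ceil_pos.2 (by positivity)
    omega
  have hprob : listProb (ones f) (30 * ⌈1 / ε⌉₊)
      (fun S => ¬ ∃ z ∈ S, t ≤ hdist (toPStr z) d) ≤ 1 / 10 := by
    have h1 : listProb (ones f) (30 * ⌈1 / ε⌉₊) (fun S => ¬ ∃ z ∈ S, t ≤ hdist (toPStr z) d) ≤
        listProb (ones f) (30 * ⌈1 / ε⌉₊) (fun S => ∀ z ∈ S, hdist (toPStr z) d < t) := by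
      refine listProb_mono fun S _ _ h z hz => ?_
      by_contra hlt
      exact h ⟨z, hz, not_lt.1 hlt⟩
    refine h1.trans ?_
    rw [listProb_forall_eq]
    have h2 : freq (ones f) (fun z => hdist (toPStr z) d < t) ≤ 1 - ε / 8 := by
      rcases Nat.eq_zero_or_pos t with rfl | hpos
      · simp only [Nat.not_lt_zero]
        rw [freq_eq_div]
        simp
        linarith
      · have h3 := hmin (t - 1) (by omega)
        have h4 := freq_add_not hf fun z => t - 1 < hdist (toPStr z) d
        have h5 : freq (ones f) (fun z => hdist (toPStr z) d < t) =
            freq (ones f) (fun z => ¬ t - 1 < hdist (toPStr z) d) :=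
          freq_congr fun z _ => by omega
        rw [h5]
        linarith
    have h6 : freq (ones f) (fun z => hdist (toPStr z) d < t) ≤ Real.exp (-(ε / 8)) :=
      h2.trans (Real.one_sub_le_exp_neg _)
    refine (pow_le_pow_left₀ (freq_nonneg _ _) h6 _).trans ?_
    rw [← Real.exp_nat_mul]
    have h7 : ((30 * ⌈1 / ε⌉₊ : ℕ) : ℝ) * -(ε / 8) ≤ -3 := by
      have : 1 / ε ≤ ⌈1 / ε⌉₊ := Nat.le_ceil _
      rw [div_le_iff₀ hε] at this
      push_cast
      nlinarith
    refine (Real.exp_le_exp.2 h7).trans ?_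
    rw [Real.exp_neg, show (3 : ℝ) = ((3 : ℕ) : ℝ) * 1 by norm_num, Real.exp_nat_mul]
    have h8 : (2.7 : ℝ) ≤ Real.exp 1 := by have := Real.exp_one_gt_d9; linarith
    have h9 : (10 : ℝ) ≤ Real.exp 1 ^ 3 :=
      le_trans (by norm_num) (pow_le_pow_left₀ (by norm_num) h8 3)
    rw [one_div]
    exact inv_anti₀ (by norm_num) h9
  refine ((ensures_samples hprob).bind le_rfl (c₂ := ⊤) fun S hS => ?_).mono le_top
    (add_zero _).le (fun _ => id) fun _ => id
  obtain ⟨y, hyS, hy⟩ := hS.2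
  split
  · rename_i h
    rw [List.argmax_eq_none] at h
    simp [h] at hyS
  · rename_i z hz
    refine (ensures_preprocessTail_sure hV d δ (hS.1.2 z (List.argmax_mem hz))).imp ?_
    rintro M rfl
    refine (freq_mono fun x _ hx => ?_).trans ht
    exact (hy.trans (List.le_of_mem_argmax (f := fun z => hdist (toPStr z) d) hyS hz)).trans_lt hx

end RelUnate

namespace RelUnate

open Finset Algo
open scoped BigOperators

variable {n : ℕ} {f : Cube n → Bool} {hf : (ones f).Nonempty} {V : Verdict → Prop}

/-! ### BiasedTest -/

theorem biasedTest_eq (M : ℕ) (ε' : ℝ) (d : PStr n) : biasedTest M ε' d =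
    if fixedCoords d = ∅ then ret () else
      repeatN (10 * ⌈(M : ℝ) / ε'⌉₊) (sample >>= fun z => moveTest d z) := rfl

theorem ensures_biasedTest (hV : Unate f ∨ V Verdict.reject) (M : ℕ) (ε' : ℝ) (d : PStr n) :
    Ensures f hf (biasedTest M ε' d) ((520 * ⌈(M : ℝ) / ε'⌉₊ : ℕ)) 0 V fun _ => True := by
  rw [biasedTest_eq]
  split_ifs
  · exact ensures_ret le_rfl trivial
  · refine (ensures_repeatN _ (ensures_sample_bind fun z hz =>
      ensures_moveTest hV d hz)).mono_cost ?_
    rw [show (51 : ℕ∞) + 1 = ((52 : ℕ) : ℕ∞) by norm_num]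
    exact_mod_cast (by ring_nf; exact le_rfl :
      10 * ⌈(M : ℝ) / ε'⌉₊ * 52 ≤ 520 * ⌈(M : ℝ) / ε'⌉₊)

/-- The coordinates along which moving `z` towards `d` leaves `f⁻¹(1)`. -/
def badCoords (f : Cube n → Bool) (d : PStr n) (z : Cube n) : Finset (Fin n) :=
  (diffCoords (toPStr z) d).filter fun i => f (flipAt z i) = false

/-- The expected number of bad coordinates, restricted to points at distance at most `M`. -/
noncomputable def fixedMass (f : Cube n → Bool) (d : PStr n) (M : ℕ) : ℝ :=
  𝔼 z ∈ ones f, if hdist (toPStr z) d ≤ M then ((badCoords f d z).card : ℝ) else 0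

/-- A bad coordinate is drawn with probability |bad|/|D| ≥ |bad|/M, since |D| ≤ M, and is then
confirmed with probability 99/100. Points farther than M are given up. -/
theorem surv_moveTest_le_badCoords {d : PStr n} (hd : Reliable f d) {M : ℕ} (hM : 0 < M)
    (z : Cube n) : surv f hf (moveTest d z) ≤ 1 - 99 / 100 / M *
      if hdist (toPStr z) d ≤ M then ((badCoords f d z).card : ℝ) else 0 := by
  have hM' : (0 : ℝ) < M := by exact_mod_cast hM
  split_ifs with h
  · set D := diffCoords (toPStr z) d with hD
    rcases D.eq_empty_or_nonempty with he | hne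
    · have : badCoords f d z = ∅ := by rw [badCoords, ← hD, he, Finset.filter_empty]
      rw [this]
      simpa using surv_le_one _
    · refine (surv_moveTest_le hd hne).trans ?_
      have h1 : ∀ i ∈ D, (if f (flipAt z i) = true then (1 : ℝ) else 1 / 100) =
          1 - 99 / 100 * if f (flipAt z i) = false then 1 else 0 := by
        intro i _
        cases f (flipAt z i) <;> norm_num
      rw [Finset.expect_congr rfl h1, Finset.expect_sub_distrib, Finset.expect_const hne,
        ← Finset.mul_expect, Finset.expect_eq_sum_div_card, Finset.sum_boole]
      have h2 : (0 : ℝ) < D.card := by exact_mod_cast hne.card_pos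
      have h3 : (D.card : ℝ) ≤ M := by exact_mod_cast h
      have h4 : ((badCoords f d z).card : ℝ) / M ≤ ((badCoords f d z).card : ℝ) / D.card := by
        gcongr
      have h5 : (99 : ℝ) / 100 / M * (badCoords f d z).card =
        99 / 100 * (((badCoords f d z).card : ℝ) / M) := by ring
      rw [h5]
      have h6 : D.filter (fun i => f (flipAt z i) = false) = badCoords f d z := rfl
      rw [h6]
      linarith
  · simpa using surv_le_one _

theorem surv_biasedTest_le {d : PStr n} (hd : Reliable f d) {M : ℕ} {ε : ℝ} (hε : 0 < ε)
    (h : 7 * ε / 32 ≤ fixedMass f d M) : surv f hf (biasedTest M (ε / 64) d) ≤ 1 / 100 := by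
  have hcard : ∀ z, (badCoords f d z).card ≤ hdist (toPStr z) d := fun z =>
    Finset.card_le_card (Finset.filter_subset _ _)
  -- Positive mass rules out the degenerate cases M = 0 and d without fixed coordinates, in which
  -- the test does nothing.
  have hzero : (∀ z : Cube n, hdist (toPStr z) d ≤ M → hdist (toPStr z) d = 0) → False := by
    intro h0
    have : fixedMass f d M = 0 := by
      rw [fixedMass]
      refine (Finset.expect_congr rfl fun z _ => ?_).trans (Finset.expect_const hf 0)
      split_ifs with hz
      · have := hcard z
        rw [h0 z hz] at this
        exact_mod_cast Nat.le_zero.1 this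
      · rfl
    linarith
  have hM : 0 < M := by
    rcases Nat.eq_zero_or_pos M with rfl | hM
    · exact (hzero fun z hz => Nat.le_zero.1 hz).elim
    · exact hM
  have hM' : (0 : ℝ) < M := by exact_mod_cast hM
  rw [biasedTest_eq, if_neg]
  swap
  · intro he
    refine hzero fun z _ => ?_
    rw [hdist, diffCoords, he, Finset.inter_empty, Finset.filter_empty, Finset.card_empty]
  have hbody : surv f hf (sample >>= fun z => moveTest d z) ≤
      Real.exp (-(99 / 100 / M * (7 * ε / 32))) := by
    rw [surv_sample_bind]
    refine (Finset.expect_le_expect fun z _ => surv_moveTest_le_badCoords hd hM z).trans ?_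
    rw [Finset.expect_sub_distrib, Finset.expect_const hf, ← Finset.mul_expect]
    refine le_trans ?_ (Real.one_sub_le_exp_neg _)
    have : 99 / 100 / M * (7 * ε / 32) ≤ 99 / 100 / M * fixedMass f d M :=
      mul_le_mul_of_nonneg_left h (by positivity)
    rw [fixedMass] at this
    linarith
  refine (surv_repeatN_le _ hbody).trans ?_
  rw [← Real.exp_nat_mul]
  have hceil : (M : ℝ) / (ε / 64) ≤ ⌈(M : ℝ) / (ε / 64)⌉₊ := Nat.le_ceil _
  have h1 : ((10 * ⌈(M : ℝ) / (ε / 64)⌉₊ : ℕ) : ℝ) * -(99 / 100 / M * (7 * ε / 32)) ≤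
      -((7 : ℕ) : ℝ) := by
    push_cast
    have h2 := mul_le_mul_of_nonneg_right hceil
      (show 0 ≤ 99 / 100 / (M : ℝ) * (7 * ε / 32) by positivity)
    -- M and ε cancel: 64 · 0.99 · 7/32 = 13.86, before the factor 10 for the repetitions.
    have h3 : (M : ℝ) / (ε / 64) * (99 / 100 / (M : ℝ) * (7 * ε / 32)) = 1386 / 100 := by
      field_simp; norm_num
    rw [h3] at h2
    linarith
  refine ((Real.exp_le_exp.2 h1).trans (exp_neg_nat_le 7)).trans ?_
  norm_num

/-! ### UnbiasedTest -/

open Classical in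
/-- One trial of `UnbiasedTest` in direction `i` with `k` samples. -/
noncomputable def collisionTest (k : ℕ) (i : Fin n) : Algo n Unit := do
  let S ← samples k
  let answers ← askAll (fun z => flipAt z i) S
  if ∃ x ∈ answers, ∃ y ∈ answers,
      x.1 i = false ∧ y.1 i = true ∧ x.2 = false ∧ y.2 = false
  then halt Verdict.reject else ret ()

theorem unbiasedTest_eq (ε' : ℝ) (d : PStr n) : unbiasedTest ε' d =
    if unfixedCoords d = ∅ then ret () else
      forEach (List.range' 1 (ceilLog (((unfixedCoords d).card : ℝ) / ε') + 2)) fun r =>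
        repeatN ⌈50 * ((unfixedCoords d).card : ℝ) / (ε' * 2 ^ r)⌉₊
          (withRandom (unfixedCoords d) (collisionTest (3 * 2 ^ r))) := rfl

theorem ensures_collisionTest (hV : Unate f ∨ V Verdict.reject) (k : ℕ) (i : Fin n) :
    Ensures f hf (collisionTest k i) ((2 * k : ℕ)) 0 V fun _ => True := by
  refine (ensures_samples_zero.sure_bind le_rfl (c₂ := ((k : ℕ) : ℕ∞)) fun S hS =>
    (ensures_askAll_bind (c := 0) ?_).mono_cost (by rw [hS.1, zero_add])).mono_cost ?_
  · split_ifs with h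
    · refine ensures_halt le_rfl (hV.resolve_left ?_)
      obtain ⟨x, hx, y, hy, h1, h2, h3, h4⟩ := h
      obtain ⟨x', hx', rfl⟩ := List.mem_map.1 hx
      obtain ⟨y', hy', rfl⟩ := List.mem_map.1 hy
      exact not_unate_of_edges (mem_ones.1 (hS.2 x' hx')) (mem_ones.1 (hS.2 y' hy'))
        (by simp only at h1 h2; rw [h1, h2]; simp) h3 h4
    · exact ensures_ret le_rfl trivial
  · rw [two_mul]; push_cast; exact le_rfl

/-- The number of oracle calls of `UnbiasedTest` with `m` unfixed coordinates. -/
noncomputable def unbiasedCost (ε' : ℝ) (m : ℕ) : ℕ :=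
  ((List.range' 1 (ceilLog ((m : ℝ) / ε') + 2)).map fun r =>
    ⌈50 * (m : ℝ) / (ε' * 2 ^ r)⌉₊ * (6 * 2 ^ r)).sum

theorem ensures_unbiasedTest (hV : Unate f ∨ V Verdict.reject) (ε' : ℝ) (d : PStr n) :
    Ensures f hf (unbiasedTest ε' d)
      ((if (unfixedCoords d).card = 0 then 0 else unbiasedCost ε' (unfixedCoords d).card : ℕ))
      0 V fun _ => True := by
  rw [unbiasedTest_eq]
  by_cases h : unfixedCoords d = ∅
  · rw [if_pos h]
    exact ensures_ret le_rfl trivial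
  · rw [if_neg h, if_neg (by rwa [Finset.card_eq_zero])]
    refine (ensures_forEach (c := fun r => ((⌈50 * ((unfixedCoords d).card : ℝ) /
      (ε' * 2 ^ r)⌉₊ * (6 * 2 ^ r) : ℕ) : ℕ∞)) fun r _ => ?_).mono_cost ?_
    · refine (ensures_repeatN _ (ensures_withRandom le_rfl
        (fun i _ => ensures_collisionTest hV _ i) fun _ => trivial)).mono_cost ?_
      exact_mod_cast Nat.mul_le_mul_left _ (by omega : 2 * (3 * 2 ^ r) ≤ 6 * 2 ^ r)
    · rw [unbiasedCost, Nat.cast_list_sum, List.map_map]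
      exact le_rfl

/-- The smaller of the probabilities of the two kinds of boundary edges in direction `i`. -/
noncomputable def minBoundary (f : Cube n → Bool) (i : Fin n) : ℝ :=
  min (freq (ones f) fun z => z i = false ∧ f (flipAt z i) = false)
    (freq (ones f) fun z => z i = true ∧ f (flipAt z i) = false)

/-- With 3 · 2^r samples each of the two kinds of boundary edges is missed with probability at most
e⁻³ < 1/20. -/
theorem surv_collisionTest_le (r : ℕ) {i : Fin n} (h : (1 / 2 : ℝ) ^ r ≤ minBoundary f i) :
    surv f hf (collisionTest (3 * 2 ^ r) i) ≤ 1 / 10 := by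
  have hmiss : ∀ p : Cube n → Prop, (1 / 2 : ℝ) ^ r ≤ freq (ones f) p →
      listProb (ones f) (3 * 2 ^ r) (fun S => ¬ ∃ z ∈ S, p z) ≤ 1 / 20 := by
    intro p hp
    have h1 : listProb (ones f) (3 * 2 ^ r) (fun S => ¬ ∃ z ∈ S, p z) ≤
        listProb (ones f) (3 * 2 ^ r) (fun S => ∀ z ∈ S, ¬ p z) :=
      listProb_mono fun S _ _ h z hz hpz => h ⟨z, hz, hpz⟩
    refine h1.trans ?_
    rw [listProb_forall_eq]
    have h2 : freq (ones f) (fun z => ¬ p z) ≤ Real.exp (-((1 / 2 : ℝ) ^ r)) := by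
      refine le_trans ?_ (Real.one_sub_le_exp_neg _)
      linarith [freq_add_not hf p]
    refine (pow_le_pow_left₀ (freq_nonneg _ _) h2 _).trans ?_
    rw [← Real.exp_nat_mul]
    have h3 : ((3 * 2 ^ r : ℕ) : ℝ) * -((1 / 2 : ℝ) ^ r) = -(((3 : ℕ) : ℝ) * 1) := by
      push_cast
      rw [one_div, inv_pow]
      field_simp
    rw [h3, Real.exp_neg, Real.exp_nat_mul]
    have h8 : (2.7182 : ℝ) ≤ Real.exp 1 := by have := Real.exp_one_gt_d9; linarith
    have h9 : (20 : ℝ) ≤ Real.exp 1 ^ 3 :=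
      le_trans (by norm_num) (pow_le_pow_left₀ (by norm_num) h8 3)
    rw [one_div]
    exact inv_anti₀ (by norm_num) h9
  have h1 := hmiss _ (h.trans (min_le_left _ _))
  have h2 := hmiss _ (h.trans (min_le_right _ _))
  refine (surv_samples_bind_le (G := fun S =>
    (∃ z ∈ S, z i = false ∧ f (flipAt z i) = false) ∧
      ∃ z ∈ S, z i = true ∧ f (flipAt z i) = false) fun S _ _ hG => ?_).trans
      ((listProb_not_and_le _ _ _).trans (by linarith))
  rw [surv_askAll_bind, if_pos]
  · simp
  · obtain ⟨⟨x, hx, hx1, hx2⟩, y, hy, hy1, hy2⟩ := hG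
    exact ⟨_, List.mem_map.2 ⟨x, hx, rfl⟩, _, List.mem_map.2 ⟨y, hy, rfl⟩, hx1, hy1, hx2, hy2⟩

/-- For x ≤ 1 the powers 2^(-r) ≤ x with 1 ≤ r ≤ R sum to at least (x - 2^(-R))/2. So the dyadic
levels together retain about half of the total weight. -/
theorem sum_levels_ge {ι : Type} (U : Finset ι) (w : ι → ℝ) (hw : ∀ i ∈ U, w i ≤ 1) (R : ℕ) :
    ∑ i ∈ U, (w i - (1 / 2) ^ R) / 2 ≤ ((List.range' 1 R).map fun r =>
      ∑ i ∈ U, if (1 / 2 : ℝ) ^ r ≤ w i then (1 / 2 : ℝ) ^ r else 0).sum := by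
  have key : ∀ x : ℝ, x ≤ 1 → ∀ R : ℕ, 0 ≤ ((List.range' 1 R).map fun r =>
      if (1 / 2 : ℝ) ^ r ≤ x then (1 / 2 : ℝ) ^ r else 0).sum ∧ (x - (1 / 2) ^ R) / 2 ≤
      ((List.range' 1 R).map fun r =>
        if (1 / 2 : ℝ) ^ r ≤ x then (1 / 2 : ℝ) ^ r else 0).sum := by
    intro x hx R
    induction R with
    | zero => simp; linarith
    | succ R ih =>
        rw [List.range'_1_concat, List.map_append, List.sum_append]
        simp only [List.map_cons, List.map_nil, List.sum_cons, List.sum_nil, add_zero]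
        have hpos : (0 : ℝ) < (1 / 2) ^ (1 + R) := by positivity
        have e : (1 / 2 : ℝ) ^ (1 + R) = (1 / 2) ^ R / 2 := by rw [pow_add]; ring
        rw [add_comm R 1]
        split_ifs with h
        · constructor <;> linarith [ih.1, ih.2]
        -- When the new power exceeds x the target is negative, which is why nonnegativity is part
        -- of the induction.
        · constructor <;> linarith [ih.1, ih.2]
  have hswap : ∀ l : List ℕ, (l.map fun r =>
      ∑ i ∈ U, if (1 / 2 : ℝ) ^ r ≤ w i then (1 / 2 : ℝ) ^ r else 0).sum =
      ∑ i ∈ U, (l.map fun r => if (1 / 2 : ℝ) ^ r ≤ w i then (1 / 2 : ℝ) ^ r else 0).sum := by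
    intro l
    induction l with
    | nil => simp
    | cons r l ih => simp only [List.map_cons, List.sum_cons, ih, Finset.sum_add_distrib]
  rw [hswap]
  exact Finset.sum_le_sum fun i hi => (key (w i) (hw i hi) R).2

/-- Level r runs about m/(ε 2^r) trials, each hitting a direction with `minBoundary` at least 2^(-r)
with probability c_r/m, where c_r counts these directions. The survival probabilities multiply, so
the exponents 2880/ε · 2^(-r) c_r add up to a multiple of the total mass. -/
theorem surv_unbiasedTest_le {d : PStr n} {ε : ℝ} (hε : 0 < ε)
    (h : 7 * ε / 32 ≤ ∑ i ∈ unfixedCoords d, minBoundary f i) :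
    surv f hf (unbiasedTest (ε / 64) d) ≤ 1 / 100 := by
  rw [unbiasedTest_eq, if_neg]
  swap
  · intro he
    rw [he, Finset.sum_empty] at h
    linarith
  set U := unfixedCoords d with hU
  have hne : U.Nonempty := by
    rw [Finset.nonempty_iff_ne_empty]
    intro he
    rw [he, Finset.sum_empty] at h
    linarith
  have hm : (0 : ℝ) < U.card := by exact_mod_cast hne.card_pos
  set R := ceilLog ((U.card : ℝ) / (ε / 64)) + 2 with hR
  have hlevel : ∀ r ∈ List.range' 1 R, surv f hf
      (repeatN ⌈50 * (U.card : ℝ) / (ε / 64 * 2 ^ r)⌉₊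
        (withRandom U (collisionTest (3 * 2 ^ r)))) ≤
      Real.exp (-(2880 / ε) * ∑ i ∈ U, if (1 / 2 : ℝ) ^ r ≤ minBoundary f i
        then (1 / 2 : ℝ) ^ r else 0) := by
    intro r _
    have hbody : surv f hf (withRandom U (collisionTest (3 * 2 ^ r))) ≤
        Real.exp (-(9 / 10 * ((∑ i ∈ U, if (1 / 2 : ℝ) ^ r ≤ minBoundary f i
          then (1 : ℝ) else 0) / U.card))) := by
      rw [surv_withRandom hne]
      have h1 : ∀ i ∈ U, surv f hf (collisionTest (3 * 2 ^ r) i) ≤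
          1 - 9 / 10 * if (1 / 2 : ℝ) ^ r ≤ minBoundary f i then (1 : ℝ) else 0 := by
        intro i _
        split_ifs with hi
        · refine (surv_collisionTest_le r hi).trans (by norm_num)
        · simpa using surv_le_one _
      refine (Finset.expect_le_expect h1).trans ?_
      rw [Finset.expect_sub_distrib, Finset.expect_const hne, ← Finset.mul_expect,
        Finset.expect_eq_sum_div_card]
      exact Real.one_sub_le_exp_neg _
    refine (surv_repeatN_le _ hbody).trans ?_
    rw [← Real.exp_nat_mul, Real.exp_le_exp]
    have hs : (∑ i ∈ U, if (1 / 2 : ℝ) ^ r ≤ minBoundary f i then (1 / 2 : ℝ) ^ r else 0) =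
        (1 / 2 : ℝ) ^ r * ∑ i ∈ U, if (1 / 2 : ℝ) ^ r ≤ minBoundary f i then (1 : ℝ) else 0 := by
      rw [Finset.mul_sum]
      exact Finset.sum_congr rfl fun i _ => by split_ifs <;> simp
    rw [hs]
    set c := ∑ i ∈ U, if (1 / 2 : ℝ) ^ r ≤ minBoundary f i then (1 : ℝ) else 0 with hc
    have hc0 : 0 ≤ c := Finset.sum_nonneg fun i _ => by split_ifs <;> norm_num
    have hceil := Nat.le_ceil (50 * (U.card : ℝ) / (ε / 64 * 2 ^ r))
    have h2 := mul_le_mul_of_nonneg_right hceil (show 0 ≤ 9 / 10 * (c / U.card) by positivity)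
    have h3 : 50 * (U.card : ℝ) / (ε / 64 * 2 ^ r) * (9 / 10 * (c / U.card)) =
        2880 / ε * ((1 / 2 : ℝ) ^ r * c) := by
      rw [one_div, inv_pow]; field_simp; ring
    linarith
  refine (surv_forEach_le hlevel).trans ?_
  have hprod : ∀ (l : List ℕ) (g : ℕ → ℝ) (a : ℝ),
      (l.map fun r => Real.exp (a * g r)).prod = Real.exp (a * (l.map g).sum) := by
    intro l g a
    induction l with
    | nil => simp
    | cons r l ih =>
        rw [List.map_cons, List.prod_cons, ih, ← Real.exp_add, List.map_cons, List.sum_cons,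
          mul_add]
  rw [hprod]
  have hw : ∀ i ∈ U, minBoundary f i ≤ 1 := fun i _ =>
    (min_le_left _ _).trans (freq_le_one hf _)
  have hsum := sum_levels_ge U (minBoundary f) hw R
  -- The two extra levels in R make the truncation loss m · 2^(-R) at most ε/256.
  have hpowR : (1 / 2 : ℝ) ^ R ≤ ε / 64 / U.card / 4 := by
    rw [hR, pow_add]
    have := half_pow_ceilLog (t := ε / 64 / U.card) (by positivity)
    rw [one_div_div] at this
    linarith
  have h4 : 13 * ε / 128 ≤ ∑ i ∈ U, (minBoundary f i - (1 / 2) ^ R) / 2 := by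
    rw [← Finset.sum_div, Finset.sum_sub_distrib, Finset.sum_const, nsmul_eq_mul]
    have h5 := mul_le_mul_of_nonneg_left hpowR hm.le
    have h6 : (U.card : ℝ) * (ε / 64 / U.card / 4) = ε / 256 := by field_simp; norm_num
    rw [h6] at h5
    linarith
  have h7 : -(2880 / ε) * ((List.range' 1 R).map fun r => ∑ i ∈ U,
      if (1 / 2 : ℝ) ^ r ≤ minBoundary f i then (1 / 2 : ℝ) ^ r else 0).sum ≤ -((7 : ℕ) : ℝ) := by
    have h8 := mul_le_mul_of_nonneg_left (h4.trans hsum) (show 0 ≤ 2880 / ε by positivity)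
    have h9 : 2880 / ε * (13 * ε / 128) = 292.5 := by field_simp; norm_num
    rw [h9] at h8
    rw [neg_mul]
    push_cast
    linarith
  refine ((Real.exp_le_exp.2 h7).trans (exp_neg_nat_le 7)).trans ?_
  norm_num

/-! ### Functions far from unate -/

theorem hdist_flipAt_le {d : PStr n} {x : Cube n} {i : Fin n}
    (h : d i = none ∨ d i = some (!(x i))) :
    hdist (toPStr (flipAt x i)) d ≤ hdist (toPStr x) d := by
  refine Finset.card_le_card fun j hj => ?_
  rw [mem_diffCoords] at hj ⊢
  by_cases hij : j = i
  · subst hij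
    rcases h with h | h
    · rw [h] at hj; cases hj
    · exact h
  · rwa [flipAt_of_ne _ hij] at hj

/-- Cutting f down to f' costs ε/8, so 7ε/8 is at most twice the number of violations of f' divided
by N. The fixed and the unfixed coordinates share 7ε/16, and one of them has half of it. -/
theorem mass_of_far {ε : ℝ} (hf : (ones f).Nonempty) (hfar : ε ≤ reldistUnate f)
    (d : PStr n) {M : ℕ} (hM : freq (ones f) (fun z => M < hdist (toPStr z) d) ≤ ε / 8) :
    7 * ε / 32 ≤ fixedMass f d M ∨ 7 * ε / 32 ≤ ∑ i ∈ unfixedCoords d, minBoundary f i := by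
  have hN : (0 : ℝ) < (ones f).card := by exact_mod_cast hf.card_pos
  set f' : Cube n → Bool := fun x => f x && decide (hdist (toPStr x) d ≤ M) with hf'
  -- On unfixed coordinates b is chosen so that the violations are the rarer kind of boundary edge,
  -- whose frequency is `minBoundary f i`.
  set b : Fin n → Bool := fun i => (d i).getD
    (decide ((freq (ones f) fun z => z i = false ∧ f (flipAt z i) = false) ≤
      freq (ones f) fun z => z i = true ∧ f (flipAt z i) = false)) with hb
  obtain ⟨g, hg, hcard⟩ := exists_unate_near f' b
  have hdist_fg := hfar.trans (reldistUnate_le f hg)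
  rw [reldist, le_div_iff₀ hN] at hdist_fg
  have h1 : ((symmDiff (ones f) (ones g)).card : ℝ) ≤
      (symmDiff (ones f) (ones f')).card + (symmDiff (ones f') (ones g)).card := by
    exact_mod_cast (Finset.card_le_card (symmDiff_triangle _ (ones f') _)).trans
      (Finset.card_union_le _ _)
  have h2 : ((symmDiff (ones f) (ones f')).card : ℝ) ≤ ε / 8 * (ones f).card := by
    rw [freq_eq_div, div_le_iff₀ hN] at hM
    refine le_trans ?_ hM
    norm_cast
    refine Finset.card_le_card fun x hx => ?_
    simp only [Finset.mem_symmDiff, mem_ones, hf', Bool.and_eq_true, decide_eq_true_eq] at hx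
    rw [Finset.mem_filter, mem_ones]
    rcases hx with hx | hx
    · exact ⟨hx.1, not_le.1 fun h => hx.2 ⟨hx.1, h⟩⟩
    · exact absurd hx.1.1 hx.2
  -- Moving towards d, or along an unfixed coordinate, does not increase the distance to d. Hence
  -- the cut creates no new violation: where f' drops, f itself drops.
  have hviol : ∀ i x, d i = none ∨ d i = some (b i) → x ∈ violations f' i (b i) →
      f x = true ∧ hdist (toPStr x) d ≤ M ∧ x i ≠ b i ∧ f (flipAt x i) = false := by
    intro i x hi hx
    simp only [violations, Finset.mem_filter, mem_ones, hf', Bool.and_eq_true,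
      decide_eq_true_eq] at hx
    obtain ⟨⟨h3, h4⟩, h5, h6⟩ := hx
    refine ⟨h3, h4, h5, ?_⟩
    have h7 : hdist (toPStr (flipAt x i)) d ≤ M := by
      refine (hdist_flipAt_le ?_).trans h4
      refine hi.imp_right fun hi => ?_
      rw [hi]
      revert h5
      cases x i <;> cases b i <;> simp
    simpa [h7] using h6
  have h3 : ∑ i ∈ unfixedCoords d, ((violations f' i (b i)).card : ℝ) ≤
      (ones f).card * ∑ i ∈ unfixedCoords d, minBoundary f i := by
    rw [Finset.mul_sum]
    refine Finset.sum_le_sum fun i hi => ?_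
    have hi' : d i = none := by simpa [unfixedCoords] using hi
    have hbi : b i = decide ((freq (ones f) fun z => z i = false ∧ f (flipAt z i) = false) ≤
        freq (ones f) fun z => z i = true ∧ f (flipAt z i) = false) := by
      simp [hb, hi']
    have h4 : (violations f' i (b i)).card ≤
        ((ones f).filter fun z => z i = (!(b i)) ∧ f (flipAt z i) = false).card := by
      refine Finset.card_le_card fun x hx => ?_
      have := hviol i x (Or.inl hi') hx
      rw [Finset.mem_filter, mem_ones]
      refine ⟨this.1, ?_, this.2.2.2⟩
      have h5 := this.2.2.1
      revert h5
      cases x i <;> cases b i <;> simp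
    have h5 : ((violations f' i (b i)).card : ℝ) ≤ (ones f).card *
        freq (ones f) fun z => z i = (!(b i)) ∧ f (flipAt z i) = false := by
      rw [freq_eq_div, mul_div_cancel₀ _ hN.ne']
      exact_mod_cast h4
    refine h5.trans (mul_le_mul_of_nonneg_left ?_ hN.le)
    rw [minBoundary]
    rcases le_or_gt (freq (ones f) fun z => z i = false ∧ f (flipAt z i) = false)
      (freq (ones f) fun z => z i = true ∧ f (flipAt z i) = false) with h6 | h6
    · rw [min_eq_left h6, hbi, decide_eq_true h6]; exact le_rfl
    · rw [min_eq_right h6.le, hbi, decide_eq_false (not_le.2 h6)]; exact le_rfl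
  have h4 : ∑ i ∈ fixedCoords d, ((violations f' i (b i)).card : ℝ) ≤
      (ones f).card * fixedMass f d M := by
    rw [fixedMass, Finset.expect_eq_sum_div_card, mul_div_cancel₀ _ hN.ne']
    have h5 : ∀ i ∈ fixedCoords d, ((violations f' i (b i)).card : ℝ) ≤ ∑ z ∈ ones f,
        if hdist (toPStr z) d ≤ M ∧ i ∈ badCoords f d z then (1 : ℝ) else 0 := by
      intro i hi
      have hi' : d i = some (b i) := by
        have : d i ≠ none := by simpa [fixedCoords] using hi
        obtain ⟨c, hc⟩ := Option.ne_none_iff_exists'.1 this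
        simp [hb, hc]
      rw [Finset.sum_boole]
      norm_cast
      refine Finset.card_le_card fun x hx => ?_
      have := hviol i x (Or.inr hi') hx
      rw [Finset.mem_filter, mem_ones, badCoords, Finset.mem_filter, mem_diffCoords]
      refine ⟨this.1, this.2.1, ?_, this.2.2.2⟩
      rw [hi']
      have h5 := this.2.2.1
      revert h5
      cases x i <;> cases b i <;> simp
    refine (Finset.sum_le_sum h5).trans ?_
    rw [Finset.sum_comm]
    refine Finset.sum_le_sum fun z _ => ?_
    split_ifs with hz
    · simp only [hz, true_and]
      rw [Finset.sum_boole]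
      norm_cast
      exact Finset.card_le_card fun i hi => (Finset.mem_filter.1 hi).2
    · simp [hz]
  have h5 : ((∑ i, (violations f' i (b i)).card : ℕ) : ℝ) =
      ∑ i ∈ fixedCoords d, ((violations f' i (b i)).card : ℝ) +
        ∑ i ∈ unfixedCoords d, ((violations f' i (b i)).card : ℝ) := by
    rw [Nat.cast_sum, ← Finset.sum_filter_add_sum_filter_not Finset.univ fun i => d i ≠ none]
    simp only [fixedCoords, unfixedCoords, not_not, ne_eq]
  have h6 : ((symmDiff (ones f') (ones g)).card : ℝ) ≤
      2 * ((∑ i, (violations f' i (b i)).card : ℕ) : ℝ) := by exact_mod_cast hcard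
  rw [h5] at h6
  by_contra hcon
  rw [not_or, not_le, not_le] at hcon
  have h7 := mul_lt_mul_of_pos_left hcon.1 hN
  have h8 := mul_lt_mul_of_pos_left hcon.2 hN
  linarith

end RelUnate

namespace RelUnate

open Finset Algo
open scoped BigOperators

variable {n : ℕ} {f : Cube n → Bool} {hf : (ones f).Nonempty} {V : Verdict → Prop}

/-! ### Correctness of the tester -/

/-- The part of the tester after the choice of `a`. -/
noncomputable def testerRest (n : ℕ) (ε δ : ℝ) (a : Cube n) : Algo n Unit :=
  samples (100 * ceilLog (1 / δ)) >>= fun S => checkSamples a S (δ / 12) >>=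
    fun _ => iterativeBias a δ >>= fun d => preprocessing d ε δ >>= fun M =>
    biasedTest M (ε / 64) d >>= fun _ => unbiasedTest (ε / 64) d >>= fun _ =>
    (halt Verdict.accept : Algo n Unit)

theorem ensures_tests_sure (hV : Unate f ∨ V Verdict.reject) (hacc : V Verdict.accept)
    (M : ℕ) (ε : ℝ) (d : PStr n) :
    Ensures f hf (biasedTest M ε d >>= fun _ => unbiasedTest ε d >>= fun _ =>
      (halt Verdict.accept : Algo n Unit)) ⊤ 0 V fun _ => False :=
  ((ensures_biasedTest hV M ε d).sure_bind (c₂ := ⊤) (η := 0) le_rfl fun _ _ =>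
    ((ensures_unbiasedTest hV ε d).sure_bind (c₂ := 0) (η := 0) le_rfl
      fun _ _ => ensures_halt le_rfl hacc).mono_cost le_top).mono_cost le_top

theorem ensures_testerRest_sure (hV : Unate f ∨ V Verdict.reject) (hacc : V Verdict.accept)
    (ε δ : ℝ) {a : Cube n} (ha : a ∈ ones f) :
    Ensures f hf (testerRest n ε δ a) ⊤ 0 V fun _ => False := by
  refine (ensures_samples_zero.sure_bind (c₂ := ⊤) (η := 0) le_rfl fun S hS => ?_).mono_cost le_top
  refine ((ensures_checkSamples hV ha hS.2 _).sure_bind (c₂ := ⊤) (η := 0) le_rfl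
    fun _ _ => ?_).mono_cost le_top
  refine ((ensures_iterativeBias_sure hV hacc ha δ).sure_bind (c₂ := ⊤) (η := 0) le_rfl
    fun d _ => ?_).mono_cost le_top
  exact ((ensures_preprocessing_sure hV d ε δ).sure_bind (c₂ := ⊤) (η := 0) le_rfl
    fun M _ => ensures_tests_sure hV hacc M _ d).mono_cost le_top

/-- The postcondition `False` says that the tester always halts. For unate f it is used with
acceptance as the only allowed verdict. -/
theorem ensures_tester_sure (hV : Unate f ∨ V Verdict.reject) (hacc : V Verdict.accept)
    (ε δ : ℝ) : Ensures f hf (unatenessTesterUnknownN n ε δ) ⊤ 0 V fun _ => False :=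
  (ensures_sample_bind (k := testerRest n ε δ) (c := ⊤)
    fun _ ha => ensures_testerRest_sure hV hacc ε δ ha).mono_cost le_top

theorem ensures_tests_of_far {ε : ℝ} (hε : 0 < ε) (hfar : ε ≤ reldistUnate f) {d : PStr n}
    (hd : Reliable f d) {M : ℕ} (hM : freq (ones f) (fun z => M < hdist (toPStr z) d) ≤ ε / 8)
    (hV : V Verdict.reject) : Ensures f hf (biasedTest M (ε / 64) d >>= fun _ =>
      unbiasedTest (ε / 64) d >>= fun _ => (halt Verdict.accept : Algo n Unit)) ⊤ (1 / 100) V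
        fun _ => False := by
  have hb := (ensures_biasedTest (hf := hf) (f := f) (Or.inr hV) M (ε / 64) d).mono_cost le_top
  have hu := (ensures_unbiasedTest (hf := hf) (f := f) (Or.inr hV) (ε / 64) d).mono_cost le_top
  rcases mass_of_far hf hfar d hM with h | h
  · exact ((hb.of_surv (Q := fun _ => False) (surv_biasedTest_le hd hε h)).bind (η₂ := 0) (c₂ := 0)
      le_rfl fun _ h => h.elim).mono le_top (add_zero _).le (fun _ => id) fun _ => id
  · exact (hb.sure_bind (by norm_num) (c₂ := ⊤ + 0) fun _ _ =>
      ((hu.of_surv (Q := fun _ => False) (surv_unbiasedTest_le hε h)).bind (η₂ := 0) (c₂ := 0)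
        le_rfl fun _ h => h.elim).mono_prob (add_zero _).le).mono_cost le_top

/-- The errors are 1/10 for an unreliable d or premature acceptance, 1/10 for too small an M, and
1/100 for the final tests. The other steps can only reject. -/
theorem ensures_testerRest_reject (hV : V Verdict.reject) {ε δ : ℝ} (hε : 0 < ε) (hε1 : ε ≤ 1)
    (hδ : 0 < δ) (hδ1 : δ < 1) (hfar : ε ≤ reldistUnate f) {a : Cube n} (ha : a ∈ ones f) :
    Ensures f hf (testerRest n ε δ a) ⊤ (1 / 3) V fun _ => False := by
  refine (ensures_samples_zero.sure_bind (c₂ := ⊤) (η := 1 / 3) (by norm_num)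
    fun S hS => ?_).mono_cost le_top
  refine ((ensures_checkSamples (Or.inr hV) ha hS.2 _).sure_bind (c₂ := ⊤) (η := 1 / 3)
    (by norm_num) fun _ _ => ?_).mono_cost le_top
  refine ((ensures_iterativeBias_reliable (Or.inr hV) ha hδ hδ1).bind (c₂ := ⊤)
    (η₂ := 1 / 10 + 1 / 100) (by norm_num) fun d hd => ?_).mono le_top (by norm_num)
      (fun _ => id) fun _ => id
  refine ((ensures_preprocessing_tail (Or.inr hV) d hε hε1 δ).bind (c₂ := ⊤) (by norm_num)
    fun M hM => ?_).mono_cost le_top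
  exact ensures_tests_of_far hε hfar hd hM hV

theorem ensures_tester_reject (hV : V Verdict.reject) {ε δ : ℝ} (hε : 0 < ε) (hε1 : ε ≤ 1)
    (hδ : 0 < δ) (hδ1 : δ < 1) (hfar : ε ≤ reldistUnate f) :
    Ensures f hf (unatenessTesterUnknownN n ε δ) ⊤ (1 / 3) V fun _ => False :=
  (ensures_sample_bind (k := testerRest n ε δ) (c := ⊤)
    fun _ ha => ensures_testerRest_reject hV hε hε1 hδ hδ1 hfar ha).mono_cost le_top

/-! ### Query complexity -/

section cost

theorem logb_le_add {T x : ℝ} (hT : 1 ≤ T) (hx : 0 < x) {k : ℕ} (h : x ≤ 2 ^ k * T) :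
    Real.logb 2 x ≤ k + Real.logb 2 (T + 2) := by
  have h1 : Real.logb 2 x ≤ Real.logb 2 (2 ^ k * (T + 2)) := by
    refine Real.logb_le_logb_of_le (by norm_num) hx (h.trans ?_)
    have : (0 : ℝ) < 2 ^ k := by positivity
    nlinarith
  rw [Real.logb_mul (by positivity) (by positivity), Real.logb_pow,
    Real.logb_self_eq_one (by norm_num), mul_one] at h1
  exact h1

theorem one_le_logb_add_two {T : ℝ} (hT : 1 ≤ T) : 1 ≤ Real.logb 2 (T + 2) := by
  rw [Real.le_logb_iff_rpow_le (by norm_num) (by positivity), Real.rpow_one]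
  linarith

theorem clog_le_logb_add_one {N : ℕ} (hN : 1 ≤ N) :
    (Nat.clog 2 N : ℝ) ≤ Real.logb 2 N + 1 := by
  have h := Real.natCeil_logb_natCast 2 N
  rw [← h]
  push_cast
  exact (Nat.ceil_lt_add_one (Real.logb_nonneg (by norm_num) (by exact_mod_cast hN))).le

theorem ceilLog_le {t : ℝ} (ht : 1 ≤ t) : (ceilLog t : ℝ) ≤ Real.logb 2 t + 1 :=
  (Nat.ceil_lt_add_one (Real.logb_nonneg (by norm_num) ht)).le

theorem two_pow_ceilLog_le {t : ℝ} (ht : 1 ≤ t) : (2 : ℝ) ^ ceilLog t ≤ 2 * t := by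
  have h := ceilLog_le ht
  have h1 : (ceilLog t : ℝ) ≤ Real.logb 2 (2 * t) := by
    rw [Real.logb_mul (by norm_num) (by positivity), Real.logb_self_eq_one (by norm_num)]
    linarith
  rwa [Real.le_logb_iff_rpow_le (by norm_num) (by positivity), Real.rpow_natCast] at h1

variable {T ε δ : ℝ}

theorem ceilLog_div_le (hδ : 0 < δ) (hδ1 : δ < 1) (hT : 1 ≤ T) (hΛ : Real.logb 2 (1 / δ) ≤ T)
    {a : ℝ} (ha : 1 ≤ a) : (ceilLog (1 / (δ / a)) : ℝ) ≤ Real.logb 2 a + 2 * T := by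
  have h1 : (1 : ℝ) ≤ 1 / δ := by rw [le_div_iff₀ hδ]; linarith
  have h2 : 1 / (δ / a) = a * (1 / δ) := by rw [one_div_div]; ring
  rw [h2]
  refine (ceilLog_le (by nlinarith)).trans ?_
  rw [Real.logb_mul (by positivity) (by positivity)]
  linarith

/-- Since 2^J is at most 14T, a round costs O(T) apart from a logarithm, and J + 1 ≤ 6 log(T + 2)
rounds are run. The bound log(T + 2) on both factors gives the exponent 2 of the main theorem. -/
theorem loop_cost_le (hδ : 0 < δ) (hδ1 : δ < 1) (hT : 1 ≤ T) (hf : (ones f).Nonempty)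
    (hΛ : Real.logb 2 (1 / δ) ≤ T) (hν : 1 + Real.logb 2 (ones f).card ≤ T) :
    (((loopRounds f + 1) * biasCost δ (2 ^ loopRounds f) : ℕ) : ℝ) ≤
      1500000 * (T * Real.logb 2 (T + 2) ^ 2) := by
  have hL := one_le_logb_add_two hT
  set L := Real.logb 2 (T + 2) with hLdef
  set K := Nat.clog 2 (ones f).card + 6 with hK
  have hK1 : (1 : ℝ) ≤ K := by
    rw [hK]; push_cast; linarith [Nat.cast_nonneg (α := ℝ) (Nat.clog 2 (ones f).card)]
  have hKT : (K : ℝ) ≤ 7 * T := by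
    have := clog_le_logb_add_one hf.card_pos
    rw [hK]; push_cast; linarith
  have hJeq : loopRounds f = ceilLog (K : ℝ) := by
    rw [loopRounds, ceilLog, ← hK]
    exact (Real.natCeil_logb_natCast 2 K).symm
  set J := loopRounds f with hJ
  have hJL : (J : ℝ) ≤ 5 * L := by
    have h1 := ceilLog_le hK1
    have h2 := logb_le_add (k := 3) hT (by linarith) (show (K : ℝ) ≤ 2 ^ 3 * T by linarith)
    push_cast at h2
    rw [← hJeq] at h1
    linarith
  have hJ2 : (2 : ℝ) ^ J ≤ 14 * T := by
    have := two_pow_ceilLog_le hK1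
    rw [← hJeq] at this
    linarith
  have hlam : (ceilLog (1 / δ) : ℝ) ≤ 2 * T := by
    have := ceilLog_le (t := 1 / δ) (by rw [le_div_iff₀ hδ]; linarith)
    linarith
  have hJ1 : (1 : ℝ) ≤ 2 ^ J := one_le_pow₀ (by norm_num)
  have hcl : (ceilLog (1 / (δ / (48 * ((2 ^ J : ℕ) : ℝ)))) : ℝ) ≤ 10 + L + 2 * T := by
    refine (ceilLog_div_le hδ hδ1 hT hΛ (by push_cast; linarith)).trans ?_
    have := logb_le_add (x := 48 * ((2 ^ J : ℕ) : ℝ)) (k := 10) hT (by push_cast; positivity)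
      (by push_cast; linarith)
    push_cast at this ⊢
    linarith
  have hTL : T ≤ T * L := le_mul_of_one_le_right (by linarith) hL
  have hLT : L ≤ T * L := le_mul_of_one_le_left (by linarith) hT
  have hcost : (biasCost δ (2 ^ J) : ℝ) ≤ 250000 * (T * L) := by
    rw [biasCost, biasSamples]
    push_cast at hcl ⊢
    linarith
  rw [Nat.cast_mul]
  have hJ1' : ((J + 1 : ℕ) : ℝ) ≤ 6 * L := by push_cast; linarith
  calc _ ≤ 6 * L * (250000 * (T * L)) :=
        mul_le_mul hJ1' hcost (Nat.cast_nonneg _) (by positivity)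
    _ = _ := by ring

/-- Repetitions times samples is O(m/ε) at every level; rounding up adds at most 6 · 2^r, which is
O(T) up to the last level. There are O(log(T + 2)) levels. -/
theorem unbiasedCost_le (hε : 0 < ε) (hε1 : ε ≤ 1) (hT : 1 ≤ T) {m : ℕ} (hm : 1 ≤ m)
    (hmT : (m : ℝ) / ε ≤ 40 * T) :
    (unbiasedCost (ε / 64) m : ℝ) ≤ 16000000 * (T * Real.logb 2 (T + 2)) := by
  have hL := one_le_logb_add_two hT
  set L := Real.logb 2 (T + 2) with hLdef
  have hm' : (1 : ℝ) ≤ m := by exact_mod_cast hm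
  set x : ℝ := (m : ℝ) / (ε / 64) with hx
  have hxeq : x = 64 * (m / ε) := by rw [hx]; field_simp
  have hx1 : 1 ≤ x := by
    rw [hx, le_div_iff₀ (by positivity)]; linarith
  have hxT : x ≤ 2560 * T := by rw [hxeq]; linarith
  set R := ceilLog x + 2 with hR
  have hRL : (R : ℝ) ≤ 16 * L := by
    have h1 := ceilLog_le hx1
    have h2 := logb_le_add (k := 12) hT (by linarith) (show x ≤ 2 ^ 12 * T by linarith)
    rw [hR]; push_cast at h2 ⊢
    linarith
  have hR2 : (2 : ℝ) ^ R ≤ 20480 * T := by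
    have := two_pow_ceilLog_le hx1
    rw [hR, pow_add]
    linarith
  rw [unbiasedCost, ← hx, ← hR, Nat.cast_list_sum, List.map_map]
  refine (List.sum_le_card_nsmul _ (1000000 * T) ?_).trans ?_
  · intro y hy
    obtain ⟨r, hr, rfl⟩ := List.mem_map.1 hy
    rw [List.mem_range'_1] at hr
    have hpow : (2 : ℝ) ^ r ≤ 2 ^ R := pow_le_pow_right₀ (by norm_num) (by omega)
    have hp : (0 : ℝ) < 2 ^ r := by positivity
    have h1 : 50 * (m : ℝ) / (ε / 64 * 2 ^ r) = 50 * x / 2 ^ r := by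
      rw [hx]; field_simp
    have h2 : (⌈50 * (m : ℝ) / (ε / 64 * 2 ^ r)⌉₊ : ℝ) ≤ 50 * x / 2 ^ r + 1 := by
      rw [h1]
      exact (Nat.ceil_lt_add_one (by positivity)).le
    have h3 := mul_le_mul_of_nonneg_right h2 (show (0 : ℝ) ≤ 6 * 2 ^ r by positivity)
    have h4 : (50 * x / 2 ^ r + 1) * (6 * 2 ^ r) = 300 * x + 6 * 2 ^ r := by field_simp; ring
    simp only [Function.comp]
    push_cast
    linarith
  · rw [List.length_map, List.length_range', nsmul_eq_mul]
    have := mul_le_mul_of_nonneg_right hRL (show 0 ≤ 1000000 * T by positivity)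
    linarith

end cost

/-- The errors δ/4 + δ/16 of IterativeBias and 3δ/16 of Preprocessing sum to δ/2. Outside these
events M ≤ 1 + log N and at most 40 log N coordinates are unfixed, so the last two tests are cheap
with certainty. -/
theorem ensures_tester_cost (hf : (ones f).Nonempty) {ε δ : ℝ} (hε : 0 < ε) (hε1 : ε ≤ 1)
    (hδ : 0 < δ) (hδ1 : δ < 1) :
    Ensures f hf (unatenessTesterUnknownN n ε δ)
      ((⌊20000000 * quasilinear 2 ((1 + Real.logb 2 ((ones f).card : ℝ)) / ε +
        Real.logb 2 (1 / δ))⌋₊ : ℕ)) δ (fun _ => True) fun _ => True := by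
  set ν := Real.logb 2 ((ones f).card : ℝ) with hνdef
  set T := (1 + ν) / ε + Real.logb 2 (1 / δ) with hTdef
  have hN : (1 : ℝ) ≤ (ones f).card := by exact_mod_cast hf.card_pos
  have hν0 : 0 ≤ ν := Real.logb_nonneg (by norm_num) hN
  have hδ' : (1 : ℝ) ≤ 1 / δ := by rw [le_div_iff₀ hδ]; linarith
  have hΛ0 : 0 ≤ Real.logb 2 (1 / δ) := Real.logb_nonneg (by norm_num) hδ'
  have hνε : 1 + ν ≤ (1 + ν) / ε := by
    rw [le_div_iff₀ hε]
    nlinarith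
  have hinv : 1 / ε ≤ T := by
    have : 1 / ε ≤ (1 + ν) / ε := by gcongr; linarith
    linarith
  have hΛ : Real.logb 2 (1 / δ) ≤ T := by linarith
  have hνT : 1 + ν ≤ T := by linarith
  have hνεT : (1 + ν) / ε ≤ T := by linarith
  have hT : 1 ≤ T := by linarith
  have hL := one_le_logb_add_two hT
  set L := Real.logb 2 (T + 2) with hLdef
  have hV : Unate f ∨ (fun _ : Verdict => True) Verdict.reject := Or.inr trivial
  have hlam : (ceilLog (1 / δ) : ℝ) ≤ 2 * T := by linarith [ceilLog_le hδ']
  set cu := ⌊16000000 * (T * L)⌋₊ with hcu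
  set cb := 520 * ⌈(1 + ν) / (ε / 64)⌉₊ with hcb
  have hTL : T ≤ T * L := le_mul_of_one_le_right (by linarith) hL
  have hTL2 : T * L ≤ T * L ^ 2 := by nlinarith
  have hub : ∀ d : PStr n, ((unfixedCoords d).card : ℝ) ≤ 40 * ν →
      Ensures f hf (unbiasedTest (ε / 64) d) (cu : ℕ) 0 (fun _ => True) fun _ => True := by
    intro d hd
    refine (ensures_unbiasedTest hV _ d).mono_cost ?_
    norm_cast
    split_ifs with h0
    · exact Nat.zero_le _
    · refine Nat.le_floor (unbiasedCost_le hε hε1 hT (by omega) ?_)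
      have h1 : ((unfixedCoords d).card : ℝ) / ε ≤ (40 * (1 + ν)) / ε := by gcongr; linarith
      rw [mul_div_assoc] at h1
      linarith
  have hbb : ∀ (M : ℕ) (d : PStr n), (M : ℝ) ≤ 1 + ν →
      Ensures f hf (biasedTest M (ε / 64) d) (cb : ℕ) 0 (fun _ => True) fun _ => True := by
    intro M d hM
    refine (ensures_biasedTest hV M _ d).mono_cost ?_
    norm_cast
    refine Nat.mul_le_mul_left _ (Nat.ceil_le_ceil ?_)
    gcongr
  have hall := ensures_sample_bind (f := f) (hf := hf) (V := fun _ => True)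
    (k := testerRest n ε δ) (Q := fun _ => True) fun a ha =>
    ensures_samples_zero.sure_bind (show 0 ≤ δ / 4 + δ / 16 + (3 * (δ / 16) + 0) by positivity)
      fun S hS =>
    (ensures_checkSamples hV ha hS.2 (δ / 12)).sure_bind (by positivity) fun _ _ =>
    (ensures_iterativeBias_cost ha hδ hδ1).bind (by positivity) fun d hd =>
    (ensures_preprocessing_cost hV hd.1 ε hδ hδ1).bind le_rfl fun M hM =>
    (hbb M d hM).sure_bind le_rfl fun _ _ =>
    (hub d hd.2).sure_bind le_rfl (c₂ := 0) fun _ _ => ensures_halt le_rfl trivial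
  refine hall.mono ?_ (by linarith) (fun _ => id) fun _ => id
  have hloop := loop_cost_le hδ hδ1 hT hf hΛ hνT
  have hc12 : (ceilLog (1 / (δ / 12)) : ℝ) ≤ 6 * T := by
    have h1 := ceilLog_div_le hδ hδ1 hT hΛ (a := 12) (by norm_num)
    have h2 : Real.logb 2 12 ≤ 4 := by
      rw [Real.logb_le_iff_le_rpow (by norm_num) (by norm_num)]
      norm_num
    linarith
  have hclog : (Nat.clog 2 (2 * (ones f).card) : ℝ) ≤ 2 * T := by
    have h1 := clog_le_logb_add_one (N := 2 * (ones f).card) (by have := hf.card_pos; omega)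
    push_cast at h1
    rw [Real.logb_mul (by norm_num) (by positivity), Real.logb_self_eq_one (by norm_num)] at h1
    linarith
  have hceil : (⌈1 / ε⌉₊ : ℝ) ≤ 2 * T := by
    linarith [(Nat.ceil_lt_add_one (show 0 ≤ 1 / ε by positivity)).le]
  have hcbT : (⌈(1 + ν) / (ε / 64)⌉₊ : ℝ) ≤ 65 * T := by
    have h1 := (Nat.ceil_lt_add_one (show 0 ≤ (1 + ν) / (ε / 64) by positivity)).le
    have h2 : (1 + ν) / (ε / 64) = 64 * ((1 + ν) / ε) := by field_simp
    linarith
  have hcuT : (cu : ℝ) ≤ 16000000 * (T * L) := Nat.floor_le (by positivity)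
  norm_cast
  refine Nat.le_floor ?_
  rw [quasilinear, ← hLdef]
  rw [hcb]
  push_cast at hloop ⊢
  nlinarith

theorem Algo.one_sub_le_prob {α : Type} {A : Algo n α} {c : ℕ∞} {η : ℝ} {Q : α → Prop}
    (h : Ensures f hf A c η V Q) {P : Verdict ⊕ α → ℕ → Prop}
    (hP : ∀ o (q : ℕ), (q : ℕ∞) ≤ c → Sum.elim V Q o → P o q) : 1 - η ≤ A.prob f hf P := by
  have h1 := prob_add_not (f := f) (hf := hf) A fun o q => (q : ℕ∞) ≤ c ∧ Sum.elim V Q o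
  have h2 : A.prob f hf (fun o q => (q : ℕ∞) ≤ c ∧ Sum.elim V Q o) ≤ A.prob f hf P :=
    prob_mono A fun o q h => hP o q h.1 h.2
  have h3 : A.prob f hf (fun o q => ¬ ((q : ℕ∞) ≤ c ∧ Sum.elim V Q o)) ≤ η := h
  linarith

end RelUnate

/-! ### The main theorem -/

theorem mainTheorem2 :
    ∃ (C : ℝ) (c : ℕ), 0 < C ∧
      ∀ (n : ℕ) (ε δ : ℝ), 0 < ε → ε ≤ 1 → 0 < δ → δ < 1 →
      ∀ (f : RelUnate.Cube n → Bool) (hf : (RelUnate.ones f).Nonempty),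
        (1 - δ ≤ (RelUnate.unatenessTesterUnknownN n ε δ).prob f hf (fun _ q =>
            (q : ℝ) ≤ C * RelUnate.quasilinear c
              ((1 + Real.logb 2 ((RelUnate.ones f).card : ℝ)) / ε + Real.logb 2 (1 / δ)))) ∧
        (RelUnate.Unate f →
          (RelUnate.unatenessTesterUnknownN n ε δ).prob f hf
            (fun o _ => o = Sum.inl RelUnate.Verdict.accept) = 1) ∧
        (ε ≤ RelUnate.reldistUnate f →
          2 / 3 ≤ (RelUnate.unatenessTesterUnknownN n ε δ).prob f hf
            (fun o _ => o = Sum.inl RelUnate.Verdict.reject)) := by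
  refine ⟨20000000, 2, by norm_num, fun n ε δ hε hε1 hδ hδ1 f hf =>
    ⟨?_, fun hU => ?_, fun hfar => ?_⟩⟩
  · refine RelUnate.Algo.one_sub_le_prob (RelUnate.ensures_tester_cost hf hε hε1 hδ hδ1) ?_
    intro o q hq _
    have hq' := Nat.cast_le.1 hq
    -- For q ≠ 0 the bound by a natural floor converts to the real bound directly; for q = 0 the
    -- bound must be shown nonnegative.
    by_cases h0 : q = 0
    · subst h0
      refine le_of_eq_of_le Nat.cast_zero ?_
      have hN : (1 : ℝ) ≤ (RelUnate.ones f).card := by exact_mod_cast hf.card_pos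
      have h1 : 0 ≤ Real.logb 2 ((RelUnate.ones f).card : ℝ) := Real.logb_nonneg (by norm_num) hN
      have h2 : 0 ≤ Real.logb 2 (1 / δ) :=
        Real.logb_nonneg (by norm_num) (by rw [le_div_iff₀ hδ]; linarith)
      unfold RelUnate.quasilinear
      positivity
    · exact (Nat.le_floor_iff' h0).1 hq'
  · refine le_antisymm (RelUnate.Algo.prob_le_one _ _) ?_
    have := RelUnate.Algo.one_sub_le_prob (RelUnate.ensures_tester_sure (hf := hf)
      (V := fun v => v = RelUnate.Verdict.accept) (Or.inl hU) rfl ε δ)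
      (P := fun o _ => o = Sum.inl RelUnate.Verdict.accept) (by
        rintro (v | a) q _ h
        · exact congrArg Sum.inl h
        · exact h.elim)
    linarith
  · have := RelUnate.Algo.one_sub_le_prob
      (RelUnate.ensures_tester_reject (hf := hf) (V := fun v => v = RelUnate.Verdict.reject)
        rfl hε hε1 hδ hδ1 hfar)
      (P := fun o _ => o = Sum.inl RelUnate.Verdict.reject) (by
        rintro (v | a) q _ h
        · exact congrArg Sum.inl h
        · exact h.elim)
    linarith
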